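/- Let $\Sigma=\{1,\dots,\sigma\}$, $\sigma\ge 1$, and let $w$ be a word of length $n$ over $\Sigma$ in which every letter of $\Sigma$ occurs. A word $v\in\Sigma^*$ is an absent subsequence of $w$ if it is not a (scattered) subsequence of $w$, and a shortest absent subsequence (SAS) of $w$ if, in addition, no absent subsequence of $w$ over $\Sigma$ is shorter. Let $w=\mathrm{ar}_w(1)\cdots \mathrm{ar}_w(k)\,r(w)$ be the arch factorisation of $w$: every arch $\mathrm{ar}_w(\ell)$ contains all letters of $\Sigma$, its last letter occurs exactly once in it, and some letter of $\Sigma$ does not occur in $r(w)$. Positions of $w$ are counted from $1$. For $\ell\in[1:k]$ and $a\in\Sigma$ define: - $\mathrm{firstPosArch}[\ell][a]$ and $\mathrm{lastPosArch}[\ell][a]$: the leftmost and the rightmost position of $a$ inside $\mathrm{ar}_w(\ell)$; - $\mathrm{dist}[i]$, $i\in[1:n]$: the least length of a word over $\Sigma$ that starts with $w[i]$ and is not a subsequence of $w[i:n]$; - $L'_\ell=\{\mathrm{lastPosArch}[\ell][a]\mid a\in\Sigma\}\setminus\{\mathrm{lastPosArch}[\ell][a]\mid \mathrm{dist}[\mathrm{firstPosArch}[\ell+1][a]]>k-\ell+1\}$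 for $\ell<k$, and $L'_k=\{\mathrm{lastPosArch}[k][a]\mid a\in\Sigma\}\setminus\{\mathrm{lastPosArch}[k][a]\mid a \text{ occurs in } r(w)\}$; - $\mathrm{sortedLast}[\ell][\cdot]$: the elements of $L'_\ell$ in ascending order, indexed from $1$; - $\mathrm{Leq}[\ell][i]=\max(\{t\mid \mathrm{sortedLast}[\ell][t]\le i\}\cup\{-\infty\})$ for every position $i$ of $\mathrm{ar}_w(\ell)$; - $\mathrm{Lex}[\ell][t]$, $1\le t\le |L'_\ell|$: the position among $\mathrm{sortedLast}[\ell][1],\dots,\mathrm{sortedLast}[\ell][t]$ that carries the smallest letter; - $\mathrm{startSAS}$: the list of the positions $\mathrm{firstPosArch}[1][a]$, $a\in\Sigma$, with $\mathrm{dist}[\mathrm{firstPosArch}[1][a]]=k+1$; and $\mathrm{init}$: the element of $\mathrm{startSAS}$ that carries the smallest letter. The computational model is the unit-cost RAM with logarithmic word size: each operation takes one step and all values, including addresses, are $O(n)$. There are fixed programs (independent of $w$), with constants independent of $w$, such that the following hold. 0. Given $w$, $n$ and $\sigma$, the number of arches, their end positions, the arrays $\mathrm{firstPosArch}$, $\mathrm{lastPosArch}$,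 $\mathrm{sortedLast}$ (with the lengths of its rows), $\mathrm{Leq}$, $\mathrm{Lex}$, the list $\mathrm{startSAS}$ (with its length) and the position $\mathrm{init}$ are computed in $O(n)$ time. Given these data (and $w$, $n$, $\sigma$), and leaving them intact: 1. for every word $u\in\Sigma^*$ of length $k+1$, it is decided in $O(k)$ time whether $u$ is an SAS of $w$; 2. the lexicographically smallest SAS of $w$ is computed in $O(k)$ time; 3. all SAS of $w$ are output, each exactly once, with polynomial delay: the numbers of steps before the first output word is completed, between the completions of two consecutive output words, and after the last one until the program halts are bounded by a fixed polynomial in $n$. -/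

import Mathlib

/-! ### Words, absent subsequences, arch factorisation

Letters are natural numbers; a word is a `List ℕ`; positions are counted from `1`. -/

/-- `w` is a word over `{1, …, σ}` in which every letter of that alphabet occurs. -/
def IsWordOver (σ : ℕ) (w : List ℕ) : Prop :=
  ∀ a, a ∈ w ↔ 1 ≤ a ∧ a ≤ σ

/-- The letter `w[i]`, for `1 ≤ i ≤ |w|`. -/
def letterAt (w : List ℕ) (i : ℕ) : ℕ := w.getD (i - 1) 0

/-- `v` is a word over `alph(w)` that is not a subsequence of `w`. -/
def IsAbsent (w v : List ℕ) : Prop :=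
  (∀ a ∈ v, a ∈ w) ∧ ¬ v.Sublist w

/-- `v` is a shortest absent subsequence of `w`. -/
def IsSAS (w v : List ℕ) : Prop :=
  IsAbsent w v ∧ ∀ v', IsAbsent w v' → v.length ≤ v'.length

/-- The arch factorisation `w = ar(1) ⋯ ar(k) r`: every arch contains all letters of `w`, its last
letter occurs only once in it, and some letter of `w` does not occur in the rest `r`. -/
structure ArchFactorization (w : List ℕ) where
  arches : List (List ℕ)
  rest : List ℕ
  eq_append : arches.flatten ++ rest = w
  arch_universal : ∀ x ∈ arches, ∀ a ∈ w, a ∈ x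
  arch_last : ∀ x ∈ arches, ∃ (y : List ℕ) (a : ℕ), x = y ++ [a] ∧ a ∉ y
  rest_missing : ∃ a ∈ w, a ∉ rest

/-- Every nonempty word has an arch factorisation. -/
theorem ArchFactorization.nonempty_of_ne_nil (w : List ℕ) (hw : w ≠ []) :
    Nonempty (ArchFactorization w) := by
  have key : ∀ (m : ℕ) (v : List ℕ), v.length = m →
      ∃ (L : List (List ℕ)) (r : List ℕ), L.flatten ++ r = v ∧
        (∀ x ∈ L, ∀ a ∈ w, a ∈ x) ∧
        (∀ x ∈ L, ∃ (y : List ℕ) (a : ℕ), x = y ++ [a] ∧ a ∉ y) ∧ ∃ a ∈ w, a ∉ r := by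
    intro m
    induction m using Nat.strong_induction_on with
    | _ m ih =>
      intro v hv
      by_cases h : ∃ a ∈ w, a ∉ v
      · exact ⟨[], v, by simp, by simp, by simp, h⟩
      · push Not at h
        have hex : ∃ g, ∀ a ∈ w, a ∈ v.take g := ⟨v.length, by simpa using h⟩
        classical
        have hg := Nat.find_spec hex
        set g := Nat.find hex with hgdef
        obtain ⟨b, hb⟩ := List.exists_mem_of_ne_nil w hw
        have hg0 : 0 < g := by
          rcases Nat.eq_zero_or_pos g with h0 | h0
          · have := hg b hb
            simp [h0] at this
          · exact h0
        obtain ⟨a, haw, hna⟩ : ∃ a ∈ w, a ∉ v.take (g - 1) := by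
          have := Nat.find_min hex (m := g - 1) (by omega)
          push Not at this
          exact this
        have hlt : g - 1 < v.length := by
          by_contra hcon
          exact hna (by rw [List.take_of_length_le (by omega)]; exact h a haw)
        have htake : v.take g = v.take (g - 1) ++ [v[g - 1]] := by
          rw [List.take_append_getElem hlt, Nat.sub_add_cancel hg0]
        have hav : a = v[g - 1] := by
          have h1 := hg a haw
          rw [htake, List.mem_append] at h1
          rcases h1 with h1 | h1
          · exact absurd h1 hna
          · simpa using h1
        obtain ⟨L, r, h1, h2, h3, h4⟩ := ih (v.drop g).length
          (by rw [List.length_drop]; omega) (v.drop g) rfl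
        refine ⟨v.take g :: L, r, ?_, ?_, ?_, h4⟩
        · rw [List.flatten_cons, List.append_assoc, h1, List.take_append_drop]
        · intro x hx
          rcases List.mem_cons.1 hx with rfl | hx
          · exact hg
          · exact h2 x hx
        · intro x hx
          rcases List.mem_cons.1 hx with rfl | hx
          · exact ⟨v.take (g - 1), a, by rw [htake, hav], hna⟩
          · exact h3 x hx
  obtain ⟨L, r, h1, h2, h3, h4⟩ := key w.length w rfl
  exact ⟨⟨L, r, h1, h2, h3, h4⟩⟩

/-- The least length of a word over `alph(w)` that starts with `w[i]` and is not a subsequence of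
the suffix `w[i:n]`. -/
noncomputable def distArr (w : List ℕ) (i : ℕ) : ℕ :=
  sInf {m | ∃ u : List ℕ, u.length = m ∧ u.head? = some (letterAt w i) ∧
    (∀ a ∈ u, a ∈ w) ∧ ¬ u.Sublist (w.drop (i - 1))}

namespace ArchFactorization

variable {w : List ℕ} (F : ArchFactorization w)

/-- The number of arches. -/
def k : ℕ := F.arches.length

/-- `|ar(1) ⋯ ar(ℓ)|`, the last position of the `ℓ`-th arch. -/
def archEnd (ℓ : ℕ) : ℕ := (F.arches.take ℓ).flatten.length

/-- Position `i` lies in the `ℓ`-th arch (`1 ≤ ℓ ≤ k`). -/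
def InArch (ℓ i : ℕ) : Prop := F.archEnd (ℓ - 1) < i ∧ i ≤ F.archEnd ℓ

/-- The leftmost position of the letter `a` in the `ℓ`-th arch. -/
noncomputable def firstPosArch (ℓ a : ℕ) : ℕ := sInf {i | F.InArch ℓ i ∧ letterAt w i = a}

/-- The rightmost position of the letter `a` in the `ℓ`-th arch. -/
noncomputable def lastPosArch (ℓ a : ℕ) : ℕ := sSup {i | F.InArch ℓ i ∧ letterAt w i = a}

/-- The letters `a` whose last position in the `ℓ`-th arch is filtered out: for `ℓ < k` those with
`dist[firstPosArch[ℓ+1][a]] > k - ℓ + 1`, for `ℓ = k` those that occur in the rest. -/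
noncomputable def filteredLetters (ℓ : ℕ) : Finset ℕ :=
  if ℓ < F.k then w.toFinset.filter (fun a => F.k - ℓ + 1 < distArr w (F.firstPosArch (ℓ + 1) a))
  else F.rest.toFinset

/-- The set `L'_ℓ`. -/
noncomputable def lastSet (ℓ : ℕ) : Finset ℕ :=
  w.toFinset.image (F.lastPosArch ℓ) \ (F.filteredLetters ℓ).image (F.lastPosArch ℓ)

/-- The array `sortedLast[ℓ][·]`: the elements of `L'_ℓ` in ascending order. Its `t`-th element,
`t ≥ 1`, is `letterAt (F.sortedLast ℓ) t`. -/
noncomputable def sortedLast (ℓ : ℕ) : List ℕ := (F.lastSet ℓ).sort (· ≤ ·)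

/-- `Leq[ℓ][i] = max ({t | sortedLast[ℓ][t] ≤ i} ∪ {-∞})`, with `⊥` for `-∞`. -/
noncomputable def leqArr (ℓ i : ℕ) : WithBot ℕ :=
  ((Finset.Icc 1 (F.sortedLast ℓ).length).filter
    (fun t => letterAt (F.sortedLast ℓ) t ≤ i)).max

/-- `Lex[ℓ][t]`, for `1 ≤ t ≤ |L'_ℓ|`: the position among the first `t` elements of
`sortedLast[ℓ][·]` that carries the smallest letter. -/
noncomputable def lexArr (ℓ t : ℕ) : ℕ :=
  (((F.sortedLast ℓ).take t).argmin (letterAt w)).getD 0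

/-- The list of the positions `firstPosArch[1][a]`, `a ∈ Σ`, whose `dist` value is `k + 1`. -/
noncomputable def startSAS : List ℕ :=
  ((w.toFinset.sort (· ≤ ·)).map (F.firstPosArch 1)).filter (fun i => distArr w i = F.k + 1)

/-- The element of `startSAS` that carries the smallest letter. -/
noncomputable def init : ℕ := (F.startSAS.argmin (letterAt w)).getD 0

end ArchFactorization

/-! ### The machine model

A unit-cost random access machine with bounded machine words. Programs are structured and have
finitely many registers and finitely many one-dimensional arrays with indirect addressing (as usual,
these arrays can be interleaved into one memory). Every operation (arithmetic, comparison, access to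
a register or an array cell, test of a branch or a loop, output) costs one step. No value that
occurs, in particular no address, may exceed the word bound `B`. -/

/-- Register names. -/
inductive RegName where
  | n | sigma | k | init | startLen | ans
  | tmp (i : ℕ)
deriving DecidableEq

/-- Array names. -/
inductive ArrName where
  | word | query | archEnd | firstPosArch | lastPosArch | sortedLast | sortedLen | leq | lex
  | startSAS
  | tmp (i : ℕ)
deriving DecidableEq

/-- A machine state: registers, arrays, the number of steps made, the word that is being written on
the output tape, and the finished output words, each with the time at which it was finished. -/
structure RamState where
  reg : RegName → ℕ
  arr : ArrName → ℕ → ℕ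
  time : ℕ
  cur : List ℕ
  out : List (List ℕ × ℕ)

/-- The clock is at `0` and the output tape is empty; the memory is arbitrary. -/
def RamState.Fresh (s : RamState) : Prop :=
  s.time = 0 ∧ s.cur = [] ∧ s.out = []

/-- Binary operations; `sub` is truncated at `0`, comparisons return `1` or `0`. -/
inductive BinOp where
  | add | sub | mul | lt | eq

def BinOp.eval : BinOp → ℕ → ℕ → ℕ
  | .add, a, b => a + b
  | .sub, a, b => a - b
  | .mul, a, b => a * b
  | .lt, a, b => if a < b then 1 else 0
  | .eq, a, b => if a = b then 1 else 0

inductive RamExpr where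
  | const (c : ℕ)
  | reg (x : RegName)
  | get (A : ArrName) (idx : RamExpr)
  | bin (op : BinOp) (e₁ e₂ : RamExpr)

namespace RamExpr

def eval (s : RamState) : RamExpr → ℕ
  | const c => c
  | reg x => s.reg x
  | get A idx => s.arr A (idx.eval s)
  | bin op e₁ e₂ => op.eval (e₁.eval s) (e₂.eval s)

/-- The number of operations that the evaluation takes. -/
def cost : RamExpr → ℕ
  | const _ => 1
  | reg _ => 1
  | get _ idx => idx.cost + 1
  | bin _ e₁ e₂ => e₁.cost + e₂.cost + 1

/-- All values that occur during the evaluation are at most `B`. -/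
def Fits (B : ℕ) (s : RamState) : RamExpr → Prop
  | const c => c ≤ B
  | reg x => s.reg x ≤ B
  | get A idx => idx.Fits B s ∧ s.arr A (idx.eval s) ≤ B
  | bin op e₁ e₂ => e₁.Fits B s ∧ e₂.Fits B s ∧ op.eval (e₁.eval s) (e₂.eval s) ≤ B

end RamExpr

inductive RamProg where
  | skip
  | assign (x : RegName) (e : RamExpr)
  | store (A : ArrName) (idx e : RamExpr)
  | emit (e : RamExpr)
  | endWord
  | seq (p q : RamProg)
  | ite (e : RamExpr) (p q : RamProg)
  | while (e : RamExpr) (p : RamProg)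

/-- `Exec B p s s'`: started in `s`, the program `p` halts in `s'`, and no value exceeds `B`. In each
state at most one rule applies, so `s'` is determined by `p` and `s`. -/
inductive Exec (B : ℕ) : RamProg → RamState → RamState → Prop where
  | skip (s : RamState) : Exec B .skip s { s with time := s.time + 1 }
  | assign (x : RegName) (e : RamExpr) (s : RamState) (h : e.Fits B s) :
      Exec B (.assign x e) s
        { s with reg := Function.update s.reg x (e.eval s), time := s.time + e.cost + 1 }
  | store (A : ArrName) (idx e : RamExpr) (s : RamState) (hi : idx.Fits B s) (h : e.Fits B s) :
      Exec B (.store A idx e) s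
        { s with
          arr := Function.update s.arr A (Function.update (s.arr A) (idx.eval s) (e.eval s))
          time := s.time + idx.cost + e.cost + 1 }
  | emit (e : RamExpr) (s : RamState) (h : e.Fits B s) :
      Exec B (.emit e) s
        { s with cur := s.cur ++ [e.eval s], time := s.time + e.cost + 1 }
  | endWord (s : RamState) :
      Exec B .endWord s
        { s with cur := [], out := s.out ++ [(s.cur, s.time + 1)], time := s.time + 1 }
  | seq (p q : RamProg) (s s₁ s₂ : RamState) (hp : Exec B p s s₁) (hq : Exec B q s₁ s₂) :
      Exec B (.seq p q) s s₂
  | ite_true (e : RamExpr) (p q : RamProg) (s s' : RamState) (h : e.Fits B s)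
      (he : e.eval s ≠ 0) (hp : Exec B p { s with time := s.time + e.cost + 1 } s') :
      Exec B (.ite e p q) s s'
  | ite_false (e : RamExpr) (p q : RamProg) (s s' : RamState) (h : e.Fits B s)
      (he : e.eval s = 0) (hq : Exec B q { s with time := s.time + e.cost + 1 } s') :
      Exec B (.ite e p q) s s'
  | while_true (e : RamExpr) (p : RamProg) (s s₁ s₂ : RamState) (h : e.Fits B s)
      (he : e.eval s ≠ 0) (hp : Exec B p { s with time := s.time + e.cost + 1 } s₁)
      (hw : Exec B (.while e p) s₁ s₂) :
      Exec B (.while e p) s s₂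
  | while_false (e : RamExpr) (p : RamProg) (s : RamState) (h : e.Fits B s)
      (he : e.eval s = 0) :
      Exec B (.while e p) s { s with time := s.time + e.cost + 1 }

/-! ### Representation in memory -/

/-- The memory holds `w`, its length and the size `σ` of the alphabet. -/
structure HoldsInput (σ : ℕ) (w : List ℕ) (s : RamState) : Prop where
  n : s.reg .n = w.length
  sigma : s.reg .sigma = σ
  word : ∀ i, 1 ≤ i → i ≤ w.length → s.arr .word i = letterAt w i

/-- Row-major address of entry `[ℓ][t]`, `1 ≤ ℓ`, `1 ≤ t ≤ σ`, of an array with rows of length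
`σ`. -/
def cell (σ ℓ t : ℕ) : ℕ := (ℓ - 1) * σ + t

/-- The memory holds `w`, the number of arches, the ends of the arches, the arrays `firstPosArch`,
`lastPosArch`, `sortedLast` (with the lengths of its rows), `Leq`, `Lex`, the list `startSAS` and the
position `init`. Every position `i` in an arch lies in exactly one arch `ℓ`, and the value
`Leq[ℓ][i]` is stored at address `i`, with `-∞` encoded as `0`. -/
structure HoldsData (σ : ℕ) (w : List ℕ) (F : ArchFactorization w) (s : RamState) : Prop
    extends HoldsInput σ w s where
  k : s.reg .k = F.k
  archEnd : ∀ ℓ, ℓ ≤ F.k → s.arr .archEnd ℓ = F.archEnd ℓ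
  firstPosArch : ∀ ℓ a, 1 ≤ ℓ → ℓ ≤ F.k → 1 ≤ a → a ≤ σ →
    s.arr .firstPosArch (cell σ ℓ a) = F.firstPosArch ℓ a
  lastPosArch : ∀ ℓ a, 1 ≤ ℓ → ℓ ≤ F.k → 1 ≤ a → a ≤ σ →
    s.arr .lastPosArch (cell σ ℓ a) = F.lastPosArch ℓ a
  sortedLen : ∀ ℓ, 1 ≤ ℓ → ℓ ≤ F.k → s.arr .sortedLen ℓ = (F.sortedLast ℓ).length
  sortedLast : ∀ ℓ t, 1 ≤ ℓ → ℓ ≤ F.k → 1 ≤ t → t ≤ (F.sortedLast ℓ).length →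
    s.arr .sortedLast (cell σ ℓ t) = letterAt (F.sortedLast ℓ) t
  leq : ∀ ℓ i, 1 ≤ ℓ → ℓ ≤ F.k → F.InArch ℓ i → s.arr .leq i = (F.leqArr ℓ i).unbotD 0
  lex : ∀ ℓ t, 1 ≤ ℓ → ℓ ≤ F.k → 1 ≤ t → t ≤ (F.sortedLast ℓ).length →
    s.arr .lex (cell σ ℓ t) = F.lexArr ℓ t
  startLen : s.reg .startLen = F.startSAS.length
  startSAS : ∀ j, 1 ≤ j → j ≤ F.startSAS.length →
    s.arr .startSAS j = letterAt F.startSAS j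
  init : s.reg .init = F.init

/-- The array `query` holds the word `u`. -/
def HoldsQuery (u : List ℕ) (s : RamState) : Prop :=
  ∀ i, 1 ≤ i → i ≤ u.length → s.arr .query i = letterAt u i

/-- In a run from time `0` to the final state `s`, at most `D` steps pass before the first output
word is finished, between two consecutive ones, and after the last one. -/
def DelayAtMost (D : ℕ) (s : RamState) : Prop :=
  List.IsChain (fun t t' => t' ≤ t + D) (0 :: s.out.map Prod.snd ++ [s.time])

/-!
Every SAS has length `k + 1`. After a position `p` of arch `ℓ + 1` no word of length less than
`k - ℓ` is absent. If `a v` is absent there and has exactly this length, then `a` does not occur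
again in arch `ℓ + 1`; it is matched at its first position in arch `ℓ + 2`, or not at all if
`ℓ + 1 = k`, and in the first case `v` is absent after that position. Hence the last position of `a`
in arch `ℓ + 1` is one of the elements of `L'_{ℓ+1}` up to `p`, and any of these can be chosen. So
the SAS are the branches of a tree without dead ends in which the children of every node form a
prefix of some `sortedLast[ℓ]`, whose length is an entry of `Leq[ℓ]`. A word is checked by following
its branch, `Lex` gives the smallest letter in each prefix, and a depth-first search enumerates the
branches. Some word of length `k - ℓ` is absent after `p` if and only if `Leq[ℓ + 1][p]` is not
`-∞`, so `L'_ℓ` can be computed from `Leq[ℓ + 1]` without `dist`, going from the last arch to the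
first.
-/

/-! ### Absent subsequences and arches -/

section LetterAt

variable {w v : List ℕ} {a i p q : ℕ}

theorem letterAt_add_one (h : i < w.length) : letterAt w (i + 1) = w[i] := by
  simp [letterAt, h]

theorem mem_iff_exists_letterAt :
    a ∈ w ↔ ∃ i, 1 ≤ i ∧ i ≤ w.length ∧ letterAt w i = a := by
  rw [List.mem_iff_getElem]
  constructor
  · rintro ⟨i, hi, rfl⟩
    exact ⟨i + 1, by omega, hi, letterAt_add_one hi⟩
  · rintro ⟨i, h₁, h₂, rfl⟩
    obtain ⟨i, rfl⟩ := Nat.exists_eq_add_of_le' h₁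
    exact ⟨i, h₂, (letterAt_add_one h₂).symm⟩

theorem letterAt_mem (h₁ : 1 ≤ i) (h₂ : i ≤ w.length) : letterAt w i ∈ w :=
  mem_iff_exists_letterAt.2 ⟨i, h₁, h₂, rfl⟩

theorem drop_eq_letterAt_cons (h : p < w.length) :
    w.drop p = letterAt w (p + 1) :: w.drop (p + 1) := by
  rw [List.drop_eq_getElem_cons h, letterAt_add_one h]

theorem cons_sublist_drop_iff :
    (a :: v).Sublist (w.drop p) ↔
      ∃ i, p < i ∧ i ≤ w.length ∧ letterAt w i = a ∧ v.Sublist (w.drop i) := by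
  induction hm : w.length - p generalizing p with
  | zero =>
    rw [List.drop_eq_nil_of_le (by omega)]
    simp only [List.sublist_nil, reduceCtorEq, false_iff]
    rintro ⟨i, h₁, h₂, -⟩
    omega
  | succ m ih =>
    have hp : p < w.length := by omega
    rw [drop_eq_letterAt_cons hp, List.sublist_cons_iff, ih (by omega)]
    constructor
    · rintro (⟨i, hi, h⟩ | ⟨r, hr, hs⟩)
      · exact ⟨i, by omega, h⟩
      · obtain ⟨rfl, rfl⟩ := List.cons.inj hr
        exact ⟨p + 1, by omega, hp, rfl, hs⟩
    · rintro ⟨i, hi, hn, rfl, hs⟩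
      rcases Nat.eq_or_lt_of_le hi with rfl | hlt
      · exact Or.inr ⟨v, rfl, hs⟩
      · exact Or.inl ⟨i, hlt, hn, rfl, hs⟩

theorem mem_drop_iff : a ∈ w.drop p ↔ ∃ i, p < i ∧ i ≤ w.length ∧ letterAt w i = a := by
  rw [← List.singleton_sublist, cons_sublist_drop_iff]
  simp

theorem cons_sublist_drop_iff_of_isLeast
    (hq : IsLeast {i | p < i ∧ i ≤ w.length ∧ letterAt w i = a} q) :
    (a :: v).Sublist (w.drop p) ↔ v.Sublist (w.drop q) := by
  rw [cons_sublist_drop_iff]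
  constructor
  · rintro ⟨i, h₁, h₂, h₃, hs⟩
    exact hs.trans (List.drop_sublist_drop_left w (hq.2 ⟨h₁, h₂, h₃⟩))
  · exact fun hs => ⟨q, hq.1.1, hq.1.2.1, hq.1.2.2, hs⟩

end LetterAt

/-- `v` is a word over `alph(w)` that is not a subsequence of the part of `w` after position `p`.
Matching a word greedily in `w` from left to right passes through such suffixes. -/
def AbsentAfter (w : List ℕ) (p : ℕ) (v : List ℕ) : Prop :=
  (∀ a ∈ v, a ∈ w) ∧ ¬ v.Sublist (w.drop p)

/-- Some word of length `m` over `alph(w)` is absent after position `p`. -/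
def HasAbsentAfter (w : List ℕ) (p m : ℕ) : Prop :=
  ∃ v : List ℕ, v.length = m ∧ AbsentAfter w p v

section AbsentAfter

variable {w v : List ℕ} {a p q : ℕ}

theorem absentAfter_zero : AbsentAfter w 0 v ↔ IsAbsent w v := by
  simp [AbsentAfter, IsAbsent]

theorem not_absentAfter_nil : ¬ AbsentAfter w p [] := by
  simp [AbsentAfter]

theorem AbsentAfter.mono (h : AbsentAfter w p v) (hpq : p ≤ q) : AbsentAfter w q v :=
  ⟨h.1, fun hs => h.2 (hs.trans (List.drop_sublist_drop_left w hpq))⟩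

theorem absentAfter_singleton :
    AbsentAfter w p [a] ↔ a ∈ w ∧ ∀ i, p < i → i ≤ w.length → letterAt w i ≠ a := by
  simp [AbsentAfter, mem_drop_iff]

theorem absentAfter_cons_iff_of_isLeast
    (hq : IsLeast {i | p < i ∧ i ≤ w.length ∧ letterAt w i = a} q) :
    AbsentAfter w p (a :: v) ↔ AbsentAfter w q v := by
  have ha : a ∈ w := by
    obtain ⟨h₁, h₂, rfl⟩ := hq.1
    exact letterAt_mem (by omega) h₂
  simp [AbsentAfter, cons_sublist_drop_iff_of_isLeast hq, ha]

theorem distArr_eq_sInf (hp : p < w.length) :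
    distArr w (p + 1) = sInf {m | ∃ v, v.length + 1 = m ∧ AbsentAfter w (p + 1) v} := by
  refine congrArg sInf (Set.ext fun m => ?_)
  rw [Set.mem_ofPred_eq, Nat.add_sub_cancel, drop_eq_letterAt_cons hp]
  constructor
  · rintro ⟨_ | ⟨b, v⟩, rfl, hb, hu, hs⟩
    · simp at hb
    · obtain rfl : b = letterAt w (p + 1) := by simpa using hb
      exact ⟨v, rfl, fun a ha => hu a (by simp [ha]), by rwa [List.cons_sublist_cons] at hs⟩
  · rintro ⟨v, rfl, hv, hs⟩
    refine ⟨letterAt w (p + 1) :: v, rfl, rfl, ?_, by rwa [List.cons_sublist_cons]⟩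
    simpa using ⟨letterAt_mem (by omega) hp, hv⟩

theorem distArr_mem (hp : p < w.length) : ∃ v, v.length + 1 = distArr w (p + 1) ∧
    AbsentAfter w (p + 1) v := by
  rw [distArr_eq_sInf hp]
  refine Nat.sInf_mem (s := {m | ∃ v, v.length + 1 = m ∧ AbsentAfter w (p + 1) v})
    ⟨_, List.replicate (w.length + 1) (letterAt w (p + 1)), rfl, fun a ha => ?_, fun hs => ?_⟩
  · rw [List.eq_of_mem_replicate ha]
    exact letterAt_mem (by omega) hp
  · have := hs.length_le
    simp only [List.length_replicate, List.length_drop] at this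
    omega

end AbsentAfter

namespace ArchFactorization

variable {w : List ℕ} (F : ArchFactorization w) {ℓ m i p a : ℕ} {v : List ℕ}

theorem archEnd_zero : F.archEnd 0 = 0 := by simp [archEnd]

theorem archEnd_succ (hℓ : ℓ < F.arches.length) :
    F.archEnd (ℓ + 1) = F.archEnd ℓ + F.arches[ℓ].length := by
  rw [archEnd, archEnd, List.take_succ_eq_append_getElem hℓ, List.flatten_append,
    List.length_append, List.flatten_singleton]

theorem archEnd_mono (h : ℓ ≤ m) : F.archEnd ℓ ≤ F.archEnd m := by
  obtain ⟨d, rfl⟩ := Nat.exists_eq_add_of_le h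
  simp [archEnd, List.take_add]

theorem archEnd_le_length (ℓ : ℕ) : F.archEnd ℓ ≤ w.length := by
  have := congrArg List.length F.eq_append
  rw [← List.take_append_drop ℓ F.arches, List.flatten_append, List.length_append,
    List.length_append] at this
  unfold archEnd
  omega

theorem drop_archEnd (hℓ : ℓ < F.arches.length) :
    w.drop (F.archEnd ℓ) = F.arches[ℓ] ++ ((F.arches.drop (ℓ + 1)).flatten ++ F.rest) := by
  have h := F.eq_append
  rw [← List.take_append_drop ℓ F.arches, List.drop_eq_getElem_cons hℓ, List.flatten_append,
    List.flatten_cons, List.append_assoc, List.append_assoc] at h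
  rw [← congrArg (List.drop (F.archEnd ℓ)) h]
  exact List.drop_left

theorem drop_archEnd_k : w.drop (F.archEnd F.k) = F.rest := by
  have : F.archEnd F.k = F.arches.flatten.length := by simp [archEnd, k]
  rw [this, ← congrArg (List.drop F.arches.flatten.length) F.eq_append, List.drop_left]

theorem letterAt_archEnd_add {j : ℕ} (hℓ : ℓ < F.arches.length) (hj : j < F.arches[ℓ].length) :
    letterAt w (F.archEnd ℓ + j + 1) = F.arches[ℓ][j] := by
  have h := congrArg (·[j]?) (F.drop_archEnd hℓ)
  simp only [List.getElem?_drop, List.getElem?_append_left hj, List.getElem?_eq_getElem hj] at h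
  obtain ⟨hlt, h⟩ := List.getElem?_eq_some_iff.1 h
  rw [letterAt_add_one hlt, h]

theorem exists_letterAt_of_lt_k (hℓ : ℓ < F.k) (ha : a ∈ w) :
    ∃ i, F.archEnd ℓ < i ∧ i ≤ F.archEnd (ℓ + 1) ∧ letterAt w i = a := by
  obtain ⟨j, hj, rfl⟩ := List.mem_iff_getElem.1 (F.arch_universal _ (List.getElem_mem hℓ) a ha)
  have := F.archEnd_succ hℓ
  exact ⟨F.archEnd ℓ + j + 1, by omega, by omega, F.letterAt_archEnd_add hℓ hj⟩

theorem archEnd_lt_succ (hℓ : ℓ < F.k) : F.archEnd ℓ < F.archEnd (ℓ + 1) := by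
  obtain ⟨a, ha, -⟩ := F.rest_missing
  obtain ⟨i, h₁, h₂, -⟩ := F.exists_letterAt_of_lt_k hℓ ha
  omega

theorem letterAt_ne_letterAt_archEnd (hℓ : ℓ < F.k) (h₁ : F.archEnd ℓ < i)
    (h₂ : i < F.archEnd (ℓ + 1)) : letterAt w i ≠ letterAt w (F.archEnd (ℓ + 1)) := by
  obtain ⟨y, b, hx, hb⟩ := F.arch_last _ (List.getElem_mem hℓ)
  have hlen : F.arches[ℓ].length = y.length + 1 := by simp [hx]
  have hend := F.archEnd_succ hℓ
  obtain ⟨j, rfl⟩ : ∃ j, i = F.archEnd ℓ + j + 1 := ⟨i - F.archEnd ℓ - 1, by omega⟩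
  have hlast := F.letterAt_archEnd_add (j := y.length) hℓ (by omega)
  rw [hend, hlen, ← Nat.add_assoc, hlast, F.letterAt_archEnd_add hℓ (by omega)]
  simp only [hx, List.getElem_concat_length, List.getElem_append_left (show j < y.length by omega)]
  rintro rfl
  exact hb (List.getElem_mem _)

theorem mem_rest_iff :
    a ∈ F.rest ↔ ∃ i, F.archEnd F.k < i ∧ i ≤ w.length ∧ letterAt w i = a := by
  rw [← F.drop_archEnd_k, mem_drop_iff]

theorem mem_of_mem_rest (h : a ∈ F.rest) : a ∈ w :=
  List.mem_of_mem_drop (F.drop_archEnd_k ▸ h)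

theorem k_pos : 0 < F.k := by
  obtain ⟨a, ha, hr⟩ := F.rest_missing
  by_contra h
  have hdrop := F.drop_archEnd_k
  rw [Nat.eq_zero_of_not_pos h, archEnd_zero, List.drop_zero] at hdrop
  exact hr (hdrop ▸ ha)

/-- Reading `w` from left to right, an arch is complete as soon as every letter has been seen. -/
theorem forall_exists_letterAt_iff (hℓ : ℓ ≤ F.k) (hi : i ≤ w.length) :
    (∀ a ∈ w, ∃ j, F.archEnd ℓ < j ∧ j ≤ i ∧ letterAt w j = a) ↔
      ℓ < F.k ∧ F.archEnd (ℓ + 1) ≤ i := by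
  constructor
  · intro h
    have hlt : ℓ < F.k := by
      refine hℓ.lt_of_ne ?_
      rintro rfl
      obtain ⟨a, ha, hr⟩ := F.rest_missing
      obtain ⟨j, h₁, h₂, h₃⟩ := h a ha
      exact hr (F.mem_rest_iff.2 ⟨j, h₁, by omega, h₃⟩)
    refine ⟨hlt, ?_⟩
    obtain ⟨j, h₁, h₂, h₃⟩ := h (letterAt w (F.archEnd (ℓ + 1)))
      (letterAt_mem (by have := F.archEnd_lt_succ hlt; omega) (F.archEnd_le_length _))
    by_contra hlate
    exact F.letterAt_ne_letterAt_archEnd hlt h₁ (by omega) h₃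
  · rintro ⟨hlt, h⟩ a ha
    obtain ⟨j, h₁, h₂, h₃⟩ := F.exists_letterAt_of_lt_k hlt ha
    exact ⟨j, h₁, by omega, h₃⟩

variable {F}

section Positions

theorem isLeast_firstPosArch_inArch (hℓ : ℓ < F.k) (ha : a ∈ w) :
    IsLeast {i | F.InArch (ℓ + 1) i ∧ letterAt w i = a} (F.firstPosArch (ℓ + 1) a) := by
  obtain ⟨i, h₁, h₂, h₃⟩ := F.exists_letterAt_of_lt_k hℓ ha
  exact ⟨Nat.sInf_mem ⟨i, ⟨h₁, h₂⟩, h₃⟩, fun i hi => Nat.sInf_le hi⟩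

theorem isGreatest_lastPosArch_inArch (hℓ : ℓ < F.k) (ha : a ∈ w) :
    IsGreatest {i | F.InArch (ℓ + 1) i ∧ letterAt w i = a} (F.lastPosArch (ℓ + 1) a) := by
  have hbdd : BddAbove {i | F.InArch (ℓ + 1) i ∧ letterAt w i = a} := ⟨_, fun i hi => hi.1.2⟩
  exact ⟨Nat.sSup_mem (isLeast_firstPosArch_inArch hℓ ha).nonempty hbdd,
    fun i hi => le_csSup hbdd hi⟩

theorem inArch_firstPosArch (hℓ : ℓ < F.k) (ha : a ∈ w) :
    F.InArch (ℓ + 1) (F.firstPosArch (ℓ + 1) a) := (isLeast_firstPosArch_inArch hℓ ha).1.1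

theorem inArch_lastPosArch (hℓ : ℓ < F.k) (ha : a ∈ w) :
    F.InArch (ℓ + 1) (F.lastPosArch (ℓ + 1) a) := (isGreatest_lastPosArch_inArch hℓ ha).1.1

theorem letterAt_firstPosArch (hℓ : ℓ < F.k) (ha : a ∈ w) :
    letterAt w (F.firstPosArch (ℓ + 1) a) = a := (isLeast_firstPosArch_inArch hℓ ha).1.2

theorem letterAt_lastPosArch (hℓ : ℓ < F.k) (ha : a ∈ w) :
    letterAt w (F.lastPosArch (ℓ + 1) a) = a := (isGreatest_lastPosArch_inArch hℓ ha).1.2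

theorem InArch.pos (h : F.InArch ℓ i) : 1 ≤ i := Nat.one_le_of_lt h.1

theorem InArch.le_length (h : F.InArch ℓ i) : i ≤ w.length := h.2.trans (F.archEnd_le_length ℓ)

theorem isLeast_firstPosArch (hℓ : ℓ < F.k) (ha : a ∈ w) :
    IsLeast {i | F.archEnd ℓ < i ∧ i ≤ w.length ∧ letterAt w i = a}
      (F.firstPosArch (ℓ + 1) a) := by
  have hmem := inArch_firstPosArch hℓ ha
  refine ⟨⟨hmem.1, hmem.le_length, letterAt_firstPosArch hℓ ha⟩, ?_⟩
  rintro i ⟨h₁, -, h₃⟩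
  by_contra hlt
  exact hlt ((isLeast_firstPosArch_inArch hℓ ha).2
    ⟨⟨h₁, (not_le.1 hlt).le.trans hmem.2⟩, h₃⟩)

theorem isGreatest_lastPosArch (hℓ : ℓ < F.k) (ha : a ∈ w) :
    IsGreatest {i | 1 ≤ i ∧ i ≤ F.archEnd (ℓ + 1) ∧ letterAt w i = a}
      (F.lastPosArch (ℓ + 1) a) := by
  have hmem := inArch_lastPosArch hℓ ha
  refine ⟨⟨hmem.pos, hmem.2, letterAt_lastPosArch hℓ ha⟩, ?_⟩
  rintro i ⟨-, h₂, h₃⟩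
  by_contra hlt
  exact hlt ((isGreatest_lastPosArch_inArch hℓ ha).2 ⟨⟨hmem.1.trans (not_le.1 hlt), h₂⟩, h₃⟩)

theorem isLeast_firstPosArch_of_lastPosArch_le (hℓ : ℓ + 1 < F.k) (ha : a ∈ w)
    (hp : p ≤ F.archEnd (ℓ + 1)) (hlast : F.lastPosArch (ℓ + 1) a ≤ p) :
    IsLeast {i | p < i ∧ i ≤ w.length ∧ letterAt w i = a} (F.firstPosArch (ℓ + 2) a) := by
  have hfirst := isLeast_firstPosArch hℓ ha
  refine ⟨⟨hp.trans_lt hfirst.1.1, hfirst.1.2⟩, ?_⟩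
  rintro i ⟨h₁, h₂, h₃⟩
  refine hfirst.2 ⟨?_, h₂, h₃⟩
  by_contra hle
  have := (isGreatest_lastPosArch (by omega) ha).2 ⟨by omega, not_lt.1 hle, h₃⟩
  omega

end Positions

section ShortestAbsent

theorem sublist_drop_archEnd (hv : ∀ a ∈ v, a ∈ w) (hlen : v.length + ℓ ≤ F.k) :
    v.Sublist (w.drop (F.archEnd ℓ)) := by
  induction v generalizing ℓ with
  | nil => exact List.nil_sublist _
  | cons a v ih =>
    rw [List.length_cons] at hlen
    obtain ⟨ha, hv⟩ := List.forall_mem_cons.1 hv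
    obtain ⟨j, h₁, h₂, h₃⟩ := F.exists_letterAt_of_lt_k (ℓ := ℓ) (by omega) ha
    exact cons_sublist_drop_iff.2 ⟨j, h₁, h₂.trans (F.archEnd_le_length _), h₃,
      (ih hv (by omega)).trans (List.drop_sublist_drop_left w h₂)⟩

theorem k_lt_length_of_absentAfter (h : AbsentAfter w p v) (hp : p ≤ F.archEnd ℓ) :
    F.k < v.length + ℓ := by
  by_contra hlen
  exact (h.mono hp).2 (sublist_drop_archEnd h.1 (not_lt.1 hlen))

theorem exists_absentAfter_archEnd (hℓ : ℓ ≤ F.k) :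
    ∃ v, v.length + ℓ = F.k + 1 ∧ AbsentAfter w (F.archEnd ℓ) v := by
  induction hℓ using Nat.decreasingInduction with
  | self =>
    obtain ⟨a, ha, hr⟩ := F.rest_missing
    exact ⟨[a], Nat.add_comm 1 _, by simpa [AbsentAfter, F.drop_archEnd_k, ha] using hr⟩
  | of_succ ℓ hℓ ih =>
    obtain ⟨v, hlen, hv⟩ := ih
    have hlt := F.archEnd_lt_succ hℓ
    have hend : IsLeast {i | F.archEnd ℓ < i ∧ i ≤ w.length ∧
        letterAt w i = letterAt w (F.archEnd (ℓ + 1))} (F.archEnd (ℓ + 1)) := by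
      refine ⟨⟨hlt, F.archEnd_le_length _, rfl⟩, fun i hi => ?_⟩
      by_contra hc
      exact F.letterAt_ne_letterAt_archEnd hℓ hi.1 (not_le.1 hc) hi.2.2
    exact ⟨_ :: v, by simp only [List.length_cons]; omega,
      (absentAfter_cons_iff_of_isLeast hend).2 hv⟩

theorem isSAS_iff {u : List ℕ} : IsSAS w u ↔ u.length = F.k + 1 ∧ AbsentAfter w 0 u := by
  have hmin : ∀ v, IsAbsent w v → F.k < v.length := fun v hv =>
    k_lt_length_of_absentAfter (absentAfter_zero.2 hv) (Nat.zero_le (F.archEnd 0))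
  obtain ⟨v, hlen, hv⟩ := exists_absentAfter_archEnd (F := F) (Nat.zero_le _)
  rw [archEnd_zero, absentAfter_zero] at hv
  rw [absentAfter_zero]
  constructor
  · rintro ⟨hu, hle⟩
    have := hle v hv
    have := hmin u hu
    exact ⟨by omega, hu⟩
  · rintro ⟨hlen', hu⟩
    exact ⟨hu, fun v' hv' => hlen' ▸ hmin v' hv'⟩

theorem le_distArr (h : F.InArch (ℓ + 1) p) : F.k - ℓ < distArr w p := by
  obtain ⟨p, rfl⟩ := Nat.exists_eq_add_of_le' h.pos
  obtain ⟨v, hv, habs⟩ := distArr_mem h.le_length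
  have := k_lt_length_of_absentAfter habs h.2
  omega

theorem distArr_eq_iff (h : F.InArch (ℓ + 1) p) :
    distArr w p = F.k - ℓ + 1 ↔ HasAbsentAfter w p (F.k - ℓ) := by
  have hle := le_distArr h
  obtain ⟨p, rfl⟩ := Nat.exists_eq_add_of_le' h.pos
  constructor
  · intro heq
    obtain ⟨v, hv, habs⟩ := distArr_mem h.le_length
    exact ⟨v, by omega, habs⟩
  · rintro ⟨v, hv, habs⟩
    refine le_antisymm ?_ hle
    rw [distArr_eq_sInf h.le_length]
    exact Nat.sInf_le ⟨v, by omega, habs⟩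

end ShortestAbsent

section LastSet

theorem mem_of_mem_filteredLetters (h : a ∈ F.filteredLetters ℓ) : a ∈ w := by
  unfold filteredLetters at h
  split_ifs at h
  · exact List.mem_toFinset.1 (Finset.mem_of_mem_filter a h)
  · exact F.mem_of_mem_rest (List.mem_toFinset.1 h)

theorem mem_filteredLetters_iff_not_hasAbsentAfter (hℓ : ℓ + 1 < F.k) (ha : a ∈ w) :
    a ∈ F.filteredLetters (ℓ + 1) ↔
      ¬ HasAbsentAfter w (F.firstPosArch (ℓ + 2) a) (F.k - (ℓ + 1)) := by
  have hin := inArch_firstPosArch hℓ ha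
  have hle := le_distArr hin
  simp only [← distArr_eq_iff hin, filteredLetters, hℓ, if_true, Finset.mem_filter,
    List.mem_toFinset, ha, true_and]
  omega

theorem mem_filteredLetters_k : a ∈ F.filteredLetters F.k ↔ a ∈ F.rest := by
  simp [filteredLetters]

theorem mem_lastSet_iff {j : ℕ} (hℓ : ℓ < F.k) :
    j ∈ F.lastSet (ℓ + 1) ↔ letterAt w j ∈ w ∧ letterAt w j ∉ F.filteredLetters (ℓ + 1) ∧
      F.lastPosArch (ℓ + 1) (letterAt w j) = j := by
  simp only [lastSet, Finset.mem_sdiff, Finset.mem_image, List.mem_toFinset]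
  constructor
  · rintro ⟨⟨a, ha, rfl⟩, h⟩
    rw [letterAt_lastPosArch hℓ ha]
    exact ⟨ha, fun hf => h ⟨a, hf, rfl⟩, rfl⟩
  · rintro ⟨ha, hf, hj⟩
    refine ⟨⟨_, ha, hj⟩, ?_⟩
    rintro ⟨b, hb, rfl⟩
    rw [letterAt_lastPosArch hℓ (mem_of_mem_filteredLetters hb)] at hf
    exact hf hb

theorem inArch_of_mem_lastSet {j : ℕ} (hℓ : ℓ < F.k) (hj : j ∈ F.lastSet (ℓ + 1)) :
    F.InArch (ℓ + 1) j := by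
  obtain ⟨ha, -, hlast⟩ := (mem_lastSet_iff hℓ).1 hj
  exact hlast ▸ inArch_lastPosArch hℓ ha

theorem lastPosArch_mem_lastSet_iff (hℓ : ℓ < F.k) (ha : a ∈ w) :
    F.lastPosArch (ℓ + 1) a ∈ F.lastSet (ℓ + 1) ↔ a ∉ F.filteredLetters (ℓ + 1) := by
  simp [mem_lastSet_iff hℓ, letterAt_lastPosArch hℓ ha, ha]

theorem absentAfter_cons_iff (hp : p ≤ F.archEnd (ℓ + 1)) (hlen : v.length + (ℓ + 1) = F.k)
    (hv : v ≠ []) : AbsentAfter w p (a :: v) ↔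
      a ∈ w ∧ F.lastPosArch (ℓ + 1) a ≤ p ∧ AbsentAfter w (F.firstPosArch (ℓ + 2) a) v := by
  have hℓ : ℓ + 1 < F.k := by
    have := List.length_pos_iff.2 hv
    omega
  constructor
  · intro h
    have ha : a ∈ w := h.1 a (by simp)
    have hlast : F.lastPosArch (ℓ + 1) a ≤ p := by
      by_contra hlt
      have hin := inArch_lastPosArch (F := F) (ℓ := ℓ) (by omega) ha
      refine h.2 (cons_sublist_drop_iff.2 ⟨_, not_le.1 hlt, hin.le_length,
        letterAt_lastPosArch (by omega) ha, ?_⟩)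
      by_contra hs
      have := k_lt_length_of_absentAfter ⟨fun b hb => h.1 b (by simp [hb]), hs⟩ hin.2
      omega
    exact ⟨ha, hlast, (absentAfter_cons_iff_of_isLeast
      (isLeast_firstPosArch_of_lastPosArch_le hℓ ha hp hlast)).1 h⟩
  · rintro ⟨ha, hlast, h⟩
    exact (absentAfter_cons_iff_of_isLeast
      (isLeast_firstPosArch_of_lastPosArch_le hℓ ha hp hlast)).2 h

theorem absentAfter_singleton_iff (hk : ℓ + 1 = F.k) (hp : p ≤ F.archEnd (ℓ + 1)) :
    AbsentAfter w p [a] ↔ a ∈ w ∧ F.lastPosArch (ℓ + 1) a ≤ p ∧ a ∉ F.rest := by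
  rw [absentAfter_singleton, mem_rest_iff, ← hk]
  refine and_congr_right fun ha => ?_
  have hlast := isGreatest_lastPosArch (F := F) (ℓ := ℓ) (by omega) ha
  constructor
  · intro h
    refine ⟨?_, ?_⟩
    · by_contra hlt
      exact h _ (not_le.1 hlt) (hlast.1.2.1.trans (F.archEnd_le_length _)) hlast.1.2.2
    · rintro ⟨i, h₁, h₂, h₃⟩
      exact h i (hp.trans_lt h₁) h₂ h₃
  · rintro ⟨hle, hrest⟩ i h₁ h₂ h₃
    by_cases hi : i ≤ F.archEnd (ℓ + 1)
    · have := hlast.2 ⟨by omega, hi, h₃⟩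
      omega
    · exact hrest ⟨i, not_le.1 hi, h₂, h₃⟩

/-- The recursion behind all three algorithms: the first letter of an absent word of the critical
length is chosen through a position in `L'`. -/
theorem absentAfter_cons_iff_exists_mem_lastSet (hp : p ≤ F.archEnd (ℓ + 1))
    (hlen : v.length + (ℓ + 1) = F.k) :
    AbsentAfter w p (a :: v) ↔ ∃ j ∈ F.lastSet (ℓ + 1), j ≤ p ∧ letterAt w j = a ∧
      (v = [] ∨ AbsentAfter w (F.firstPosArch (ℓ + 2) a) v) := by
  have hℓ : ℓ < F.k := by omega
  have hset : (∃ j ∈ F.lastSet (ℓ + 1), j ≤ p ∧ letterAt w j = a ∧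
      (v = [] ∨ AbsentAfter w (F.firstPosArch (ℓ + 2) a) v)) ↔
      a ∈ w ∧ a ∉ F.filteredLetters (ℓ + 1) ∧ F.lastPosArch (ℓ + 1) a ≤ p ∧
        (v = [] ∨ AbsentAfter w (F.firstPosArch (ℓ + 2) a) v) := by
    constructor
    · rintro ⟨j, hj, hjp, rfl, hv⟩
      obtain ⟨ha, hf, hlast⟩ := (mem_lastSet_iff hℓ).1 hj
      exact ⟨ha, hf, hlast.symm ▸ hjp, hv⟩
    · rintro ⟨ha, hf, hlast, hv⟩
      exact ⟨_, (lastPosArch_mem_lastSet_iff hℓ ha).2 hf, hlast, letterAt_lastPosArch hℓ ha, hv⟩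
  rw [hset]
  rcases eq_or_ne v [] with rfl | hv
  · have hk : ℓ + 1 = F.k := by simpa using hlen
    simp only [absentAfter_singleton_iff hk hp, hk, mem_filteredLetters_k, true_or, and_true]
    tauto
  · have hlt : ℓ + 1 < F.k := by
      have := List.length_pos_iff.2 hv
      omega
    simp only [absentAfter_cons_iff hp hlen hv, hv, false_or]
    refine and_congr_right fun ha => ⟨fun h => ⟨?_, h⟩, And.right⟩
    rw [mem_filteredLetters_iff_not_hasAbsentAfter hlt ha, not_not]
    exact ⟨v, by omega, h.2⟩

theorem hasAbsentAfter_iff (hℓ : ℓ < F.k) (hp : p ≤ F.archEnd (ℓ + 1)) :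
    HasAbsentAfter w p (F.k - ℓ) ↔ ∃ j ∈ F.lastSet (ℓ + 1), j ≤ p := by
  constructor
  · rintro ⟨_ | ⟨a, v⟩, hlen, hv⟩
    · exact absurd hv not_absentAfter_nil
    · rw [List.length_cons] at hlen
      obtain ⟨j, hj, hjp, -⟩ := (absentAfter_cons_iff_exists_mem_lastSet hp (by omega)).1 hv
      exact ⟨j, hj, hjp⟩
  · rintro ⟨j, hj, hjp⟩
    obtain ⟨ha, hf, -⟩ := (mem_lastSet_iff hℓ).1 hj
    obtain ⟨v, hlen, hv⟩ : ∃ v : List ℕ, v.length + (ℓ + 1) = F.k ∧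
        (v = [] ∨ AbsentAfter w (F.firstPosArch (ℓ + 2) (letterAt w j)) v) := by
      rcases Nat.lt_or_eq_of_le (Nat.succ_le_of_lt hℓ) with hlt | heq
      · rw [mem_filteredLetters_iff_not_hasAbsentAfter hlt ha, not_not] at hf
        obtain ⟨v, hlen, hv⟩ := hf
        exact ⟨v, by omega, Or.inr hv⟩
      · exact ⟨[], by simpa using heq, Or.inl rfl⟩
    exact ⟨letterAt w j :: v, by rw [List.length_cons]; omega,
      (absentAfter_cons_iff_exists_mem_lastSet hp hlen).2 ⟨j, hj, hjp, rfl, hv⟩⟩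

end LastSet

end ArchFactorization

/-! ### The arrays and the tree of choices -/

section Lists

variable {L : List ℕ} {i j t : ℕ}

theorem letterAt_take (ht : 1 ≤ t) (hti : t ≤ i) : letterAt (L.take i) t = letterAt L t := by
  have : t - 1 < i := by omega
  simp [letterAt, this]

theorem take_add_one_eq_concat (ht : t < L.length) :
    L.take (t + 1) = L.take t ++ [letterAt L (t + 1)] := by
  rw [List.take_succ_eq_append_getElem ht, letterAt_add_one ht]

theorem letterAt_le_iff_le_countP (hL : L.Pairwise (· < ·)) (h₁ : 1 ≤ t) (h₂ : t ≤ L.length) :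
    letterAt L t ≤ i ↔ t ≤ L.countP (· ≤ i) := by
  induction L generalizing t with
  | nil => simp only [List.length_nil] at h₂; omega
  | cons a L ih =>
    obtain ⟨ha, hL⟩ := List.pairwise_cons.1 hL
    obtain ⟨t, rfl⟩ := Nat.exists_eq_add_of_le' h₁
    by_cases hai : a ≤ i
    · rw [List.countP_cons_of_pos (by simpa using hai), Nat.add_le_add_iff_right]
      rcases t with _ | t
      · simpa [letterAt] using hai
      · exact ih hL (by omega) (Nat.le_of_succ_le_succ h₂)
    · have hbig : ∀ b ∈ a :: L, i < b := by
        rintro b (_ | ⟨_, hb⟩)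
        · omega
        · have := ha b hb
          omega
      have hzero : (a :: L).countP (· ≤ i) = 0 := by simpa using hbig
      have := hbig _ (letterAt_mem h₁ h₂)
      omega

theorem argmin_getD_mem {f : ℕ → ℕ} (hL : L ≠ []) : (L.argmin f).getD 0 ∈ L := by
  obtain ⟨j, hj⟩ := Option.ne_none_iff_exists'.1 (mt (List.argmin_eq_none (f := f)).1 hL)
  rw [hj]
  exact List.argmin_mem hj

theorem apply_argmin_getD_le {f : ℕ → ℕ} (hj : j ∈ L) : f ((L.argmin f).getD 0) ≤ f j := by
  obtain ⟨m, hm⟩ := Option.ne_none_iff_exists'.1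
    (mt (List.argmin_eq_none (f := f)).1 (List.ne_nil_of_mem hj))
  rw [hm]
  exact List.le_of_mem_argmin hj hm

theorem argmin_getD_concat {f : ℕ → ℕ} : ((L ++ [j]).argmin f).getD 0 =
    if L = [] then j else if f j < f ((L.argmin f).getD 0) then j else (L.argmin f).getD 0 := by
  rw [List.argmin_concat]
  rcases h : L.argmin f with _ | m
  · simp [List.argmin_eq_none.1 h]
  · have hL : L ≠ [] := List.ne_nil_of_mem (List.argmin_mem h)
    simp only [hL, if_false, Option.getD_some]
    split_ifs <;> rfl

end Lists

namespace ArchFactorization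

variable {w : List ℕ} (F : ArchFactorization w) {ℓ d i j p r t : ℕ} {u v : List ℕ}

section Leq

/-- The entry `Leq[ℓ][i]` with `-∞` replaced by `0`, that is, the number of elements of `L'_ℓ` up to
position `i`; this is what the memory holds. -/
noncomputable def leqCount (ℓ i : ℕ) : ℕ := (F.leqArr ℓ i).unbotD 0

theorem mem_sortedLast : j ∈ F.sortedLast ℓ ↔ j ∈ F.lastSet ℓ := Finset.mem_sort _

theorem pairwise_sortedLast : (F.sortedLast ℓ).Pairwise (· < ·) :=
  (F.lastSet ℓ).sortedLT_sort.pairwise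

theorem leqCount_eq_countP : F.leqCount ℓ i = (F.sortedLast ℓ).countP (· ≤ i) := by
  have hle : (F.sortedLast ℓ).countP (· ≤ i) ≤ (F.sortedLast ℓ).length := List.countP_le_length
  have hfilter : (Finset.Icc 1 (F.sortedLast ℓ).length).filter
      (fun t => letterAt (F.sortedLast ℓ) t ≤ i) =
      Finset.Icc 1 ((F.sortedLast ℓ).countP (· ≤ i)) := by
    ext t
    simp only [Finset.mem_filter, Finset.mem_Icc]
    constructor
    · rintro ⟨ht, hti⟩
      exact ⟨ht.1, (letterAt_le_iff_le_countP F.pairwise_sortedLast ht.1 ht.2).1 hti⟩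
    · rintro ⟨h₁, h₂⟩
      exact ⟨⟨h₁, h₂.trans hle⟩,
        (letterAt_le_iff_le_countP F.pairwise_sortedLast h₁ (h₂.trans hle)).2 h₂⟩
  rw [leqCount, leqArr, hfilter]
  rcases Nat.eq_zero_or_pos ((F.sortedLast ℓ).countP (· ≤ i)) with h | h
  · simp [h]
  · have hne := Finset.nonempty_Icc.2 (Nat.succ_le_of_lt h)
    rw [← Finset.coe_max' hne, WithBot.unbotD_coe]
    exact (Finset.isGreatest_max' _ hne).unique
      ⟨Finset.right_mem_Icc.2 h, fun _ ht => (Finset.mem_Icc.1 ht).2⟩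

theorem leqCount_le_length : F.leqCount ℓ i ≤ (F.sortedLast ℓ).length :=
  F.leqCount_eq_countP ▸ List.countP_le_length

theorem letterAt_sortedLast_le_iff (h₁ : 1 ≤ t) (h₂ : t ≤ (F.sortedLast ℓ).length) :
    letterAt (F.sortedLast ℓ) t ≤ i ↔ t ≤ F.leqCount ℓ i :=
  F.leqCount_eq_countP ▸ letterAt_le_iff_le_countP F.pairwise_sortedLast h₁ h₂

theorem leqCount_eq_card : F.leqCount ℓ i = ((F.lastSet ℓ).filter (· ≤ i)).card := by
  rw [leqCount_eq_countP, Finset.card_def, Finset.filter_val, ← Multiset.countP_eq_card_filter,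
    ← Finset.sort_eq (F.lastSet ℓ) (· ≤ ·), Multiset.coe_countP]
  rfl

theorem leqCount_pos_iff : 0 < F.leqCount ℓ i ↔ ∃ j ∈ F.lastSet ℓ, j ≤ i := by
  simp [leqCount_eq_card, Finset.card_pos, Finset.filter_nonempty_iff]

theorem leqCount_add_one :
    F.leqCount ℓ (i + 1) = F.leqCount ℓ i + if i + 1 ∈ F.lastSet ℓ then 1 else 0 := by
  have hsplit : (F.lastSet ℓ).filter (· ≤ i + 1) =
      (F.lastSet ℓ).filter (· ≤ i) ∪ (F.lastSet ℓ).filter (· = i + 1) := by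
    ext j
    simp only [Finset.mem_union, Finset.mem_filter, Nat.le_succ_iff]
    tauto
  have hdisj : Disjoint ((F.lastSet ℓ).filter (· ≤ i)) ((F.lastSet ℓ).filter (· = i + 1)) :=
    Finset.disjoint_filter.2 fun j _ hj => by omega
  rw [leqCount_eq_card, leqCount_eq_card, hsplit, Finset.card_union_of_disjoint hdisj,
    Finset.filter_eq']
  split_ifs <;> rfl

theorem leqCount_archEnd (hℓ : ℓ < F.k) : F.leqCount (ℓ + 1) (F.archEnd ℓ) = 0 := by
  by_contra h
  obtain ⟨j, hj, hle⟩ := F.leqCount_pos_iff.1 (Nat.pos_of_ne_zero h)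
  exact (inArch_of_mem_lastSet hℓ hj).1.not_ge hle

theorem leqCount_archEnd_succ (hℓ : ℓ < F.k) :
    F.leqCount (ℓ + 1) (F.archEnd (ℓ + 1)) = (F.sortedLast (ℓ + 1)).length := by
  rw [leqCount_eq_countP, List.countP_eq_length]
  intro j hj
  simpa using (inArch_of_mem_lastSet hℓ (F.mem_sortedLast.1 hj)).2

theorem letterAt_sortedLast_leqCount (hj : j ∈ F.lastSet ℓ) :
    letterAt (F.sortedLast ℓ) (F.leqCount ℓ j) = j := by
  obtain ⟨t, h₁, h₂, rfl⟩ := mem_iff_exists_letterAt.1 (F.mem_sortedLast.2 hj)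
  have hpos : 1 ≤ F.leqCount ℓ (letterAt (F.sortedLast ℓ) t) :=
    F.leqCount_pos_iff.2 ⟨_, hj, le_rfl⟩
  refine le_antisymm ((F.letterAt_sortedLast_le_iff hpos F.leqCount_le_length).2 le_rfl) ?_
  rw [F.letterAt_sortedLast_le_iff h₁ h₂]
  exact ((F.letterAt_sortedLast_le_iff h₁ h₂).1 le_rfl).trans
    ((F.letterAt_sortedLast_le_iff hpos F.leqCount_le_length).1 le_rfl)

theorem mem_lastSet_iff_letterAt_leqCount : j ∈ F.lastSet ℓ ↔
    F.leqCount ℓ j ≠ 0 ∧ letterAt (F.sortedLast ℓ) (F.leqCount ℓ j) = j := by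
  constructor
  · exact fun hj =>
      ⟨(F.leqCount_pos_iff.2 ⟨j, hj, le_rfl⟩).ne', F.letterAt_sortedLast_leqCount hj⟩
  · rintro ⟨h, hj⟩
    rw [← mem_sortedLast, ← hj]
    exact letterAt_mem (Nat.pos_of_ne_zero h) F.leqCount_le_length

theorem mem_take_sortedLast :
    j ∈ (F.sortedLast ℓ).take (F.leqCount ℓ i) ↔ j ∈ F.lastSet ℓ ∧ j ≤ i := by
  rw [mem_iff_exists_letterAt, ← mem_sortedLast, mem_iff_exists_letterAt, List.length_take_of_le
    F.leqCount_le_length]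
  constructor
  · rintro ⟨t, h₁, h₂, rfl⟩
    have hlen := h₂.trans F.leqCount_le_length
    rw [letterAt_take h₁ h₂]
    exact ⟨⟨t, h₁, hlen, rfl⟩, (F.letterAt_sortedLast_le_iff h₁ hlen).2 h₂⟩
  · rintro ⟨⟨t, h₁, h₂, rfl⟩, hle⟩
    have ht := (F.letterAt_sortedLast_le_iff h₁ h₂).1 hle
    exact ⟨t, h₁, ht, letterAt_take h₁ ht⟩

theorem lexArr_add_one (ht : t < (F.sortedLast ℓ).length) :
    F.lexArr ℓ (t + 1) = if t = 0 then letterAt (F.sortedLast ℓ) (t + 1)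
      else if letterAt w (letterAt (F.sortedLast ℓ) (t + 1)) < letterAt w (F.lexArr ℓ t)
        then letterAt (F.sortedLast ℓ) (t + 1) else F.lexArr ℓ t := by
  have hnil : (F.sortedLast ℓ).take t = [] ↔ t = 0 := by
    rw [← List.length_eq_zero_iff, List.length_take_of_le ht.le]
  rw [lexArr, take_add_one_eq_concat ht, argmin_getD_concat]
  simp only [hnil]
  rfl

end Leq

section Choices

/-- The positions among which a letter of an SAS can be chosen at depth `ℓ` of the tree of choices:
`startSAS` for the first letter, `sortedLast[ℓ]` for the letter `ℓ + 1`. -/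
noncomputable def choices : ℕ → List ℕ
  | 0 => F.startSAS
  | ℓ + 1 => F.sortedLast (ℓ + 1)

/-- After position `j` has been chosen at depth `ℓ`, the choices at depth `ℓ + 1` that lead to an
SAS are the first `branching ℓ j` ones. -/
noncomputable def branching (ℓ j : ℕ) : ℕ :=
  F.leqCount (ℓ + 1) (F.firstPosArch (ℓ + 1) (letterAt w j))

variable {F}

theorem mem_startSAS_iff : j ∈ F.startSAS ↔ letterAt w j ∈ w ∧
    F.firstPosArch 1 (letterAt w j) = j ∧ HasAbsentAfter w j F.k := by
  have hdist : ∀ {a}, a ∈ w →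
      (distArr w (F.firstPosArch 1 a) = F.k + 1 ↔ HasAbsentAfter w (F.firstPosArch 1 a) F.k) :=
    fun ha => distArr_eq_iff (inArch_firstPosArch F.k_pos ha)
  simp only [startSAS, List.mem_filter, List.mem_map, Finset.mem_sort, List.mem_toFinset,
    decide_eq_true_eq]
  constructor
  · rintro ⟨⟨a, ha, rfl⟩, h⟩
    rw [letterAt_firstPosArch F.k_pos ha]
    exact ⟨ha, rfl, (hdist ha).1 h⟩
  · rintro ⟨ha, hj, h⟩
    refine ⟨⟨_, ha, hj⟩, ?_⟩
    rw [← hj, hdist ha, hj]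
    exact h

theorem letterAt_mem_of_mem_choices (hℓ : ℓ ≤ F.k) (hj : j ∈ F.choices ℓ) : letterAt w j ∈ w := by
  cases ℓ with
  | zero => exact (mem_startSAS_iff.1 hj).1
  | succ ℓ => exact ((mem_lastSet_iff hℓ).1 (F.mem_sortedLast.1 hj)).1

theorem injOn_letterAt_choices (hℓ : ℓ ≤ F.k) : Set.InjOn (letterAt w) {j | j ∈ F.choices ℓ} := by
  intro i hi j hj hij
  cases ℓ with
  | zero => rw [← (mem_startSAS_iff.1 hi).2.1, ← (mem_startSAS_iff.1 hj).2.1, hij]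
  | succ ℓ =>
    rw [← ((mem_lastSet_iff hℓ).1 (F.mem_sortedLast.1 hi)).2.2,
      ← ((mem_lastSet_iff hℓ).1 (F.mem_sortedLast.1 hj)).2.2, hij]

theorem pairwise_map_letterAt_startSAS : (F.startSAS.map (letterAt w)).Pairwise (· < ·) := by
  have hsort : (((w.toFinset.sort (· ≤ ·)).map (F.firstPosArch 1)).map (letterAt w)) =
      w.toFinset.sort (· ≤ ·) := by
    rw [List.map_map]
    refine (List.map_congr_left fun a ha => ?_).trans (List.map_id _)
    exact letterAt_firstPosArch F.k_pos (List.mem_toFinset.1 ((Finset.mem_sort _).1 ha))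
  refine (w.toFinset.sortedLT_sort.pairwise).sublist ?_
  rw [← hsort]
  exact List.filter_sublist.map _

theorem nodup_choices : (F.choices ℓ).Nodup := by
  cases ℓ with
  | zero => exact List.Nodup.of_map (letterAt w) (pairwise_map_letterAt_startSAS.imp ne_of_lt)
  | succ ℓ => exact F.pairwise_sortedLast.imp ne_of_lt

theorem branching_pos (hℓ : ℓ < F.k) (hj : j ∈ F.choices ℓ) : 0 < F.branching ℓ j := by
  have ha := letterAt_mem_of_mem_choices hℓ.le hj
  have hin := inArch_firstPosArch hℓ ha
  rw [branching, leqCount_pos_iff, ← hasAbsentAfter_iff hℓ hin.2]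
  cases ℓ with
  | zero =>
    obtain ⟨-, hpos, habs⟩ := mem_startSAS_iff.1 hj
    rwa [hpos]
  | succ ℓ =>
    obtain ⟨-, hf, -⟩ := (mem_lastSet_iff (Nat.lt_of_succ_lt hℓ)).1 (F.mem_sortedLast.1 hj)
    rwa [mem_filteredLetters_iff_not_hasAbsentAfter hℓ ha, not_not] at hf

theorem init_eq_head : F.init = letterAt F.startSAS 1 := by
  have hlt := pairwise_map_letterAt_startSAS (F := F)
  unfold init
  generalize F.startSAS = L at hlt
  rcases L with _ | ⟨j, L⟩
  · rfl
  · rw [List.map_cons, List.pairwise_cons] at hlt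
    rcases List.mem_cons.1 (argmin_getD_mem (f := letterAt w) (List.cons_ne_nil j L)) with h | h
    · exact h
    · have := hlt.1 _ (List.mem_map_of_mem h)
      have := apply_argmin_getD_le (f := letterAt w) (List.mem_cons_self (a := j) (l := L))
      omega

end Choices

section SasWords

/-- The last `d` letters of the SAS that start at depth `k + 1 - d` of the tree of choices with one
of its first `r` choices, in the order in which they are enumerated: the choices are taken from the
last to the first. -/
noncomputable def sasWords : ℕ → ℕ → List (List ℕ)
  | 0, _ => [[]]
  | d + 1, r => ((F.choices (F.k - d)).take r).reverse.flatMap fun j =>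
      (sasWords d (F.branching (F.k - d) j)).map (letterAt w j :: ·)

variable {F}

theorem sasWords_zero_right : F.sasWords (d + 1) 0 = [] := by simp [sasWords]

theorem sasWords_add_one (hr : r < (F.choices (F.k - d)).length) :
    F.sasWords (d + 1) (r + 1) =
      (F.sasWords d (F.branching (F.k - d) (letterAt (F.choices (F.k - d)) (r + 1)))).map
          (letterAt w (letterAt (F.choices (F.k - d)) (r + 1)) :: ·) ++ F.sasWords (d + 1) r := by
  simp [sasWords, take_add_one_eq_concat hr]

theorem cons_mem_sasWords {a : ℕ} : a :: v ∈ F.sasWords (d + 1) r ↔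
    ∃ j ∈ (F.choices (F.k - d)).take r, letterAt w j = a ∧
      v ∈ F.sasWords d (F.branching (F.k - d) j) := by
  simp only [sasWords, List.mem_flatMap, List.mem_reverse, List.mem_map, List.cons.injEq]
  constructor
  · rintro ⟨j, hj, v', hv, rfl, rfl⟩
    exact ⟨j, hj, rfl, hv⟩
  · rintro ⟨j, hj, rfl, hv⟩
    exact ⟨j, hj, v, hv, rfl, rfl⟩

theorem length_of_mem_sasWords (hv : v ∈ F.sasWords d r) : v.length = d := by
  induction d generalizing r v with
  | zero => simpa [sasWords] using hv
  | succ d ih =>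
    simp only [sasWords, List.mem_flatMap, List.mem_map] at hv
    obtain ⟨j, -, v', hv', rfl⟩ := hv
    rw [List.length_cons, ih hv']

theorem mem_sasWords_leqCount_iff (hp : p ≤ F.archEnd (ℓ + 1)) (hlen : v.length + ℓ = F.k)
    (hv : v ≠ []) :
    v ∈ F.sasWords v.length (F.leqCount (ℓ + 1) p) ↔ AbsentAfter w p v := by
  induction v generalizing ℓ p with
  | nil => exact absurd rfl hv
  | cons a v ih =>
    rw [List.length_cons] at hlen
    have hdepth : F.k - v.length = ℓ + 1 := by omega
    rw [List.length_cons, cons_mem_sasWords, absentAfter_cons_iff_exists_mem_lastSet hp (by omega),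
      hdepth]
    simp only [choices, mem_take_sortedLast, and_assoc]
    refine exists_congr fun j => and_congr_right fun hj => and_congr_right fun _ =>
      and_congr_right fun hja => ?_
    rcases eq_or_ne v [] with rfl | hne
    · simp [sasWords]
    · have hℓ : ℓ + 1 < F.k := by
        have := List.length_pos_iff.2 hne
        omega
      have ha := ((mem_lastSet_iff (by omega)).1 hj).1
      simp only [hne, false_or, ← hja]
      exact ih (inArch_firstPosArch hℓ ha).2 (by omega) hne

theorem mem_sasWords_startSAS_iff :
    v ∈ F.sasWords (F.k + 1) F.startSAS.length ↔ IsSAS w v := by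
  rw [isSAS_iff]
  suffices h : v.length = F.k + 1 →
      (v ∈ F.sasWords (F.k + 1) F.startSAS.length ↔ AbsentAfter w 0 v) from
    ⟨fun hv => have hlen := length_of_mem_sasWords hv; ⟨hlen, (h hlen).1 hv⟩,
      fun hv => (h hv.1).2 hv.2⟩
  intro hlen
  obtain ⟨a, v, rfl⟩ := List.exists_cons_of_length_pos (l := v) (by omega)
  replace hlen : v.length = F.k := by simpa using hlen
  rw [cons_mem_sasWords, Nat.sub_self, choices, List.take_length, ← hlen]
  have hv : v ≠ [] := List.ne_nil_of_length_pos (hlen ▸ F.k_pos)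
  have hfirst : ∀ b ∈ w, v ∈ F.sasWords v.length (F.leqCount 1 (F.firstPosArch 1 b)) ↔
      AbsentAfter w 0 (b :: v) := fun b hb => by
    have hleast := isLeast_firstPosArch F.k_pos hb
    rw [F.archEnd_zero] at hleast
    rw [absentAfter_cons_iff_of_isLeast hleast]
    exact mem_sasWords_leqCount_iff (inArch_firstPosArch F.k_pos hb).2 hlen hv
  constructor
  · rintro ⟨j, hj, rfl, hmem⟩
    exact (hfirst _ (mem_startSAS_iff.1 hj).1).1 hmem
  · intro h
    have ha : a ∈ w := h.1 a (by simp)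
    have hletter := letterAt_firstPosArch F.k_pos ha
    have hmem := (hfirst a ha).2 h
    refine ⟨F.firstPosArch 1 a, mem_startSAS_iff.2 ?_, hletter, ?_⟩
    · rw [hletter]
      exact ⟨ha, rfl, v, hlen, (mem_sasWords_leqCount_iff (inArch_firstPosArch F.k_pos ha).2 hlen
        hv).1 hmem⟩
    · rw [branching, hletter]
      exact hmem

theorem startSAS_ne_nil : F.startSAS ≠ [] := by
  obtain ⟨v, hlen, hv⟩ := exists_absentAfter_archEnd (F := F) (Nat.zero_le _)
  rw [F.archEnd_zero] at hv
  have hmem := (mem_sasWords_startSAS_iff (F := F)).2 (isSAS_iff.2 ⟨hlen, hv⟩)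
  intro hnil
  simp [hnil, sasWords_zero_right] at hmem

theorem nodup_sasWords (hd : d ≤ F.k + 1) : (F.sasWords d r).Nodup := by
  induction d generalizing r with
  | zero => simp [sasWords]
  | succ d ih =>
    rw [sasWords, List.nodup_flatMap]
    refine ⟨fun j _ => (ih (by omega)).map (List.cons_injective), ?_⟩
    rw [List.pairwise_reverse]
    refine ((nodup_choices.sublist (List.take_sublist _ _)).imp_of_mem ?_)
    intro i j hi hj hne
    rw [Function.onFun, List.disjoint_left]
    simp only [List.mem_map, not_exists, not_and]
    rintro _ ⟨v, -, rfl⟩ v' - heq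
    exact hne (injOn_letterAt_choices (Nat.sub_le _ _) (List.mem_of_mem_take hi)
      (List.mem_of_mem_take hj) (List.cons.inj heq).1)

end SasWords

section LexWord

/-- The lexicographically least word of `sasWords d r`: at every depth the admissible choice that
carries the smallest letter. -/
noncomputable def lexWord : ℕ → ℕ → List ℕ
  | 0, _ => []
  | d + 1, r =>
    let j := (((F.choices (F.k - d)).take r).argmin (letterAt w)).getD 0
    letterAt w j :: lexWord d (F.branching (F.k - d) j)

variable {F}

theorem lexWord_mem_sasWords (hd : d ≤ F.k) (hr : (F.choices (F.k - d)).take r ≠ []) :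
    F.lexWord (d + 1) r ∈ F.sasWords (d + 1) r := by
  induction d generalizing r with
  | zero => exact cons_mem_sasWords.2 ⟨_, argmin_getD_mem hr, rfl, by simp [lexWord, sasWords]⟩
  | succ d ih =>
    have hmem := argmin_getD_mem (f := letterAt w) hr
    refine cons_mem_sasWords.2 ⟨_, hmem, rfl, ih (by omega) ?_⟩
    have hdepth : F.k - d = F.k - (d + 1) + 1 := by omega
    have hpos := branching_pos (by omega) (List.mem_of_mem_take hmem)
    rw [hdepth, choices, ne_eq, List.take_eq_nil_iff, not_or]
    exact ⟨hpos.ne', List.ne_nil_of_length_pos (hpos.trans_le F.leqCount_le_length)⟩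

theorem lexWord_le (hv : v ∈ F.sasWords d r) : F.lexWord d r ≤ v := by
  induction d generalizing r v with
  | zero => exact not_lt.1 (List.not_lt_nil v)
  | succ d ih =>
    obtain ⟨a, v, rfl⟩ := List.exists_cons_of_length_eq_add_one (length_of_mem_sasWords hv)
    obtain ⟨j, hj, rfl, hv⟩ := cons_mem_sasWords.1 hv
    rcases (apply_argmin_getD_le (f := letterAt w) hj).lt_or_eq with hlt | heq
    · exact le_of_lt (List.Lex.rel hlt)
    · rw [lexWord, heq]
      refine List.cons_le_cons _ (ih ?_)
      rwa [injOn_letterAt_choices (Nat.sub_le _ _)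
        (List.mem_of_mem_take (argmin_getD_mem (List.ne_nil_of_mem hj))) (List.mem_of_mem_take hj)
        heq]

end LexWord

section Check

variable {F}

theorem absentAfter_drop_iff (hu : u.length = F.k + 1) (hletters : ∀ a ∈ u, a ∈ w) (hℓ : ℓ < F.k) :
    AbsentAfter w (F.firstPosArch (ℓ + 1) (letterAt u (ℓ + 1))) (u.drop (ℓ + 1)) ↔
      (∀ m, ℓ ≤ m → m < F.k → F.lastPosArch (m + 1) (letterAt u (m + 2)) ≤
        F.firstPosArch (m + 1) (letterAt u (m + 1))) ∧ letterAt u (F.k + 1) ∉ F.rest := by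
  have hmem : ∀ i, 1 ≤ i → i ≤ F.k + 1 → letterAt u i ∈ w := fun i h₁ h₂ =>
    hletters _ (letterAt_mem h₁ (hu ▸ h₂))
  induction hd : F.k - ℓ generalizing ℓ with
  | zero => omega
  | succ d ih =>
    have hin := (inArch_firstPosArch hℓ (hmem (ℓ + 1) (by omega) (by omega))).2
    rw [drop_eq_letterAt_cons (by omega)]
    have hsplit : (∀ m, ℓ ≤ m → m < F.k → F.lastPosArch (m + 1) (letterAt u (m + 2)) ≤
        F.firstPosArch (m + 1) (letterAt u (m + 1))) ↔
        F.lastPosArch (ℓ + 1) (letterAt u (ℓ + 2)) ≤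
          F.firstPosArch (ℓ + 1) (letterAt u (ℓ + 1)) ∧
        ∀ m, ℓ + 1 ≤ m → m < F.k → F.lastPosArch (m + 1) (letterAt u (m + 2)) ≤
          F.firstPosArch (m + 1) (letterAt u (m + 1)) := by
      refine ⟨fun h => ⟨h ℓ le_rfl hℓ, fun m hm => h m (by omega)⟩, fun h m hm hmk => ?_⟩
      rcases hm.eq_or_lt with rfl | hlt
      · exact h.1
      · exact h.2 m hlt hmk
    rw [hsplit, and_assoc]
    rcases (Nat.succ_le_of_lt hℓ).lt_or_eq with hlt | heq
    · have hne : u.drop (ℓ + 2) ≠ [] := by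
        rw [ne_eq, List.drop_eq_nil_iff]
        omega
      rw [absentAfter_cons_iff hin (by rw [List.length_drop]; omega) hne,
        and_iff_right (hmem (ℓ + 2) (by omega) (by omega))]
      exact and_congr_right fun _ => ih (ℓ := ℓ + 1) hlt (by omega)
    · rw [List.drop_of_length_le (by omega), absentAfter_singleton_iff heq hin, ← heq]
      have hvac : ∀ m, ℓ + 1 ≤ m → m < ℓ + 1 → F.lastPosArch (m + 1) (letterAt u (m + 2)) ≤
          F.firstPosArch (m + 1) (letterAt u (m + 1)) := fun m h₁ h₂ => by omega
      simp only [hmem (ℓ + 2) (by omega) (by omega), true_and]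
      tauto

theorem isSAS_iff_forall_lastPosArch_le (hu : u.length = F.k + 1) (hletters : ∀ a ∈ u, a ∈ w) :
    IsSAS w u ↔ (∀ m < F.k, F.lastPosArch (m + 1) (letterAt u (m + 2)) ≤
        F.firstPosArch (m + 1) (letterAt u (m + 1))) ∧
      F.lastPosArch F.k (letterAt u (F.k + 1)) ∈ F.lastSet F.k := by
  have hk := F.k_pos
  have hleast := isLeast_firstPosArch hk (hletters _ (letterAt_mem le_rfl (by omega)))
  have hu' : u = letterAt u 1 :: u.drop 1 := drop_eq_letterAt_cons (w := u) (p := 0) (by omega)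
  have hrest : F.lastPosArch F.k (letterAt u (F.k + 1)) ∈ F.lastSet F.k ↔
      letterAt u (F.k + 1) ∉ F.rest := by
    obtain ⟨ℓ, hℓ⟩ := Nat.exists_eq_add_of_le' hk
    rw [← mem_filteredLetters_k, hℓ, Nat.succ_eq_add_one,
      lastPosArch_mem_lastSet_iff (by omega) (hletters _ (letterAt_mem (by omega) (by omega)))]
  rw [isSAS_iff, and_iff_right hu, hu', ← F.archEnd_zero, absentAfter_cons_iff_of_isLeast hleast,
    ← hu', hrest, absentAfter_drop_iff hu hletters hk]
  simp

end Check

end ArchFactorization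

/-! ### Reasoning about programs -/

namespace RamState

/-- The state after `t` idle steps. -/
abbrev tick (s : RamState) (t : ℕ) : RamState := { s with time := s.time + t }

end RamState

namespace RamExpr

instance : Coe RegName RamExpr := ⟨.reg⟩

instance (c : ℕ) : OfNat RamExpr c := ⟨.const c⟩

instance : Add RamExpr := ⟨.bin .add⟩

instance : Sub RamExpr := ⟨.bin .sub⟩

instance : Mul RamExpr := ⟨.bin .mul⟩

variable {B c : ℕ} {s : RamState} {e₁ e₂ : RamExpr}

@[simp] theorem eval_ofNat : (OfNat.ofNat c : RamExpr).eval s = c := rfl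

@[simp] theorem eval_add : (e₁ + e₂).eval s = e₁.eval s + e₂.eval s := rfl

@[simp] theorem eval_sub : (e₁ - e₂).eval s = e₁.eval s - e₂.eval s := rfl

@[simp] theorem eval_mul : (e₁ * e₂).eval s = e₁.eval s * e₂.eval s := rfl

@[simp] theorem fits_ofNat : (OfNat.ofNat c : RamExpr).Fits B s ↔ c ≤ B := Iff.rfl

@[simp] theorem fits_add :
    (e₁ + e₂).Fits B s ↔ e₁.Fits B s ∧ e₂.Fits B s ∧ e₁.eval s + e₂.eval s ≤ B := Iff.rfl

@[simp] theorem fits_sub :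
    (e₁ - e₂).Fits B s ↔ e₁.Fits B s ∧ e₂.Fits B s ∧ e₁.eval s - e₂.eval s ≤ B := Iff.rfl

@[simp] theorem fits_mul :
    (e₁ * e₂).Fits B s ↔ e₁.Fits B s ∧ e₂.Fits B s ∧ e₁.eval s * e₂.eval s ≤ B := Iff.rfl

end RamExpr

attribute [simp] BinOp.eval RamExpr.eval RamExpr.Fits

theorem ite_one_zero_le {B : ℕ} (hB : 1 ≤ B) {P : Prop} [Decidable P] :
    (if P then 1 else 0) ≤ B := by
  split_ifs <;> omega

infix:50 " <ₑ " => RamExpr.bin BinOp.lt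

infix:50 " =ₑ " => RamExpr.bin BinOp.eq

infix:62 " ≔ " => RamProg.assign

infixr:60 " ;; " => RamProg.seq

namespace RamProg

/-- The state in which a loop-free program halts; loops are skipped. -/
@[simp] def run : RamProg → RamState → RamState
  | skip, s => s.tick 1
  | assign x e, s =>
    { s with reg := Function.update s.reg x (e.eval s), time := s.time + e.cost + 1 }
  | store A idx e, s =>
    { s with
      arr := Function.update s.arr A (Function.update (s.arr A) (idx.eval s) (e.eval s))
      time := s.time + idx.cost + e.cost + 1 }
  | emit e, s => { s with cur := s.cur ++ [e.eval s], time := s.time + e.cost + 1 }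
  | endWord, s =>
    { s with cur := [], out := s.out ++ [(s.cur, s.time + 1)], time := s.time + 1 }
  | seq p q, s => q.run (p.run s)
  | ite e p q, s =>
    if e.eval s = 0 then q.run (s.tick (e.cost + 1)) else p.run (s.tick (e.cost + 1))
  | .while _ _, s => s

/-- The program is loop-free, and no value exceeds `B` when it is started in the given state. -/
@[simp] def Safe (B : ℕ) : RamProg → RamState → Prop
  | skip, _ => True
  | assign _ e, s => e.Fits B s
  | store _ idx e, s => idx.Fits B s ∧ e.Fits B s
  | emit e, s => e.Fits B s
  | endWord, _ => True
  | seq p q, s => p.Safe B s ∧ q.Safe B (p.run s)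
  | ite e p q, s => e.Fits B s ∧
    if e.eval s = 0 then q.Safe B (s.tick (e.cost + 1)) else p.Safe B (s.tick (e.cost + 1))
  | .while _ _, _ => False

/-- The largest number of steps that a loop-free program can make; loops are skipped. -/
def maxCost : RamProg → ℕ
  | skip => 1
  | assign _ e => e.cost + 1
  | store _ idx e => idx.cost + e.cost + 1
  | emit e => e.cost + 1
  | endWord => 1
  | seq p q => p.maxCost + q.maxCost
  | ite e p q => e.cost + 1 + max p.maxCost q.maxCost
  | .while _ _ => 0

/-- The registers to which a program assigns. -/
def assignedRegs : RamProg → List RegName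
  | assign x _ => [x]
  | seq p q => p.assignedRegs ++ q.assignedRegs
  | ite _ p q => p.assignedRegs ++ q.assignedRegs
  | .while _ p => p.assignedRegs
  | _ => []

/-- The arrays into which a program stores. -/
def storedArrs : RamProg → List ArrName
  | store A _ _ => [A]
  | seq p q => p.storedArrs ++ q.storedArrs
  | ite _ p q => p.storedArrs ++ q.storedArrs
  | .while _ p => p.storedArrs
  | _ => []

variable {B t t' : ℕ} {s s' : RamState} {p q : RamProg} {e : RamExpr} {Q R : RamState → Prop}

theorem exec_run (h : p.Safe B s) : Exec B p s (p.run s) := by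
  induction p generalizing s with
  | skip => exact .skip s
  | assign x e => exact .assign x e s h
  | store A idx e => exact .store A idx e s h.1 h.2
  | emit e => exact .emit e s h
  | endWord => exact .endWord s
  | seq p q ihp ihq => exact .seq p q s _ _ (ihp h.1) (ihq h.2)
  | ite e p q ihp ihq =>
    obtain ⟨hfits, h⟩ := h
    by_cases he : e.eval s = 0
    · rw [if_pos he] at h
      rw [run, if_pos he]
      exact .ite_false e p q s _ hfits he (ihq h)
    · rw [if_neg he] at h
      rw [run, if_neg he]
      exact .ite_true e p q s _ hfits he (ihp h)
  | _ => exact h.elim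

theorem time_run_le (p : RamProg) (s : RamState) : (p.run s).time ≤ s.time + p.maxCost := by
  induction p generalizing s with
  | seq p q ihp ihq =>
    have := ihp s
    have := ihq (p.run s)
    simp only [run, maxCost]
    omega
  | ite e p q ihp ihq =>
    have := ihp (s.tick (e.cost + 1))
    have := ihq (s.tick (e.cost + 1))
    have := le_max_left p.maxCost q.maxCost
    have := le_max_right p.maxCost q.maxCost
    simp only [run, maxCost] at *
    split_ifs <;> omega
  | _ => simp only [run, maxCost]; omega

theorem _root_.Exec.reg_eq (h : Exec B p s s') {x : RegName} (hx : x ∉ p.assignedRegs) :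
    s'.reg x = s.reg x := by
  induction h with
  | assign y e s _ => exact Function.update_of_ne (by simpa [assignedRegs] using hx) _ _
  | seq p q _ _ _ _ _ ihp ihq =>
    simp only [assignedRegs, List.mem_append, not_or] at hx
    exact (ihq hx.2).trans (ihp hx.1)
  | ite_true e p q _ _ _ _ _ ih =>
    simp only [assignedRegs, List.mem_append, not_or] at hx
    exact ih hx.1
  | ite_false e p q _ _ _ _ _ ih =>
    simp only [assignedRegs, List.mem_append, not_or] at hx
    exact ih hx.2
  | while_true e p _ _ _ _ _ _ _ ihp ihw => exact (ihw hx).trans (ihp hx)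
  | _ => rfl

theorem _root_.Exec.arr_eq (h : Exec B p s s') {A : ArrName} (hA : A ∉ p.storedArrs) :
    s'.arr A = s.arr A := by
  induction h with
  | store A' idx e s _ _ => exact Function.update_of_ne (by simpa [storedArrs] using hA) _ _
  | seq p q _ _ _ _ _ ihp ihq =>
    simp only [storedArrs, List.mem_append, not_or] at hA
    exact (ihq hA.2).trans (ihp hA.1)
  | ite_true e p q _ _ _ _ _ ih =>
    simp only [storedArrs, List.mem_append, not_or] at hA
    exact ih hA.1
  | ite_false e p q _ _ _ _ _ ih =>
    simp only [storedArrs, List.mem_append, not_or] at hA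
    exact ih hA.2
  | while_true e p _ _ _ _ _ _ _ ihp ihw => exact (ihw hA).trans (ihp hA)
  | _ => rfl

/-- Started in `s`, the program `p` halts after at most `t` steps in a state that satisfies `Q`, and
no value exceeds `B`. -/
def RunsIn (B t : ℕ) (p : RamProg) (s : RamState) (Q : RamState → Prop) : Prop :=
  ∃ s', Exec B p s s' ∧ s'.time ≤ s.time + t ∧ Q s'

theorem RunsIn.of_safe (h : p.Safe B s) (hQ : Q (p.run s)) : RunsIn B p.maxCost p s Q :=
  ⟨p.run s, exec_run h, time_run_le p s, hQ⟩

theorem RunsIn.mono (h : RunsIn B t p s Q) (ht : t ≤ t') (hQ : ∀ s', Q s' → R s') :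
    RunsIn B t' p s R := by
  obtain ⟨s', hexec, htime, hs'⟩ := h
  exact ⟨s', hexec, by omega, hQ s' hs'⟩

theorem RunsIn.seq (hp : RunsIn B t p s R) (hq : ∀ s', R s' → RunsIn B t' q s' Q) :
    RunsIn B (t + t') (p ;; q) s Q := by
  obtain ⟨s₁, hexec₁, htime₁, hs₁⟩ := hp
  obtain ⟨s₂, hexec₂, htime₂, hs₂⟩ := hq s₁ hs₁
  exact ⟨s₂, .seq p q s s₁ s₂ hexec₁ hexec₂, by omega, hs₂⟩

/-- The invariant `I` is indexed by the number of iterations that are still to be made. -/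
theorem RunsIn.while {I : ℕ → RamState → Prop} (htick : ∀ m s t, I m s → I m (s.tick t))
    (hfits : ∀ m s, I m s → e.Fits B s) (heval : ∀ m s, I m s → (e.eval s = 0 ↔ m = 0))
    (hstep : ∀ m s, I (m + 1) s → RunsIn B t p s (I m)) {m : ℕ} (h : I m s) :
    RunsIn B (m * (e.cost + 1 + t) + (e.cost + 1)) (.while e p) s (I 0) := by
  induction m generalizing s with
  | zero =>
    exact ⟨_, .while_false e p s (hfits 0 s h) ((heval 0 s h).2 rfl), by simp [add_assoc],
      htick 0 s (e.cost + 1) h⟩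
  | succ m ih =>
    obtain ⟨s₁, hexec₁, htime₁, hs₁⟩ := hstep m _ (htick _ s (e.cost + 1) h)
    obtain ⟨s₂, hexec₂, htime₂, hs₂⟩ := ih hs₁
    have hne : e.eval s ≠ 0 := fun he => m.succ_ne_zero ((heval _ s h).1 he)
    exact ⟨s₂, .while_true e p s s₁ s₂ (hfits _ s h) hne hexec₁ hexec₂, by
      rw [add_one_mul]
      dsimp only at htime₁
      omega, hs₂⟩

theorem RunsIn.while_lt {J : ℕ → RamState → Prop} {x y : RegName} {N ℓ : ℕ} (hB : 1 ≤ B)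
    (hN : N ≤ B) (htick : ∀ ℓ s t, J ℓ s → J ℓ (s.tick t))
    (hreg : ∀ ℓ s, J ℓ s → s.reg x = ℓ ∧ s.reg y = N)
    (hstep : ∀ ℓ s, ℓ < N → J ℓ s → RunsIn B t p s (J (ℓ + 1))) (h : J ℓ s) (hℓ : ℓ ≤ N) :
    RunsIn B ((N - ℓ) * (4 + t) + 4) (.while (x <ₑ y) p) s (J N) := by
  refine (RunsIn.while (I := fun m s => m ≤ N ∧ J (N - m) s) (m := N - ℓ)
    (fun m s t hs => ⟨hs.1, htick _ s t hs.2⟩) (fun m s hs => ?_) (fun m s hs => ?_)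
    (fun m s hs => ?_) ⟨by omega, by rwa [Nat.sub_sub_self hℓ]⟩).mono le_rfl fun s' hs' => hs'.2
  · obtain ⟨hx, hy⟩ := hreg _ s hs.2
    simpa [hx, hy, hN, ite_one_zero_le hB] using (Nat.sub_le N m).trans hN
  · obtain ⟨hx, hy⟩ := hreg _ s hs.2
    simp only [RamExpr.eval, BinOp.eval, hx, hy, ite_eq_right_iff, one_ne_zero, imp_false]
    omega
  · refine (hstep (N - (m + 1)) s (by omega) hs.2).mono le_rfl fun s' hs' => ⟨by omega, ?_⟩
    rwa [show N - m = N - (m + 1) + 1 by omega]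

end RamProg

namespace Exec

variable {B σ : ℕ} {w u : List ℕ} {s s' : RamState} {p : RamProg}

theorem holdsInput (h : Exec B p s s') (hs : HoldsInput σ w s)
    (hn : .n ∉ p.assignedRegs) (hsigma : .sigma ∉ p.assignedRegs) (hword : .word ∉ p.storedArrs) :
    HoldsInput σ w s' where
  n := (h.reg_eq hn).trans hs.n
  sigma := (h.reg_eq hsigma).trans hs.sigma
  word := h.arr_eq hword ▸ hs.word

theorem holdsQuery (h : Exec B p s s') (hs : HoldsQuery u s) (hquery : .query ∉ p.storedArrs) :
    HoldsQuery u s' := by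
  rwa [HoldsQuery, h.arr_eq hquery]

end Exec

namespace RamProg

/-- The program writes only to the answer register and to scratch memory, so that it leaves the
precomputed data intact. -/
def LeavesData (p : RamProg) : Prop :=
  (∀ x ∈ p.assignedRegs, x = .ans ∨ ∃ i, x = .tmp i) ∧ ∀ A ∈ p.storedArrs, ∃ i, A = .tmp i

end RamProg

theorem Exec.holdsData {B σ : ℕ} {w : List ℕ} {F : ArchFactorization w} {s s' : RamState}
    {p : RamProg} (h : Exec B p s s') (hp : p.LeavesData) (hs : HoldsData σ w F s) :
    HoldsData σ w F s' := by
  have hreg : ∀ x, x ≠ .ans → (∀ i, x ≠ .tmp i) → s'.reg x = s.reg x := fun x hans htmp =>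
    h.reg_eq fun hx => (hp.1 x hx).elim hans fun ⟨i, hi⟩ => htmp i hi
  have harr : ∀ A, (∀ i, A ≠ .tmp i) → s'.arr A = s.arr A := fun A htmp =>
    h.arr_eq fun hA => (hp.2 A hA).elim htmp
  constructor
  · constructor <;> simp only [hreg, harr, ne_eq, reduceCtorEq, not_false_eq_true, implies_true]
    exacts [hs.n, hs.sigma, hs.word]
  all_goals simp only [hreg, harr, ne_eq, reduceCtorEq, not_false_eq_true, implies_true]
  exacts [hs.k, hs.archEnd, hs.firstPosArch, hs.lastPosArch, hs.sortedLen, hs.sortedLast, hs.leq,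
    hs.lex, hs.startLen, hs.startSAS, hs.init]

/-! ### Checking a word -/

theorem IsWordOver.toFinset_eq {σ : ℕ} {w : List ℕ} (hw : IsWordOver σ w) :
    w.toFinset = Finset.Icc 1 σ := by
  ext a
  rw [List.mem_toFinset, hw, Finset.mem_Icc]

namespace ArchFactorization

variable {w : List ℕ} {F : ArchFactorization w} {σ ℓ a : ℕ}

theorem mul_le_archEnd (hw : IsWordOver σ w) (hℓ : ℓ ≤ F.k) : ℓ * σ ≤ F.archEnd ℓ := by
  induction ℓ with
  | zero => simp
  | succ ℓ ih =>
    have hcard : (Finset.Icc 1 σ).card ≤ (Finset.Ioc (F.archEnd ℓ) (F.archEnd (ℓ + 1))).card := by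
      refine Finset.card_le_card_of_injOn (F.firstPosArch (ℓ + 1))
        (fun a ha => ?_) fun a ha b hb hab => ?_
      · exact Finset.mem_coe.2 (Finset.mem_Ioc.2
          (inArch_firstPosArch hℓ ((hw a).2 (Finset.mem_Icc.1 ha))))
      · rw [← letterAt_firstPosArch hℓ ((hw a).2 (Finset.mem_Icc.1 ha)), hab,
          letterAt_firstPosArch hℓ ((hw b).2 (Finset.mem_Icc.1 hb))]
    rw [Nat.card_Icc, Nat.card_Ioc] at hcard
    have := ih (by omega)
    have := F.archEnd_mono (Nat.le_add_right ℓ 1)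
    rw [add_one_mul]
    omega

theorem mul_add_le_length (hw : IsWordOver σ w) (hℓ : ℓ < F.k) (ha : a ≤ σ) :
    ℓ * σ + a ≤ w.length := by
  have := (mul_le_archEnd hw (Nat.succ_le_of_lt hℓ)).trans (F.archEnd_le_length _)
  rw [Nat.succ_mul] at this
  omega

theorem one_le_of_isWordOver (F : ArchFactorization w) (hw : IsWordOver σ w) : 1 ≤ σ := by
  obtain ⟨a, ha, -⟩ := F.rest_missing
  have := (hw a).1 ha
  omega

theorem k_le_length (F : ArchFactorization w) (hw : IsWordOver σ w) : F.k ≤ w.length :=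
  (Nat.le_mul_of_pos_right _ (F.one_le_of_isWordOver hw)).trans
    ((mul_le_archEnd hw le_rfl).trans (F.archEnd_le_length _))

theorem length_sortedLast_le (hw : IsWordOver σ w) : (F.sortedLast ℓ).length ≤ σ := by
  rw [sortedLast, Finset.length_sort, lastSet]
  refine (Finset.card_le_card Finset.sdiff_subset).trans (Finset.card_image_le.trans ?_)
  rw [hw.toFinset_eq, Nat.card_Icc, Nat.add_sub_cancel]

theorem length_choices_le (hw : IsWordOver σ w) : (F.choices ℓ).length ≤ σ := by
  cases ℓ with
  | zero =>
    refine (List.length_filter_le _ _).trans_eq ?_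
    rw [List.length_map, Finset.length_sort, hw.toFinset_eq, Nat.card_Icc, Nat.add_sub_cancel]
  | succ ℓ => exact length_sortedLast_le hw

end ArchFactorization

namespace HoldsData

variable {σ ℓ a i t : ℕ} {w : List ℕ} {F : ArchFactorization w} {s : RamState}

theorem arr_firstPosArch (hs : HoldsData σ w F s) (hw : IsWordOver σ w) (hℓ : ℓ < F.k)
    (ha : a ∈ w) : s.arr .firstPosArch (ℓ * σ + a) = F.firstPosArch (ℓ + 1) a :=
  hs.firstPosArch (ℓ + 1) a ℓ.succ_pos hℓ ((hw a).1 ha).1 ((hw a).1 ha).2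

theorem arr_lastPosArch (hs : HoldsData σ w F s) (hw : IsWordOver σ w) (hℓ : ℓ < F.k)
    (ha : a ∈ w) : s.arr .lastPosArch (ℓ * σ + a) = F.lastPosArch (ℓ + 1) a :=
  hs.lastPosArch (ℓ + 1) a ℓ.succ_pos hℓ ((hw a).1 ha).1 ((hw a).1 ha).2

theorem arr_sortedLast (hs : HoldsData σ w F s) (hℓ : ℓ < F.k) (ht : 1 ≤ t)
    (ht' : t ≤ (F.sortedLast (ℓ + 1)).length) :
    s.arr .sortedLast (ℓ * σ + t) = letterAt (F.sortedLast (ℓ + 1)) t :=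
  hs.sortedLast (ℓ + 1) t ℓ.succ_pos hℓ ht ht'

theorem arr_leq (hs : HoldsData σ w F s) (hℓ : ℓ < F.k) (hi : F.InArch (ℓ + 1) i) :
    s.arr .leq i = F.leqCount (ℓ + 1) i :=
  hs.leq (ℓ + 1) i ℓ.succ_pos hℓ hi

end HoldsData

namespace RegName

abbrev pos : RegName := .tmp 0

abbrev level : RegName := .tmp 1

abbrev count : RegName := .tmp 2

end RegName

section

open RamProg RamExpr RegName ArrName

/-- One iteration of the check: the letters `u[ℓ + 1]` and `u[ℓ + 2]` of the query are compared in
the arch `ℓ + 1`, where `ℓ` is the contents of the register `level`. -/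
def checkStep : RamProg :=
  pos ≔ get firstPosArch (level * sigma + get query (level + 1)) ;;
  ans ≔ ans - (pos <ₑ get lastPosArch (level * sigma + get query (level + 2))) ;;
  level ≔ level + 1

/-- The test of the last letter of the query. -/
def checkLast : RamProg :=
  level ≔ k - 1 ;;
  pos ≔ get lastPosArch (level * sigma + get query (k + 1)) ;;
  count ≔ get leq pos ;;
  ite count (ans ≔ ans - (get sortedLast (level * sigma + count) <ₑ pos)) (ans ≔ 0)

/-- The program that checks whether the query is a shortest absent subsequence. -/
def checkProg : RamProg :=
  (ans ≔ 1 ;; level ≔ 0) ;; .while (level <ₑ k) checkStep ;; checkLast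

end

/-- The state of the check before the iteration for arch `ℓ + 1`. -/
structure CheckInvariant (σ : ℕ) (w u : List ℕ) (F : ArchFactorization w) (ℓ : ℕ)
    (s : RamState) : Prop extends HoldsData σ w F s where
  query : HoldsQuery u s
  level : s.reg .level = ℓ
  ans : s.reg .ans = if ∀ m < ℓ, F.lastPosArch (m + 1) (letterAt u (m + 2)) ≤
    F.firstPosArch (m + 1) (letterAt u (m + 1)) then 1 else 0

section

variable {B σ ℓ a : ℕ} {w u : List ℕ} {F : ArchFactorization w} {s : RamState}

open ArchFactorization RamProg

theorem checkStep_runs (hw : IsWordOver σ w) (hB : 2 * w.length ≤ B) (hu : u.length = F.k + 1)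
    (hletters : ∀ a ∈ u, a ∈ w) (hℓ : ℓ < F.k) (h : CheckInvariant σ w u F ℓ s) :
    RunsIn B checkStep.maxCost checkStep s (CheckInvariant σ w u F (ℓ + 1)) := by
  have hσ := F.one_le_of_isWordOver hw
  have hcσ := mul_add_le_length hw hℓ le_rfl
  have hk := F.k_le_length hw
  have ha := hletters _ (letterAt_mem (w := u) (i := ℓ + 1) (by omega) (by omega))
  have hb := hletters _ (letterAt_mem (w := u) (i := ℓ + 2) (by omega) (by omega))
  have hqa := h.query (ℓ + 1) (by omega) (by omega)
  have hqb := h.query (ℓ + 2) (by omega) (by omega)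
  have hca := mul_add_le_length hw hℓ ((hw _).1 ha).2
  have hcb := mul_add_le_length hw hℓ ((hw _).1 hb).2
  have hfirst := h.arr_firstPosArch hw hℓ ha
  have hlast := h.arr_lastPosArch hw hℓ hb
  have := (inArch_firstPosArch hℓ ha).le_length
  have := (inArch_lastPosArch hℓ hb).le_length
  have hans : s.reg .ans ≤ 1 := h.ans ▸ ite_one_zero_le le_rfl
  have hsafe : checkStep.Safe B s := by
    simp (disch := first | omega | simp) [checkStep, h.level, h.sigma, hqa, hqb, hfirst, hlast,
      hB.trans', ite_one_zero_le]
  have hexec := exec_run hsafe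
  refine .of_safe hsafe ⟨hexec.holdsData ?_ h.toHoldsData, hexec.holdsQuery h.query ?_, ?_, ?_⟩
  · simp [RamProg.LeavesData, checkStep, RamProg.assignedRegs, RamProg.storedArrs]
  · simp [checkStep, RamProg.storedArrs]
  · simp [checkStep, h.level]
  · have hval : (checkStep.run s).reg .ans = s.reg .ans -
        if F.firstPosArch (ℓ + 1) (letterAt u (ℓ + 1)) < F.lastPosArch (ℓ + 1) (letterAt u (ℓ + 2))
        then 1 else 0 := by
      simp [checkStep, h.level, h.sigma, hqa, hqb, hfirst, hlast]
    rw [hval, h.ans]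
    grind

theorem checkLast_safe_and_ans (hw : IsWordOver σ w) (hB : 2 * w.length ≤ B)
    (hℓ : F.k = ℓ + 1) (hs : HoldsData σ w F s) (ha : a ∈ w) (hquery : s.arr .query (ℓ + 2) = a)
    (hans : s.reg .ans ≤ 1) :
    checkLast.Safe B s ∧ (checkLast.run s).reg .ans =
      if F.lastPosArch (ℓ + 1) a ∈ F.lastSet (ℓ + 1) then s.reg .ans else 0 := by
  have hℓk : ℓ < F.k := by omega
  have hσ := F.one_le_of_isWordOver hw
  have hcσ := mul_add_le_length hw hℓk le_rfl
  have hkw := F.k_le_length hw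
  have hk := hs.k.trans hℓ
  have hca := mul_add_le_length hw hℓk ((hw _).1 ha).2
  have hlast := hs.arr_lastPosArch hw hℓk ha
  have hin := inArch_lastPosArch hℓk ha
  have hinw := hin.le_length
  generalize F.lastPosArch (ℓ + 1) a = q at *
  have hleq := hs.arr_leq hℓk hin
  have hmem := F.mem_lastSet_iff_letterAt_leqCount (ℓ := ℓ + 1) (j := q)
  have hcount := F.leqCount_le_length (ℓ := ℓ + 1) (i := q)
  have hcc := mul_add_le_length hw hℓk (hcount.trans (length_sortedLast_le hw))
  rcases Nat.eq_zero_or_pos (F.leqCount (ℓ + 1) q) with hzero | hpos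
  · constructor <;> simp (disch := first | omega | simp) [checkLast, hk, hs.sigma, hquery, hlast,
      hleq, hzero, hmem, hB.trans']
  · have hsorted := hs.arr_sortedLast hℓk hpos hcount
    have hle := (F.letterAt_sortedLast_le_iff hpos hcount).2 le_rfl
    have hne : F.leqCount (ℓ + 1) q ≠ 0 := hpos.ne'
    constructor
    · simp (disch := first | omega | simp) [checkLast, hk, hs.sigma, hquery, hlast, hleq, hne,
        hsorted, hB.trans', ite_one_zero_le]
    · rcases hle.eq_or_lt with heq | hlt
      · simp [checkLast, hk, hs.sigma, hquery, hlast, hleq, hne, hsorted, hmem, heq]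
      · simp [checkLast, hk, hs.sigma, hquery, hlast, hleq, hne, hsorted, hmem, hlt, hlt.ne, hans]

theorem checkLast_runs (hw : IsWordOver σ w) (hB : 2 * w.length ≤ B) (hu : u.length = F.k + 1)
    (hletters : ∀ a ∈ u, a ∈ w) (h : CheckInvariant σ w u F F.k s) :
    RunsIn B checkLast.maxCost checkLast s fun s' => HoldsData σ w F s' ∧
      (IsSAS w u → s'.reg .ans = 1) ∧ (¬ IsSAS w u → s'.reg .ans = 0) := by
  obtain ⟨ℓ, hℓ⟩ : ∃ ℓ, F.k = ℓ + 1 := Nat.exists_eq_add_of_le' F.k_pos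
  have hans : s.reg .ans ≤ 1 := h.ans ▸ ite_one_zero_le le_rfl
  obtain ⟨hsafe, hval⟩ := checkLast_safe_and_ans hw hB hℓ h.toHoldsData
    (hletters _ (letterAt_mem (by omega) (by omega))) (h.query (ℓ + 2) (by omega) (by omega)) hans
  refine .of_safe hsafe ⟨(exec_run hsafe).holdsData ?_ h.toHoldsData, ?_⟩
  · simp [LeavesData, checkLast, assignedRegs, storedArrs]
  · rw [hval, h.ans, isSAS_iff_forall_lastPosArch_le hu hletters, hℓ]
    grind

theorem checkProg_runs (hw : IsWordOver σ w) (hB : 2 * w.length ≤ B) (hu : u.length = F.k + 1)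
    (hletters : ∀ a ∈ u, a ∈ w) (hs : HoldsData σ w F s) (hquery : HoldsQuery u s) :
    RunsIn B (70 * F.k) checkProg s fun s' => HoldsData σ w F s' ∧
      (IsSAS w u → s'.reg .ans = 1) ∧ (¬ IsSAS w u → s'.reg .ans = 0) := by
  have hk := F.k_pos
  have hkw := F.k_le_length hw
  have hsafe : (.ans ≔ 1 ;; .level ≔ 0 : RamProg).Safe B s := by
    simp (disch := first | omega | simp) [hB.trans']
  have hstart : CheckInvariant σ w u F 0 ((.ans ≔ 1 ;; .level ≔ 0 : RamProg).run s) :=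
    { (exec_run hsafe).holdsData (by simp [LeavesData, assignedRegs, storedArrs]) hs with
      query := hquery
      level := by simp
      ans := by simp }
  have htime : 4 + ((F.k - 0) * (4 + 28) + 4 + 30) ≤ 70 * F.k := by omega
  refine ((RunsIn.of_safe hsafe hstart).seq fun s₁ hs₁ => (RunsIn.while_lt (by omega) (by omega)
    (fun _ _ _ h => { h with }) (fun _ _ h => ⟨h.level, h.k⟩)
    (fun _ _ hℓ h => checkStep_runs hw hB hu hletters hℓ h) hs₁ (Nat.zero_le _)).seq
    fun s₂ hs₂ => checkLast_runs hw hB hu hletters hs₂).mono htime fun _ h => h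

end

/-! ### The lexicographically smallest shortest absent subsequence -/

namespace ArchFactorization

variable {w : List ℕ} {F : ArchFactorization w} {ℓ j : ℕ}

theorem exists_inArch_of_mem_choices (hℓ : ℓ ≤ F.k) (hj : j ∈ F.choices ℓ) :
    ∃ m < F.k, F.InArch (m + 1) j := by
  cases ℓ with
  | zero =>
    obtain ⟨ha, hpos, -⟩ := mem_startSAS_iff.1 hj
    exact ⟨0, F.k_pos, hpos ▸ inArch_firstPosArch F.k_pos ha⟩
  | succ ℓ => exact ⟨ℓ, hℓ, inArch_of_mem_lastSet hℓ (F.mem_sortedLast.1 hj)⟩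

theorem branching_le_length : F.branching ℓ j ≤ (F.choices (ℓ + 1)).length := F.leqCount_le_length

theorem lexArr_branching_mem (hℓ : ℓ < F.k) (hj : j ∈ F.choices ℓ) :
    F.lexArr (ℓ + 1) (F.branching ℓ j) ∈ F.choices (ℓ + 1) := by
  have hpos := branching_pos hℓ hj
  refine List.mem_of_mem_take (argmin_getD_mem ?_)
  rw [ne_eq, List.take_eq_nil_iff, not_or]
  exact ⟨hpos.ne', List.ne_nil_of_length_pos (hpos.trans_le F.leqCount_le_length)⟩

theorem init_mem_startSAS : F.init ∈ F.startSAS := argmin_getD_mem F.startSAS_ne_nil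

theorem lexWord_branching (hℓ : ℓ < F.k) : F.lexWord (F.k - ℓ) (F.branching ℓ j) =
    letterAt w (F.lexArr (ℓ + 1) (F.branching ℓ j)) :: F.lexWord (F.k - (ℓ + 1))
      (F.branching (ℓ + 1) (F.lexArr (ℓ + 1) (F.branching ℓ j))) := by
  obtain ⟨d, hd⟩ : ∃ d, F.k = ℓ + 1 + d := Nat.exists_eq_add_of_le hℓ
  simp only [show F.k - ℓ = d + 1 by omega, show F.k - (ℓ + 1) = d by omega, lexWord,
    show F.k - d = ℓ + 1 by omega, choices, lexArr]

theorem lexWord_startSAS : F.lexWord (F.k + 1) F.startSAS.length =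
    letterAt w F.init :: F.lexWord F.k (F.branching 0 F.init) := by
  simp only [lexWord, Nat.sub_self, choices, List.take_length, init]

theorem isSAS_lexWord : IsSAS w (F.lexWord (F.k + 1) F.startSAS.length) :=
  mem_sasWords_startSAS_iff.1 <| lexWord_mem_sasWords le_rfl <| by
    simpa [choices] using F.startSAS_ne_nil

theorem lexWord_le_of_isSAS {v : List ℕ} (hv : IsSAS w v) :
    F.lexWord (F.k + 1) F.startSAS.length ≤ v :=
  lexWord_le (mem_sasWords_startSAS_iff.2 hv)

end ArchFactorization

namespace HoldsData

variable {σ ℓ j t : ℕ} {w : List ℕ} {F : ArchFactorization w} {s : RamState}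

theorem arr_lex (hs : HoldsData σ w F s) (hℓ : ℓ < F.k) (ht : 1 ≤ t)
    (ht' : t ≤ (F.sortedLast (ℓ + 1)).length) :
    s.arr .lex (ℓ * σ + t) = F.lexArr (ℓ + 1) t :=
  hs.lex (ℓ + 1) t ℓ.succ_pos hℓ ht ht'

theorem arr_leq_firstPosArch (hs : HoldsData σ w F s) (hw : IsWordOver σ w) (hℓ : ℓ < F.k)
    (hj : j ∈ F.choices ℓ) :
    s.arr .leq (s.arr .firstPosArch (ℓ * σ + letterAt w j)) = F.branching ℓ j := by
  have ha := ArchFactorization.letterAt_mem_of_mem_choices hℓ.le hj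
  rw [hs.arr_firstPosArch hw hℓ ha,
    hs.arr_leq hℓ (ArchFactorization.inArch_firstPosArch hℓ ha), ArchFactorization.branching]

end HoldsData

section

open RamProg RamExpr RegName ArrName

/-- One step of the descent in the tree of choices along the smallest letters. -/
def lexMinStep : RamProg :=
  emit (get word pos) ;;
  pos ≔ get lex (level * sigma + get leq (get firstPosArch (level * sigma + get word pos))) ;;
  level ≔ level + 1

/-- The output of the last letter. -/
def lexMinLast : RamProg :=
  emit (get word pos) ;; endWord

/-- The program that outputs the lexicographically smallest shortest absent subsequence. -/
def lexMinProg : RamProg :=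
  (pos ≔ RegName.init ;; level ≔ 0) ;; .while (level <ₑ k) lexMinStep ;; lexMinLast

end

/-- The state of the descent at depth `ℓ` of the tree of choices, before the letter of the current
position is output. -/
structure LexMinInvariant (σ : ℕ) (w : List ℕ) (F : ArchFactorization w) (ℓ : ℕ) (s : RamState) :
    Prop extends HoldsData σ w F s where
  level : s.reg .level = ℓ
  out : s.out = []
  mem_choices : s.reg .pos ∈ F.choices ℓ
  cur : s.cur ++ letterAt w (s.reg .pos) :: F.lexWord (F.k - ℓ) (F.branching ℓ (s.reg .pos)) =
    F.lexWord (F.k + 1) F.startSAS.length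

section

variable {B σ ℓ : ℕ} {w : List ℕ} {F : ArchFactorization w} {s : RamState}

open ArchFactorization RamProg

theorem lexMinStep_runs (hw : IsWordOver σ w) (hB : 2 * w.length ≤ B) (hℓ : ℓ < F.k)
    (h : LexMinInvariant σ w F ℓ s) :
    RunsIn B lexMinStep.maxCost lexMinStep s (LexMinInvariant σ w F (ℓ + 1)) := by
  have hcσ := mul_add_le_length hw hℓ le_rfl
  have hk := F.k_le_length hw
  have hj := h.mem_choices
  have hcur := h.cur
  generalize hpos : s.reg .pos = j at hj hcur
  obtain ⟨_, _, hin⟩ := exists_inArch_of_mem_choices hℓ.le hj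
  have hjw := hin.le_length
  have hword := h.word j hin.pos hjw
  have ha := letterAt_mem_of_mem_choices hℓ.le hj
  have hca := mul_add_le_length hw hℓ ((hw _).1 ha).2
  have hfirst := h.arr_firstPosArch hw hℓ ha
  have hfirstw := (inArch_firstPosArch hℓ ha).le_length
  have hleq := h.arr_leq_firstPosArch hw hℓ hj
  have hr := F.branching_le_length (ℓ := ℓ) (j := j)
  have hcr := mul_add_le_length hw hℓ (hr.trans (length_sortedLast_le hw))
  have hlex := h.arr_lex hℓ (branching_pos hℓ hj) hr
  have hmem := lexArr_branching_mem hℓ hj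
  obtain ⟨_, _, hin'⟩ := exists_inArch_of_mem_choices hℓ hmem
  have hlexw := hin'.le_length
  have hsafe : lexMinStep.Safe B s := by
    simp (disch := first | omega | simp) [lexMinStep, h.level, h.sigma, hpos, hword, hleq, hlex,
      hB.trans']
  refine .of_safe hsafe ⟨(exec_run hsafe).holdsData ?_ h.toHoldsData, ?_, ?_, ?_, ?_⟩
  · simp [LeavesData, lexMinStep, assignedRegs, storedArrs]
  · simp [lexMinStep, h.level]
  · simp [lexMinStep, h.out]
  · simpa [lexMinStep, h.level, h.sigma, hpos, hword, hleq, hlex] using hmem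
  · simp [lexMinStep, h.level, h.sigma, hpos, hword, hleq, hlex, ← hcur, lexWord_branching hℓ]

theorem lexMinLast_runs (hw : IsWordOver σ w) (hB : 2 * w.length ≤ B)
    (h : LexMinInvariant σ w F F.k s) :
    RunsIn B lexMinLast.maxCost lexMinLast s fun s' => HoldsData σ w F s' ∧ s'.cur = [] ∧
      ∃ t, s'.out = [(F.lexWord (F.k + 1) F.startSAS.length, t)] := by
  obtain ⟨_, _, hin⟩ := exists_inArch_of_mem_choices le_rfl h.mem_choices
  have hjw := hin.le_length
  have hword := h.word _ hin.pos hjw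
  have ha := ((hw _).1 (letterAt_mem_of_mem_choices le_rfl h.mem_choices)).2
  have hσ := mul_add_le_length hw F.k_pos le_rfl
  have hcur := h.cur
  rw [Nat.sub_self, lexWord] at hcur
  have hsafe : lexMinLast.Safe B s := by
    simp (disch := first | omega | simp) [lexMinLast, hword, hB.trans']
  refine .of_safe hsafe ⟨(exec_run hsafe).holdsData ?_ h.toHoldsData, rfl, s.time + 4, ?_⟩
  · simp [LeavesData, lexMinLast, assignedRegs, storedArrs]
  · simp [lexMinLast, hword, h.out, RamExpr.cost, hcur]

theorem lexMinProg_runs (hw : IsWordOver σ w) (hB : 2 * w.length ≤ B) (hs : HoldsData σ w F s)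
    (hcur : s.cur = []) (hout : s.out = []) :
    RunsIn B (40 * F.k) lexMinProg s fun s' => HoldsData σ w F s' ∧ s'.cur = [] ∧
      ∃ t, s'.out = [(F.lexWord (F.k + 1) F.startSAS.length, t)] := by
  have hk := F.k_pos
  have hkw := F.k_le_length hw
  obtain ⟨_, _, hinit⟩ := exists_inArch_of_mem_choices (Nat.zero_le _) F.init_mem_startSAS
  have hinitw := hinit.le_length
  have hsafe : (.pos ≔ RegName.init ;; .level ≔ 0 : RamProg).Safe B s := by
    simp (disch := first | omega | simp) [hs.init, hB.trans']
  have hstart : LexMinInvariant σ w F 0 ((.pos ≔ RegName.init ;; .level ≔ 0 : RamProg).run s) :=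
    { (exec_run hsafe).holdsData (by simp [LeavesData, assignedRegs, storedArrs]) hs with
      level := by simp
      out := hout
      mem_choices := by simpa [hs.init, choices] using F.init_mem_startSAS
      cur := by simp [hs.init, hcur, lexWord_startSAS] }
  have htime : 4 + ((F.k - 0) * (4 + 21) + 4 + 4) ≤ 40 * F.k := by omega
  refine ((RunsIn.of_safe hsafe hstart).seq fun s₁ hs₁ => (RunsIn.while_lt (by omega) (by omega)
    (fun _ _ _ h => { h with }) (fun _ _ h => ⟨h.level, h.k⟩)
    (fun _ _ hℓ h => lexMinStep_runs hw hB hℓ h) hs₁ (Nat.zero_le _)).seq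
    fun s₂ hs₂ => lexMinLast_runs hw hB hs₂).mono htime fun _ h => h

end

/-! ### Enumerating the shortest absent subsequences -/

namespace DelayAtMost

variable {D D' : ℕ} {v : List ℕ} {s s' : RamState}

theorem of_time_le (h : DelayAtMost D s) (hout : s'.out = s.out) (htime : s'.time ≤ s.time) :
    DelayAtMost D s' := by
  rw [DelayAtMost, List.isChain_append] at *
  rw [hout]
  refine ⟨h.1, List.isChain_singleton _, fun t ht t' ht' => ?_⟩
  obtain rfl : s'.time = t' := by simpa using ht'
  exact htime.trans (h.2.2 t ht s.time rfl)

theorem append_word (h : DelayAtMost D s) {t : ℕ} (hout : s'.out = s.out ++ [(v, t)])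
    (ht : t ≤ s.time) (htime : s'.time ≤ t + D) : DelayAtMost D s' := by
  have hchain := h.of_time_le (s' := { s with time := t }) rfl ht
  rw [DelayAtMost] at *
  rw [hout, List.map_append, ← List.cons_append, List.isChain_append]
  exact ⟨hchain, List.isChain_singleton _, by simpa [List.getLast?_cons] using htime⟩

theorem mono (h : DelayAtMost D s) (hD : D ≤ D') : DelayAtMost D' s :=
  List.IsChain.imp (fun _ _ ht => ht.trans (Nat.add_le_add_left hD _)) h

end DelayAtMost

theorem RamExpr.eval_tick {t : ℕ} {s : RamState} {e : RamExpr} : e.eval (s.tick t) = e.eval s := by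
  induction e with
  | get A idx ih => rw [eval, ih, eval]
  | bin op e₁ e₂ ih₁ ih₂ => rw [eval, ih₁, ih₂, eval]
  | _ => rfl

namespace RamProg

variable {B t t' : ℕ} {s : RamState} {p q : RamProg} {e : RamExpr} {Q : RamState → Prop}

theorem RunsIn.exec (h : RunsIn B t p s Q) : RunsIn B t p s fun s' => Exec B p s s' ∧ Q s' := by
  obtain ⟨s', hexec, htime, hs'⟩ := h
  exact ⟨s', hexec, htime, hexec, hs'⟩

theorem RunsIn.ite (hfits : e.Fits B s)
    (htrue : e.eval s ≠ 0 → RunsIn B t p (s.tick (e.cost + 1)) Q)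
    (hfalse : e.eval s = 0 → RunsIn B t' q (s.tick (e.cost + 1)) Q) :
    RunsIn B (e.cost + 1 + max t t') (.ite e p q) s Q := by
  by_cases he : e.eval s = 0
  · obtain ⟨s', hexec, htime, hs'⟩ := hfalse he
    refine ⟨s', .ite_false e p q s s' hfits he hexec, htime.trans ?_, hs'⟩
    have := le_max_right t t'
    dsimp only
    omega
  · obtain ⟨s', hexec, htime, hs'⟩ := htrue he
    refine ⟨s', .ite_true e p q s s' hfits he hexec, htime.trans ?_, hs'⟩
    have := le_max_left t t'
    dsimp only
    omega

/-- In the invariant `I P m s`, the words `P` are still to be output, the next of them within `m`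
iterations; every word that is output resets `m` to a value of at most `M`. -/
theorem exists_exec_while_of_delayAtMost {I : List (List ℕ) → ℕ → RamState → Prop} {M : ℕ}
    (htick : ∀ P m s t, I P m s → I P m (s.tick t)) (hfits : ∀ P m s, I P m s → e.Fits B s)
    (hnil : ∀ P m s, I P m s → e.eval s = 0 → P = [])
    (hstep : ∀ P m s, I P m s → e.eval s ≠ 0 → RunsIn B t p s fun s' =>
      (s'.out = s.out ∧ ∃ m' < m, I P m' s') ∨
        ∃ v P', P = v :: P' ∧ s'.out = s.out ++ [(v, s'.time)] ∧ ∃ m' ≤ M, I P' m' s')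
    (P : List (List ℕ)) (m : ℕ) (s : RamState) (h : I P m s)
    (hdelay : DelayAtMost ((e.cost + 1 + t) * (M + 1)) (s.tick ((e.cost + 1 + t) * (m + 1)))) :
    ∃ s', Exec B (.while e p) s s' ∧ (∃ m', I [] m' s') ∧
      s'.out.map Prod.fst = s.out.map Prod.fst ++ P ∧
      DelayAtMost ((e.cost + 1 + t) * (M + 1)) s' := by
  by_cases he : e.eval s = 0
  · obtain rfl := hnil P m s h he
    refine ⟨_, .while_false e p s (hfits _ m s h) he, ⟨m, htick _ m s (e.cost + 1) h⟩, by simp,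
      hdelay.of_time_le rfl ?_⟩
    dsimp only
    nlinarith
  · obtain ⟨s₁, hexec₁, htime, ⟨hout, m', hm', h₁⟩ | ⟨v, P', rfl, hout, m', hm', h₁⟩⟩ :=
      hstep P m _ (htick P m s (e.cost + 1) h) (RamExpr.eval_tick.trans_ne he)
    all_goals
      dsimp only at htime hout
    · obtain ⟨s₂, hexec₂, h₂, hwords, hdelay'⟩ := exists_exec_while_of_delayAtMost htick hfits hnil
        hstep P m' s₁ h₁ (hdelay.of_time_le hout (by dsimp only; nlinarith))
      exact ⟨s₂, .while_true e p s s₁ s₂ (hfits P m s h) he hexec₁ hexec₂, h₂, hout ▸ hwords,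
        hdelay'⟩
    · obtain ⟨s₂, hexec₂, h₂, hwords, hdelay'⟩ := exists_exec_while_of_delayAtMost htick hfits hnil
        hstep P' m' s₁ h₁ (hdelay.append_word hout (by dsimp only; nlinarith)
          (by dsimp only; gcongr))
      refine ⟨s₂, .while_true e p s s₁ s₂ (hfits _ m s h) he hexec₁ hexec₂, h₂, ?_, hdelay'⟩
      rw [hwords, hout, List.map_append, List.append_assoc, List.map_singleton,
        List.singleton_append]
termination_by (P.length, m)

end RamProg

namespace ArchFactorization

variable {w : List ℕ} (F : ArchFactorization w) {j t r : ℕ} {rem rem' chosen chosen' : ℕ → ℕ}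

/-- The shortest absent subsequences that a depth-first search of the tree of choices still has to
output when the letters `chosen 1, …, chosen (t - 1)` are fixed and, for every `i ≤ t`, the first
`rem i` choices for the letter `i` are still to be explored. -/
noncomputable def pending (rem chosen : ℕ → ℕ) : ℕ → List (List ℕ)
  | 0 => []
  | t + 1 => (F.sasWords (F.k + 1 - t) (rem (t + 1))).map
      ((List.range t).map (fun i => chosen (i + 1)) ++ ·) ++ pending rem chosen t

variable {F}

theorem pending_congr (hrem : ∀ i < t, rem (i + 1) = rem' (i + 1))
    (hchosen : ∀ i, i + 1 < t → chosen (i + 1) = chosen' (i + 1)) :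
    F.pending rem chosen t = F.pending rem' chosen' t := by
  induction t with
  | zero => rfl
  | succ t ih =>
    have hprefix : (List.range t).map (fun i => chosen (i + 1)) =
        (List.range t).map fun i => chosen' (i + 1) :=
      List.map_congr_left fun i hi => hchosen i (by simpa using hi)
    rw [pending, pending, hprefix, hrem t t.lt_succ_self,
      ih (fun i hi => hrem i (by omega)) fun i hi => hchosen i (by omega)]

theorem pending_of_rem_eq_zero (ht : t ≤ F.k) (hrem : rem (t + 1) = 0) :
    F.pending rem chosen (t + 1) = F.pending rem chosen t := by
  rw [pending, hrem, Nat.succ_sub ht, sasWords_zero_right, List.map_nil, List.nil_append]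

theorem pending_choose (ht : t ≤ F.k) (hrem : rem (t + 1) = r + 1)
    (hr : r < (F.choices t).length) (hj : letterAt (F.choices t) (r + 1) = j) :
    F.pending rem chosen (t + 1) =
      (F.sasWords (F.k - t) (F.branching t j)).map ((List.range (t + 1)).map
          (fun i => Function.update chosen (t + 1) (letterAt w j) (i + 1)) ++ ·) ++
        F.pending (Function.update rem (t + 1) r)
          (Function.update chosen (t + 1) (letterAt w j)) (t + 1) := by
  obtain ⟨d, hd⟩ : ∃ d, F.k = t + d := Nat.exists_eq_add_of_le ht
  have hdepth : F.k - d = t := by omega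
  have hprefix (a : ℕ) : (List.range t).map (fun i => Function.update chosen (t + 1) a (i + 1)) =
      (List.range t).map fun i => chosen (i + 1) :=
    List.map_congr_left fun i hi =>
      Function.update_of_ne (by have := List.mem_range.1 hi; omega) _ _
  have hsas := F.sasWords_add_one (d := d) (r := r) (hdepth ▸ hr)
  rw [hdepth, hj] at hsas
  rw [pending, pending, hrem, show F.k + 1 - t = d + 1 by omega, show F.k - t = d by omega, hsas,
    Function.update_self, hprefix,
    pending_congr (rem := Function.update rem (t + 1) r) (rem' := rem) (chosen' := chosen)
      (fun i hi => Function.update_of_ne (by omega) _ _)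
      (fun i hi => Function.update_of_ne (by omega) _ _)]
  simp [Function.comp_def, List.range_succ, hprefix]

end ArchFactorization


namespace ArrName

abbrev remaining : ArrName := .tmp 0

abbrev chosen : ArrName := .tmp 1

end ArrName

section

open RamProg RamExpr RegName ArrName

/-- The last remaining choice for the letter `level` is taken. -/
def enumChoose : RamProg :=
  ite (level =ₑ 1) (pos ≔ get startSAS (get remaining level))
    (pos ≔ get sortedLast ((level - 2) * sigma + get remaining level)) ;;
  store remaining level (get remaining level - 1) ;;
  store chosen level (get word pos)

/-- The search proceeds to the next letter. -/
def enumDescend : RamProg :=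
  store remaining (level + 1)
    (get leq (get firstPosArch ((level - 1) * sigma + get chosen level))) ;;
  level ≔ level + 1

/-- The output of the word of the first `level` chosen letters. -/
def enumOutput : RamProg :=
  count ≔ 0 ;; .while (count <ₑ level) (count ≔ count + 1 ;; emit (get chosen count)) ;; endWord

/-- One step of the depth-first search of the tree of choices. -/
def enumStep : RamProg :=
  ite (get remaining level) (enumChoose ;; ite (k <ₑ level) enumOutput enumDescend)
    (level ≔ level - 1)

/-- The program that enumerates the shortest absent subsequences. -/
def enumProg : RamProg :=
  (level ≔ 1 ;; store remaining 1 startLen) ;; .while level enumStep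

end

/-- The state of the search between two steps. The words `P` are still to be output, the next of
them within `m` steps: at most `k + 1` steps return to a letter with a remaining choice, and at most
`k + 1` more steps complete a word. -/
structure EnumInvariant (σ : ℕ) (w : List ℕ) (F : ArchFactorization w) (P : List (List ℕ)) (m : ℕ)
    (s : RamState) : Prop extends HoldsData σ w F s where
  cur : s.cur = []
  level_le : s.reg .level ≤ F.k + 1
  remaining_le : ∀ i < s.reg .level, s.arr .remaining (i + 1) ≤ (F.choices i).length
  chosen_mem : ∀ i, i + 1 < s.reg .level → s.arr .chosen (i + 1) ∈ w
  pending : F.pending (s.arr .remaining) (s.arr .chosen) (s.reg .level) = P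
  countdown : m = if s.arr .remaining (s.reg .level) = 0 then s.reg .level + (F.k + 2)
    else F.k + 2 - s.reg .level

/-- The state of the search after the position of the letter `t + 1` has been chosen. -/
structure EnumChoice (σ : ℕ) (w : List ℕ) (F : ArchFactorization w) (P : List (List ℕ)) (t : ℕ)
    (s : RamState) : Prop extends HoldsData σ w F s where
  cur : s.cur = []
  level : s.reg .level = t + 1
  mem_choices : s.reg .pos ∈ F.choices t
  remaining_le : ∀ i ≤ t, s.arr .remaining (i + 1) ≤ (F.choices i).length
  chosen_mem : ∀ i ≤ t, s.arr .chosen (i + 1) ∈ w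
  chosen_eq : s.arr .chosen (t + 1) = letterAt w (s.reg .pos)
  pending : (F.sasWords (F.k - t) (F.branching t (s.reg .pos))).map
      ((List.range (t + 1)).map (fun i => s.arr .chosen (i + 1)) ++ ·) ++
    F.pending (s.arr .remaining) (s.arr .chosen) (t + 1) = P

section

variable {B σ j r t m : ℕ} {w : List ℕ} {F : ArchFactorization w} {s : RamState}
  {P : List (List ℕ)}

open ArchFactorization RamProg

theorem enumChoose_spec (hw : IsWordOver σ w) (hB : 2 * w.length ≤ B) (ht : t ≤ F.k)
    (hs : HoldsData σ w F s) (hlevel : s.reg .level = t + 1)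
    (hr : s.arr .remaining (t + 1) = r + 1) (hrt : r < (F.choices t).length)
    (hjval : letterAt (F.choices t) (r + 1) = j) :
    enumChoose.Safe B s ∧ (enumChoose.run s).reg .pos = j ∧
      (enumChoose.run s).arr .remaining = Function.update (s.arr .remaining) (t + 1) r ∧
      (enumChoose.run s).arr .chosen = Function.update (s.arr .chosen) (t + 1) (letterAt w j) := by
  have hk := F.k_pos
  have hkw := F.k_le_length hw
  have hσ := mul_add_le_length hw hk le_rfl
  have hrσ := hrt.trans_le (length_choices_le hw)
  have hj : j ∈ F.choices t := hjval ▸ letterAt_mem r.succ_pos hrt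
  obtain ⟨_, _, hin⟩ := exists_inArch_of_mem_choices ht hj
  have hjw := hin.le_length
  have hword := hs.word j hin.pos hjw
  have ha := ((hw _).1 (letterAt_mem_of_mem_choices ht hj)).2
  cases t with
  | zero =>
    have hstart := hs.startSAS (r + 1) r.succ_pos hrt
    rw [← choices, hjval] at hstart
    refine ⟨?_, ?_, ?_, ?_⟩ <;> simp (disch := first | omega | simp) [enumChoose, hlevel, hr,
      hstart, hword, hB.trans']
  | succ ℓ =>
    have hcr := mul_add_le_length hw ht hrσ
    have hsorted := hs.arr_sortedLast ht r.succ_pos hrt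
    rw [← choices, hjval] at hsorted
    refine ⟨?_, ?_, ?_, ?_⟩ <;> simp (disch := first | omega | simp) [enumChoose, hlevel, hr,
      hsorted, hword, hs.sigma, hB.trans']

theorem enumChoose_runs (hw : IsWordOver σ w) (hB : 2 * w.length ≤ B)
    (h : EnumInvariant σ w F P m s) (hlevel : s.reg .level = t + 1)
    (hrem : s.arr .remaining (t + 1) ≠ 0) :
    RunsIn B enumChoose.maxCost enumChoose s fun s' =>
      EnumChoice σ w F P t s' ∧ s'.out = s.out := by
  obtain ⟨r, hr⟩ := Nat.exists_eq_add_one_of_ne_zero hrem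
  have ht : t ≤ F.k := by
    have := h.level_le
    omega
  have hrt : r < (F.choices t).length := by
    have := h.remaining_le t (by omega)
    omega
  obtain ⟨j, hj⟩ : ∃ j, letterAt (F.choices t) (r + 1) = j := ⟨_, rfl⟩
  have hmem : j ∈ F.choices t := hj ▸ letterAt_mem r.succ_pos hrt
  obtain ⟨hsafe, hpos, hremaining, hchosen⟩ :=
    enumChoose_spec hw hB ht h.toHoldsData hlevel hr hrt hj
  have hpending := h.pending
  rw [hlevel, pending_choose ht hr hrt hj] at hpending
  refine .of_safe hsafe ⟨⟨(exec_run hsafe).holdsData ?_ h.toHoldsData, ?_, ?_, hpos ▸ hmem,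
    fun i hi => ?_, fun i hi => ?_, ?_, ?_⟩, ?_⟩
  · simp [LeavesData, enumChoose, assignedRegs, storedArrs]
  · rw [enumChoose, run, run, run, run, run]
    split_ifs <;> exact h.cur
  · rw [(exec_run hsafe).reg_eq (by simp [enumChoose, assignedRegs]), hlevel]
  · have := h.remaining_le i (by omega)
    rw [hremaining]
    grind
  · rw [hchosen]
    have := letterAt_mem_of_mem_choices ht hmem
    grind [h.chosen_mem i]
  · rw [hchosen, hpos, Function.update_self]
  · rw [hchosen, hpos, hremaining, hpending]
  · rw [enumChoose, run, run, run, run, run]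
    split_ifs <;> rfl

theorem enumDescend_runs (hw : IsWordOver σ w) (hB : 2 * w.length ≤ B) (ht : t < F.k)
    (h : EnumChoice σ w F P t s) : RunsIn B enumDescend.maxCost enumDescend s fun s' =>
      EnumInvariant σ w F P (F.k - t) s' ∧ s'.out = s.out := by
  have hkw := F.k_le_length hw
  have ha := letterAt_mem_of_mem_choices ht.le h.mem_choices
  have haw := (inArch_firstPosArch ht ha).le_length
  have hσ := mul_add_le_length hw (by omega : 0 < F.k) le_rfl
  have haddr := mul_add_le_length hw ht ((hw _).1 ha).2
  have hfirst := h.arr_firstPosArch hw ht ha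
  have hleq := h.arr_leq_firstPosArch hw ht h.mem_choices
  rw [hfirst] at hleq
  have hpos := branching_pos ht h.mem_choices
  have hle := F.branching_le_length (ℓ := t) (j := s.reg .pos)
  have hlew := hle.trans (length_choices_le hw)
  have hsafe : enumDescend.Safe B s := by
    simp (disch := first | omega | simp) [enumDescend, h.level, h.chosen_eq, h.sigma, hfirst, hleq,
      hB.trans']
  have hlevel : (enumDescend.run s).reg .level = t + 2 := by simp [enumDescend, h.level]
  have hchosen : (enumDescend.run s).arr .chosen = s.arr .chosen := by simp [enumDescend]
  have hremaining : (enumDescend.run s).arr .remaining =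
      Function.update (s.arr .remaining) (t + 2) (F.branching t (s.reg .pos)) := by
    simp [enumDescend, h.level, h.chosen_eq, h.sigma, hfirst, hleq]
  refine .of_safe hsafe ⟨⟨(exec_run hsafe).holdsData ?_ h.toHoldsData, h.cur, by omega,
    fun i hi => ?_, fun i hi => ?_, ?_, ?_⟩, rfl⟩
  · simp [LeavesData, enumDescend, assignedRegs, storedArrs]
  · rw [hlevel] at hi
    rcases Nat.lt_succ_iff_lt_or_eq.1 hi with hi | rfl
    · rw [hremaining, Function.update_of_ne (by omega)]
      exact h.remaining_le i (by omega)
    · rwa [hremaining, Function.update_self]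
  · rw [hchosen]
    exact h.chosen_mem i (by omega)
  · rw [hlevel, hchosen, hremaining, ArchFactorization.pending, Function.update_self,
      show F.k + 1 - (t + 1) = F.k - t by omega,
      pending_congr (fun i hi => Function.update_of_ne (by omega) _ _) fun i _ => rfl, h.pending]
  · rw [hlevel, hremaining, Function.update_self, if_neg hpos.ne']
    omega

/-- The state of `enumOutput`, started in `s₀`, after `i` letters have been written. -/
structure OutputInvariant (s₀ : RamState) (i : ℕ) (s : RamState) : Prop where
  count : s.reg .count = i
  level : s.reg .level = s₀.reg .level
  chosen : s.arr .chosen = s₀.arr .chosen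
  cur : s.cur = (List.range i).map fun i => s₀.arr .chosen (i + 1)
  out : s.out = s₀.out

theorem enumOutput_runs (hB : 1 ≤ B) (hlevel : s.reg .level ≤ B)
    (hchosen : ∀ i < s.reg .level, s.arr .chosen (i + 1) ≤ B) (hcur : s.cur = []) :
    RunsIn B (11 * s.reg .level + 7) enumOutput s fun s' => s'.cur = [] ∧ s'.out = s.out ++
      [((List.range (s.reg .level)).map fun i => s.arr .chosen (i + 1), s'.time)] := by
  have hstart : (.count ≔ 0 : RamProg).Safe B s := Nat.zero_le B
  have hstep (i : ℕ) (s₁ : RamState) (hi : i < s.reg .level) (h : OutputInvariant s i s₁) :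
      RunsIn B 7 (.count ≔ RegName.count + 1 ;; .emit (.get .chosen RegName.count) : RamProg) s₁
        (OutputInvariant s (i + 1)) := by
    have hi' := hchosen i hi
    have hiB := hi.trans_le hlevel
    exact .of_safe (by simp [h.count, h.chosen, hi', hB, hiB, hiB.le])
      ⟨by simp [h.count], by simp [h.level], h.chosen,
        by simp [h.cur, h.count, h.chosen, List.range_succ], h.out⟩
  have htime : 2 + ((s.reg .level - 0) * (4 + 7) + 4 + 1) ≤ 11 * s.reg .level + 7 := by omega
  refine ((RunsIn.of_safe hstart (Q := OutputInvariant s 0) ⟨by simp, by simp, rfl, hcur, rfl⟩).seq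
    fun s₁ hs₁ => (RunsIn.while_lt hB hlevel (fun _ _ _ h => { h with })
      (fun _ _ h => ⟨h.count, h.level⟩) hstep hs₁ (Nat.zero_le _)).seq fun s₂ hs₂ =>
        .of_safe (p := .endWord) trivial ⟨rfl, ?_⟩).mono htime fun _ h => h
  rw [run, hs₂.out, hs₂.cur]

theorem EnumChoice.enumInvariant {s' : RamState} (h : EnumChoice σ w F P F.k s)
    (hexec : Exec B enumOutput s s') (hcur : s'.cur = []) :
    ∃ m ≤ 2 * F.k + 3, EnumInvariant σ w F
      (F.pending (s.arr .remaining) (s.arr .chosen) (F.k + 1)) m s' := by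
  have hlevel := (hexec.reg_eq (x := .level) (by simp [enumOutput, assignedRegs])).trans h.level
  have harr (A : ArrName) : s'.arr A = s.arr A :=
    hexec.arr_eq (by simp [enumOutput, storedArrs])
  refine ⟨_, ?_, hexec.holdsData ?_ h.toHoldsData, hcur, hlevel.le, fun i hi => ?_, fun i hi => ?_,
    ?_, rfl⟩
  · split_ifs <;> omega
  · simp [LeavesData, enumOutput, assignedRegs, storedArrs]
  · rw [harr]
    exact h.remaining_le i (by omega)
  · rw [harr]
    exact h.chosen_mem i (by omega)
  · rw [harr, harr, hlevel]

theorem enumOutput_runs_of_enumChoice (hw : IsWordOver σ w) (hB : 2 * w.length ≤ B)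
    (h : EnumChoice σ w F P F.k s) : RunsIn B (11 * F.k + 18) enumOutput s fun s' =>
      ∃ v P', P = v :: P' ∧ s'.out = s.out ++ [(v, s'.time)] ∧
        ∃ m ≤ 2 * F.k + 3, EnumInvariant σ w F P' m s' := by
  have hk := F.k_pos
  have hkw := F.k_le_length hw
  have hlevel := h.level
  have hσ := mul_add_le_length hw F.k_pos le_rfl
  have hchosen (i : ℕ) (hi : i < s.reg .level) : s.arr .chosen (i + 1) ≤ B := by
    have := (hw _).1 (h.chosen_mem i (by omega))
    omega
  have hpending := h.pending
  rw [Nat.sub_self, sasWords, List.map_singleton, List.append_nil, List.singleton_append]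
    at hpending
  exact (enumOutput_runs (by omega) (by omega) hchosen h.cur).exec.mono (by omega)
    fun s' ⟨hexec, hcur, hout⟩ =>
      ⟨_, _, hpending.symm, hlevel ▸ hout, h.enumInvariant hexec hcur⟩

/-- Outcome of a step from `s` to `s'` with pending words `P` and countdown `m`: the next word is
output, or the countdown decreases. -/
def EnumProgress (σ : ℕ) (w : List ℕ) (F : ArchFactorization w) (P : List (List ℕ)) (m : ℕ)
    (s s' : RamState) : Prop :=
  (s'.out = s.out ∧ ∃ m' < m, EnumInvariant σ w F P m' s') ∨
    ∃ v P', P = v :: P' ∧ s'.out = s.out ++ [(v, s'.time)] ∧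
      ∃ m' ≤ 2 * F.k + 3, EnumInvariant σ w F P' m' s'

theorem enumBacktrack_runs (hB : 1 ≤ B) (hlevelB : s.reg .level ≤ B)
    (h : EnumInvariant σ w F P m s) (hlevel : s.reg .level = t + 1)
    (hrem : s.arr .remaining (t + 1) = 0) :
    RunsIn B 4 (.level ≔ RegName.level - 1 : RamProg) s (EnumProgress σ w F P m s) := by
  have ht := hlevel ▸ h.level_le
  have hsafe : (.level ≔ RegName.level - 1 : RamProg).Safe B s := by
    simp [hlevelB, hB, hlevelB.trans']
  have hlevel' : ((.level ≔ RegName.level - 1 : RamProg).run s).reg .level = t := by simp [hlevel]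
  refine .of_safe hsafe (.inl ⟨rfl, _, ?_, (exec_run hsafe).holdsData ?_ h.toHoldsData, h.cur,
    by omega, fun i hi => h.remaining_le i (by omega), fun i hi => h.chosen_mem i (by omega), ?_,
    rfl⟩)
  · rw [h.countdown, hlevel, hrem, hlevel']
    split_ifs <;> omega
  · simp [LeavesData, assignedRegs, storedArrs]
  · rw [hlevel', ← h.pending, hlevel, pending_of_rem_eq_zero (by omega) hrem]
    rfl

theorem enumVisit_runs (hw : IsWordOver σ w) (hB : 2 * w.length ≤ B)
    (h : EnumInvariant σ w F P m s) (hlevel : s.reg .level = t + 1)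
    (hrem : s.arr .remaining (t + 1) ≠ 0) :
    RunsIn B (11 * F.k + 46)
      (enumChoose ;; .ite (RegName.k <ₑ RegName.level) enumOutput enumDescend) s
      (EnumProgress σ w F P m s) := by
  have hk := F.k_pos
  have hkw := F.k_le_length hw
  have ht := h.level_le
  have htime : 24 + (3 + 1 + max (11 * F.k + 18) 18) ≤ 11 * F.k + 46 := by omega
  refine ((enumChoose_runs hw hB h hlevel hrem).seq fun s₁ ⟨h₁, hout⟩ =>
    RunsIn.ite (t := 11 * F.k + 18) (t' := enumDescend.maxCost) ?_ (fun hlast => ?_)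
      fun hlast => ?_).mono htime fun _ h => h
  · simp (disch := omega) [h₁.level, h₁.k, ite_one_zero_le, hB.trans']
  · obtain rfl : t = F.k := by
      have : F.k < t + 1 := by simpa [h₁.level, h₁.k] using hlast
      omega
    refine (enumOutput_runs_of_enumChoice hw hB (s := s₁.tick 4) { h₁ with }).mono le_rfl
      fun s' h' => .inr ?_
    rwa [← hout]
  · have ht : t < F.k := by simpa [h₁.level, h₁.k] using hlast
    refine (enumDescend_runs hw hB ht (s := s₁.tick 4) { h₁ with }).mono le_rfl
      fun s' ⟨h', hout'⟩ => .inl ⟨hout'.trans hout, F.k - t, ?_, h'⟩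
    rw [h.countdown, hlevel, if_neg hrem]
    omega

theorem enumStep_runs (hw : IsWordOver σ w) (hB : 2 * w.length ≤ B)
    (h : EnumInvariant σ w F P m s) (hlevel : s.reg .level ≠ 0) :
    RunsIn B (11 * F.k + 49) enumStep s (EnumProgress σ w F P m s) := by
  obtain ⟨t, hlevel⟩ := Nat.exists_eq_add_one_of_ne_zero hlevel
  have hk := F.k_pos
  have hkw := F.k_le_length hw
  have ht : t ≤ F.k := by
    have := h.level_le
    omega
  have hrem := (h.remaining_le t (by omega)).trans (length_choices_le hw)
  have hσ := mul_add_le_length hw F.k_pos le_rfl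
  have htime : 2 + 1 + max (11 * F.k + 46) 4 ≤ 11 * F.k + 49 := by omega
  refine (RunsIn.ite ?_ (fun htrue => ?_) fun hfalse => ?_).mono htime fun _ h => h
  · simp (disch := omega) [hlevel, hB.trans']
  · have htick : EnumInvariant σ w F P m (s.tick 3) := { h with }
    exact enumVisit_runs hw hB htick hlevel (by simpa [hlevel] using htrue)
  · have htick : EnumInvariant σ w F P m (s.tick 3) := { h with }
    exact enumBacktrack_runs (by omega) (hlevel.trans_le (by omega)) htick hlevel
      (by simpa [hlevel] using hfalse)

theorem enumInit_runs (hw : IsWordOver σ w) (hB : 2 * w.length ≤ B) (hs : HoldsData σ w F s)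
    (hcur : s.cur = []) :
    RunsIn B 5 (.level ≔ 1 ;; .store .remaining 1 RegName.startLen : RamProg) s fun s' =>
      s'.out = s.out ∧
        EnumInvariant σ w F (F.sasWords (F.k + 1) F.startSAS.length) (F.k + 1) s' := by
  have hk := F.k_pos
  have hkw := F.k_le_length hw
  have hσ := mul_add_le_length hw F.k_pos le_rfl
  have hlen : F.startSAS.length ≤ σ := length_choices_le (ℓ := 0) hw
  have hsafe : (.level ≔ 1 ;; .store .remaining 1 RegName.startLen : RamProg).Safe B s := by
    simp (disch := first | omega | simp) [hs.startLen, hB.trans']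
  refine .of_safe hsafe
    ⟨rfl, (exec_run hsafe).holdsData ?_ hs, hcur, ?_, fun i hi => ?_, fun i hi => ?_, ?_, ?_⟩
  · simp [LeavesData, assignedRegs, storedArrs]
  · simp
  · obtain rfl : i = 0 := by simpa using hi
    simp [hs.startLen, choices]
  · simp at hi
  · simp [ArchFactorization.pending, hs.startLen]
  · simp [hs.startLen, F.startSAS_ne_nil]

theorem enumProg_runs (hw : IsWordOver σ w) (hB : 2 * w.length ≤ B) (hs : HoldsData σ w F s)
    (htime : s.time = 0) (hcur : s.cur = []) (hout : s.out = []) :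
    ∃ s', Exec B enumProg s s' ∧ HoldsData σ w F s' ∧ s'.cur = [] ∧
      s'.out.map Prod.fst = F.sasWords (F.k + 1) F.startSAS.length ∧
      DelayAtMost ((11 * F.k + 51) * (2 * F.k + 4)) s' := by
  have hk := F.k_pos
  have hkw := F.k_le_length hw
  obtain ⟨s₁, hexec₁, htime₁, hout₁, h₁⟩ := enumInit_runs hw hB hs hcur
  have hdelay₁ : DelayAtMost ((11 * F.k + 51) * (2 * F.k + 4))
      (s₁.tick ((11 * F.k + 51) * (F.k + 1 + 1))) := by
    have : s₁.time + (11 * F.k + 51) * (F.k + 1 + 1) ≤ (11 * F.k + 51) * (2 * F.k + 4) := by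
      nlinarith
    simpa [DelayAtMost, hout₁, hout] using this
  have hcost : (RamExpr.reg .level).cost + 1 + (11 * F.k + 49) = 11 * F.k + 51 := by
    rw [RamExpr.cost]
    omega
  have hnil (P : List (List ℕ)) (m : ℕ) (s : RamState) (h : EnumInvariant σ w F P m s)
      (he : s.reg .level = 0) : P = [] := by rw [← h.pending, he, ArchFactorization.pending]
  obtain ⟨s₂, hexec₂, ⟨_, h₂⟩, hwords, hdelay⟩ := exists_exec_while_of_delayAtMost
    (B := B) (e := .reg .level) (I := EnumInvariant σ w F) (M := 2 * F.k + 3)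
    (fun _ _ _ _ h => { h with }) (fun _ _ s h => h.level_le.trans (by omega))
    hnil (fun _ _ s h he => enumStep_runs hw hB h he) _ _ s₁ h₁ (hcost ▸ hdelay₁)
  exact ⟨s₂, .seq _ _ _ _ _ hexec₁ hexec₂, h₂.toHoldsData, h₂.cur,
    by rw [hwords, hout₁, hout, List.map_nil, List.nil_append], hcost ▸ hdelay⟩

end

/-! ### Preprocessing -/

section LastOcc

variable {w : List ℕ} {σ a i j p : ℕ}

/-- The last position up to `i` at which the letter `a` occurs, or `0` if there is none. -/
def lastOcc (w : List ℕ) : ℕ → ℕ → ℕ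
  | 0, _ => 0
  | i + 1, a => if letterAt w (i + 1) = a then i + 1 else lastOcc w i a

theorem lastOcc_le : lastOcc w i a ≤ i := by
  induction i with
  | zero => rfl
  | succ i ih =>
    rw [lastOcc]
    split_ifs <;> omega

theorem lt_lastOcc_iff : p < lastOcc w i a ↔ ∃ j, p < j ∧ j ≤ i ∧ letterAt w j = a := by
  induction i with
  | zero => grind [lastOcc]
  | succ i ih =>
    rw [lastOcc]
    grind

/-- The letters that occur at the positions `p + 1, …, i`. -/
def lettersBetween (w : List ℕ) (p i : ℕ) : Finset ℕ :=
  w.toFinset.filter fun a => p < lastOcc w i a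

theorem lettersBetween_self : lettersBetween w p p = ∅ :=
  Finset.filter_false_of_mem fun _ _ => not_lt.2 lastOcc_le

theorem card_lettersBetween_add_one (hi : i < w.length) (hp : p ≤ i) :
    (lettersBetween w p (i + 1)).card = (lettersBetween w p i).card +
      if p < lastOcc w i (letterAt w (i + 1)) then 0 else 1 := by
  have hmem : letterAt w (i + 1) ∈ w := letterAt_mem (Nat.le_add_left 1 i) hi
  have heq : lettersBetween w p (i + 1) = insert (letterAt w (i + 1)) (lettersBetween w p i) := by
    ext a
    simp only [lettersBetween, Finset.mem_filter, List.mem_toFinset, Finset.mem_insert]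
    rw [lastOcc]
    grind
  rw [heq, Finset.card_insert_eq_ite]
  simp only [lettersBetween, Finset.mem_filter, List.mem_toFinset, hmem, true_and]
  split_ifs <;> rfl

theorem card_lettersBetween_le (hw : IsWordOver σ w) : (lettersBetween w p i).card ≤ σ := by
  refine (Finset.card_filter_le _ _).trans_eq ?_
  rw [hw.toFinset_eq, Nat.card_Icc, Nat.add_sub_cancel]

end LastOcc

namespace ArchFactorization

variable {w : List ℕ} {F : ArchFactorization w} {σ ℓ a i : ℕ}

theorem card_lettersBetween_archEnd_eq_iff (hw : IsWordOver σ w) (hℓ : ℓ ≤ F.k)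
    (hi : i ≤ w.length) : (lettersBetween w (F.archEnd ℓ) i).card = σ ↔
      ℓ < F.k ∧ F.archEnd (ℓ + 1) ≤ i := by
  have hcard : w.toFinset.card = σ := by
    rw [hw.toFinset_eq, Nat.card_Icc, Nat.add_sub_cancel]
  rw [← F.forall_exists_letterAt_iff hℓ hi, ← hcard, lettersBetween, Finset.card_filter_eq_iff]
  simp only [List.mem_toFinset, lt_lastOcc_iff]

theorem firstPosArch_eq_of_lastOcc_le (hℓ : ℓ < F.k) (hi : i < w.length) (hle : F.archEnd ℓ ≤ i)
    (h : lastOcc w i (letterAt w (i + 1)) ≤ F.archEnd ℓ) :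
    F.firstPosArch (ℓ + 1) (letterAt w (i + 1)) = i + 1 := by
  refine (isLeast_firstPosArch hℓ (letterAt_mem (Nat.le_add_left 1 i) hi)).unique
    ⟨⟨by omega, hi, rfl⟩, fun j hj => ?_⟩
  by_contra! hlt
  exact h.not_gt (lt_lastOcc_iff.2 ⟨j, hj.1, by omega, hj.2.2⟩)

theorem lastOcc_archEnd_succ (hℓ : ℓ < F.k) (ha : a ∈ w) :
    lastOcc w (F.archEnd (ℓ + 1)) a = F.lastPosArch (ℓ + 1) a := by
  have hlast := isGreatest_lastPosArch hℓ ha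
  refine eq_of_forall_lt_iff fun p => lt_lastOcc_iff.trans
    ⟨fun ⟨j, hpj, hj⟩ => hpj.trans_le (hlast.2 ⟨by omega, hj⟩), fun hp => ⟨_, hp, hlast.1.2⟩⟩

theorem archEnd_lt_lastOcc (hℓ : ℓ < F.k) (ha : a ∈ w) (hi : F.archEnd (ℓ + 1) ≤ i) :
    F.archEnd ℓ < lastOcc w i a := by
  obtain ⟨j, hj, hj', hja⟩ := F.exists_letterAt_of_lt_k hℓ ha
  exact lt_lastOcc_iff.2 ⟨j, hj, hj'.trans hi, hja⟩

theorem lastOcc_add_one_of_ne {m : ℕ} (hle : F.archEnd ℓ ≤ i)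
    (hlt : ℓ < F.k → i < F.archEnd (ℓ + 1)) (hm : m < F.k) (ha : a ∈ w)
    (hne : ¬(m = ℓ ∧ a = letterAt w (i + 1))) (hocc : F.archEnd m < lastOcc w (i + 1) a) :
    F.archEnd m < lastOcc w i a ∧ lastOcc w (min (i + 1) (F.archEnd (m + 1))) a =
      lastOcc w (min i (F.archEnd (m + 1))) a := by
  by_cases hai : letterAt w (i + 1) = a
  · rcases lt_trichotomy m ℓ with hmℓ | rfl | hmℓ
    · have : F.archEnd (m + 1) ≤ F.archEnd ℓ := F.archEnd_mono hmℓ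
      exact ⟨archEnd_lt_lastOcc hm ha (by omega), by rw [min_eq_right, min_eq_right] <;> omega⟩
    · exact absurd ⟨rfl, hai.symm⟩ hne
    · have : F.archEnd (ℓ + 1) ≤ F.archEnd m := F.archEnd_mono hmℓ
      have := hlt (by omega)
      have := lastOcc_le (w := w) (i := i + 1) (a := a)
      omega
  · have hsame : lastOcc w (i + 1) a = lastOcc w i a := by rw [lastOcc, if_neg hai]
    refine ⟨hsame ▸ hocc, ?_⟩
    rcases le_or_gt (F.archEnd (m + 1)) i with hmi | hmi
    · rw [min_eq_right hmi, min_eq_right (by omega)]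
    · rw [min_eq_left hmi, min_eq_left hmi.le, hsame]

theorem mem_rest_iff_lt_lastOcc : a ∈ F.rest ↔ F.archEnd F.k < lastOcc w w.length a := by
  rw [F.mem_rest_iff, lt_lastOcc_iff]

end ArchFactorization

theorem mul_add_eq_mul_add_iff {σ ℓ m a b : ℕ} (ha : 1 ≤ a) (ha' : a ≤ σ) (hb : 1 ≤ b)
    (hb' : b ≤ σ) : ℓ * σ + a = m * σ + b ↔ ℓ = m ∧ a = b := by
  refine ⟨fun h => ?_, by rintro ⟨rfl, rfl⟩; rfl⟩
  rcases lt_trichotomy ℓ m with hlt | rfl | hlt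
  · have := Nat.mul_le_mul_right σ hlt
    rw [Nat.succ_mul] at this
    omega
  · exact ⟨rfl, by omega⟩
  · have := Nat.mul_le_mul_right σ hlt
    rw [Nat.succ_mul] at this
    omega

namespace RegName

abbrev letter : RegName := .tmp 3

abbrev keep : RegName := .tmp 4

abbrev best : RegName := .tmp 5

end RegName

namespace ArrName

abbrev lastOcc : ArrName := .tmp 0

end ArrName

section

open RamProg RamExpr RegName ArrName

/-- Initialises the table of the last occurrences of the letters with `0`. -/
def clearLastOcc : RamProg :=
  count ≔ 0 ;; .while (count <ₑ sigma) (count ≔ count + 1 ;; store .lastOcc count 0)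

/-- Reads the next letter and records its position in the current arch, whose index is the contents
of the register `k`; the register `count` counts the letters that have occurred in this arch. -/
def recordOcc : RamProg :=
  pos ≔ pos + 1 ;;
  letter ≔ get word pos ;;
  ite (get archEnd k <ₑ get .lastOcc letter) skip
    (store firstPosArch (k * sigma + letter) pos ;; count ≔ count + 1) ;;
  store lastPosArch (k * sigma + letter) pos ;;
  store .lastOcc letter pos

/-- Closes the current arch if all letters have occurred in it. -/
def closeArch : RamProg :=
  ite (count =ₑ sigma) (k ≔ k + 1 ;; count ≔ 0 ;; store archEnd k pos) skip

/-- The left-to-right scan that computes the arches and the first and last occurrences of the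
letters in them. -/
def scanProg : RamProg :=
  (k ≔ 0 ;; pos ≔ 0 ;; count ≔ 0 ;; store archEnd 0 0) ;;
  .while (pos <ₑ n) (recordOcc ;; closeArch)

end

/-- The state of the scan when `i` positions have been read and `ℓ` arches have been closed. The
arch `ℓ + 1` may be complete without being closed yet. -/
structure ScanState (σ : ℕ) (w : List ℕ) (F : ArchFactorization w) (ℓ i : ℕ)
    (s : RamState) : Prop extends HoldsInput σ w s where
  pos : s.reg .pos = i
  k : s.reg .k = ℓ
  k_le : ℓ ≤ F.k
  archEnd_le : F.archEnd ℓ ≤ i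
  le_archEnd : ℓ < F.k → i ≤ F.archEnd (ℓ + 1)
  count : s.reg .count = (lettersBetween w (F.archEnd ℓ) i).card
  lastOcc : ∀ a ∈ w, s.arr .lastOcc a = lastOcc w i a
  archEnd : ∀ m ≤ ℓ, s.arr .archEnd m = F.archEnd m
  firstPosArch : ∀ m < F.k, ∀ a ∈ w, F.archEnd m < _root_.lastOcc w i a →
    s.arr .firstPosArch (m * σ + a) = F.firstPosArch (m + 1) a
  lastPosArch : ∀ m < F.k, ∀ a ∈ w, F.archEnd m < _root_.lastOcc w i a →
    s.arr .lastPosArch (m * σ + a) = _root_.lastOcc w (min i (F.archEnd (m + 1))) a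

/-- The memory holds the arches and the first and last occurrences of the letters in them and in
the whole word. -/
structure HoldsArches (σ : ℕ) (w : List ℕ) (F : ArchFactorization w) (s : RamState) : Prop
    extends HoldsInput σ w s where
  k : s.reg .k = F.k
  archEnd : ∀ ℓ ≤ F.k, s.arr .archEnd ℓ = F.archEnd ℓ
  firstPosArch : ∀ ℓ < F.k, ∀ a ∈ w,
    s.arr .firstPosArch (ℓ * σ + a) = F.firstPosArch (ℓ + 1) a
  lastPosArch : ∀ ℓ < F.k, ∀ a ∈ w,
    s.arr .lastPosArch (ℓ * σ + a) = F.lastPosArch (ℓ + 1) a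
  lastOcc : ∀ a ∈ w, s.arr .lastOcc a = lastOcc w w.length a

section

variable {B σ ℓ i : ℕ} {w : List ℕ} {F : ArchFactorization w} {s : RamState}

open ArchFactorization RamProg

theorem clearLastOcc_runs (hσ : σ ≤ B) (hB : 1 ≤ B) (hs : HoldsInput σ w s) :
    RunsIn B (2 + ((σ - 0) * (4 + 7) + 4)) clearLastOcc s
      fun s' => HoldsInput σ w s' ∧ ∀ a, 1 ≤ a → a ≤ σ → s'.arr .lastOcc a = 0 := by
  let J (ℓ : ℕ) (s : RamState) : Prop := HoldsInput σ w s ∧ s.reg .count = ℓ ∧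
    ∀ a, 1 ≤ a → a ≤ ℓ → s.arr .lastOcc a = 0
  have hstart : (.count ≔ 0 : RamProg).Safe B s := by simp
  have hJ₀ : J 0 ((.count ≔ 0 : RamProg).run s) :=
    ⟨{ hs with }, by simp, fun a ha ha' => by omega⟩
  refine ((RunsIn.of_safe hstart hJ₀).seq fun s₁ hs₁ => RunsIn.while_lt (J := J) hB hσ
    (fun _ _ _ h => ⟨{ h.1 with }, h.2⟩) (fun _ _ h => ⟨h.2.1, h.1.sigma⟩) (fun ℓ s hℓ h => ?_) hs₁
    (Nat.zero_le _)).mono le_rfl fun s' h => ⟨h.1, h.2.2⟩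
  obtain ⟨hs, hcount, hzero⟩ := h
  have hsafe :
      (.count ≔ RegName.count + 1 ;; .store .lastOcc RegName.count 0 : RamProg).Safe B s := by
    simp (disch := omega) [hcount]
    omega
  refine .of_safe hsafe ⟨(exec_run hsafe).holdsInput hs ?_ ?_ ?_, ?_, fun a ha ha' => ?_⟩
  · simp [assignedRegs]
  · simp [assignedRegs]
  · simp [storedArrs]
  · simp [hcount]
  · rcases ha'.eq_or_lt with rfl | hlt
    · simp [hcount]
    · have := hzero a ha (by omega)
      simp [hcount, hlt.ne, this]

theorem recordOcc_safe_and_values (hw : IsWordOver σ w) (hB : 2 * w.length ≤ B)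
    (hi : i < w.length) (h : ScanState σ w F ℓ i s) :
    recordOcc.Safe B s ∧ (recordOcc.run s).reg .pos = i + 1 ∧
      (recordOcc.run s).reg .count = (lettersBetween w (F.archEnd ℓ) (i + 1)).card ∧
      (recordOcc.run s).arr .lastOcc =
        Function.update (s.arr .lastOcc) (letterAt w (i + 1)) (i + 1) ∧
      (recordOcc.run s).arr .lastPosArch =
        Function.update (s.arr .lastPosArch) (ℓ * σ + letterAt w (i + 1)) (i + 1) ∧
      (recordOcc.run s).arr .firstPosArch =
        if F.archEnd ℓ < lastOcc w i (letterAt w (i + 1)) then s.arr .firstPosArch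
        else Function.update (s.arr .firstPosArch) (ℓ * σ + letterAt w (i + 1)) (i + 1) := by
  have hσ := F.one_le_of_isWordOver hw
  have hσw := mul_add_le_length hw F.k_pos le_rfl
  have hℓw := h.k_le.trans (F.k_le_length hw)
  have hℓσ := mul_le_archEnd hw h.k_le
  have hle := h.archEnd_le
  have hletter := h.word (i + 1) (Nat.le_add_left 1 i) hi
  have ha : letterAt w (i + 1) ∈ w := letterAt_mem (Nat.le_add_left 1 i) hi
  have haσ := (hw _).1 ha
  have hocc := h.lastOcc _ ha
  have hocc_le : lastOcc w i (letterAt w (i + 1)) ≤ i := lastOcc_le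
  have hend := h.archEnd ℓ le_rfl
  have hcard := card_lettersBetween_add_one hi hle
  have hcard_le : (lettersBetween w (F.archEnd ℓ) i).card ≤ σ := card_lettersBetween_le hw
  have hsafe : recordOcc.Safe B s := by
    by_cases hseen : F.archEnd ℓ < lastOcc w i (letterAt w (i + 1)) <;>
    simp (disch := first | omega | simp) [recordOcc, h.pos, h.k, h.sigma, hletter, hocc, hend,
      h.count, hseen, hB.trans']
  refine ⟨hsafe, ?_⟩
  by_cases hseen : F.archEnd ℓ < lastOcc w i (letterAt w (i + 1)) <;>
  simp [recordOcc, h.pos, h.k, h.sigma, hletter, hocc, hend, h.count, hseen, hcard]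

theorem recordOcc_runs (hw : IsWordOver σ w) (hB : 2 * w.length ≤ B) (hi : i < w.length)
    (hlt : ℓ < F.k → i < F.archEnd (ℓ + 1)) (h : ScanState σ w F ℓ i s) :
    RunsIn B recordOcc.maxCost recordOcc s (ScanState σ w F ℓ (i + 1)) := by
  have ha : letterAt w (i + 1) ∈ w := letterAt_mem (Nat.le_add_left 1 i) hi
  obtain ⟨hsafe, hpos, hcount, hlastOcc, hlast, hfirst⟩ := recordOcc_safe_and_values hw hB hi h
  have hσ {a : ℕ} (ha : a ∈ w) := (hw a).1 ha
  have hcell {m b : ℕ} (hb : b ∈ w) :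
      m * σ + b = ℓ * σ + letterAt w (i + 1) ↔ m = ℓ ∧ b = letterAt w (i + 1) :=
    mul_add_eq_mul_add_iff (hσ hb).1 (hσ hb).2 (hσ ha).1 (hσ ha).2
  have hexec := exec_run hsafe
  refine .of_safe hsafe
    { toHoldsInput := hexec.holdsInput h.toHoldsInput (by simp [recordOcc, assignedRegs])
        (by simp [recordOcc, assignedRegs]) (by simp [recordOcc, storedArrs])
      pos := hpos
      k := (hexec.reg_eq (by simp [recordOcc, assignedRegs])).trans h.k
      k_le := h.k_le
      archEnd_le := h.archEnd_le.trans (Nat.le_add_right i 1)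
      le_archEnd := hlt
      count := hcount
      lastOcc := fun b hb => ?_
      archEnd := hexec.arr_eq (A := .archEnd) (by simp [recordOcc, storedArrs]) ▸ h.archEnd
      firstPosArch := fun m hm b hb hmb => ?_
      lastPosArch := fun m hm b hb hmb => ?_ }
  · rw [hlastOcc, Function.update_apply, h.lastOcc b hb, lastOcc]
    grind
  · by_cases heq : m = ℓ ∧ b = letterAt w (i + 1)
    · obtain ⟨rfl, rfl⟩ := heq
      rw [hfirst]
      split_ifs with hseen
      · exact h.firstPosArch m hm _ ha hseen
      · rw [Function.update_self,
          firstPosArch_eq_of_lastOcc_le hm hi h.archEnd_le (not_lt.1 hseen)]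
    · have hold := h.firstPosArch m hm b hb
        (lastOcc_add_one_of_ne h.archEnd_le hlt hm hb heq hmb).1
      rw [hfirst]
      split_ifs
      · exact hold
      · rwa [Function.update_of_ne (mt (hcell hb).1 heq)]
  · by_cases heq : m = ℓ ∧ b = letterAt w (i + 1)
    · obtain ⟨rfl, rfl⟩ := heq
      rw [hlast, Function.update_self, min_eq_left (hlt hm), lastOcc, if_pos rfl]
    · obtain ⟨hold, hsame⟩ := lastOcc_add_one_of_ne h.archEnd_le hlt hm hb heq hmb
      rw [hlast, Function.update_of_ne (mt (hcell hb).1 heq), hsame]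
      exact h.lastPosArch m hm b hb hold

theorem closeArch_runs (hw : IsWordOver σ w) (hB : 2 * w.length ≤ B) (hi : i ≤ w.length)
    (h : ScanState σ w F ℓ i s) :
    RunsIn B closeArch.maxCost closeArch s fun s' =>
      ∃ m, (m < F.k → i < F.archEnd (m + 1)) ∧ ScanState σ w F m i s' := by
  have hσ := F.one_le_of_isWordOver hw
  have hσw := mul_add_le_length hw F.k_pos le_rfl
  have hkw := F.k_le_length hw
  have hcard_le : (lettersBetween w (F.archEnd ℓ) i).card ≤ σ := card_lettersBetween_le hw
  have hclosed := card_lettersBetween_archEnd_eq_iff hw h.k_le hi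
  by_cases hfull : (lettersBetween w (F.archEnd ℓ) i).card = σ
  · obtain ⟨hℓ, hle⟩ := hclosed.1 hfull
    have heq := (h.le_archEnd hℓ).antisymm hle
    have hsafe : closeArch.Safe B s := by
      simp (disch := first | omega | simp) [closeArch, h.pos, h.k, h.sigma, h.count, hfull,
        hB.trans']
    have hexec := exec_run hsafe
    have harr {A : ArrName} (hA : A ≠ .archEnd) : (closeArch.run s).arr A = s.arr A :=
      hexec.arr_eq (by simpa [closeArch, storedArrs] using hA)
    refine .of_safe hsafe ⟨ℓ + 1, fun hk => heq ▸ F.archEnd_lt_succ hk,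
      { toHoldsInput := hexec.holdsInput h.toHoldsInput (by simp [closeArch, assignedRegs])
          (by simp [closeArch, assignedRegs]) (by simp [closeArch, storedArrs])
        pos := (hexec.reg_eq (by simp [closeArch, assignedRegs])).trans h.pos
        k := by simp [closeArch, h.k, h.count, h.sigma, hfull]
        k_le := hℓ
        archEnd_le := hle
        le_archEnd := fun _ => heq ▸ F.archEnd_mono (Nat.le_add_right _ 1)
        count := by
          rw [← heq, lettersBetween_self]
          simp [closeArch, h.count, h.sigma, hfull]
        lastOcc := harr (A := .lastOcc) (by simp) ▸ h.lastOcc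
        archEnd := fun m hm => ?_
        firstPosArch := harr (A := .firstPosArch) (by simp) ▸ h.firstPosArch
        lastPosArch := harr (A := .lastPosArch) (by simp) ▸ h.lastPosArch }⟩
    rcases hm.eq_or_lt with rfl | hm
    · simpa [closeArch, h.k, h.count, h.sigma, hfull, h.pos] using heq
    · have := h.archEnd m (by omega)
      simp [closeArch, h.k, h.count, h.sigma, hfull, h.pos, hm.ne, this]
  · have hsafe : closeArch.Safe B s := by
      simp (disch := first | omega | simp) [closeArch, h.sigma, h.count, hfull, hB.trans']
    have hrun : closeArch.run s = (s.tick 4).tick 1 := by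
      simp [closeArch, h.sigma, h.count, hfull, RamExpr.cost]
    refine .of_safe hsafe ⟨ℓ, fun hℓ => ?_, hrun ▸ { h with }⟩
    by_contra! hle
    exact hfull (hclosed.2 ⟨hℓ, hle⟩)

theorem ScanState.holdsArches (h : ScanState σ w F F.k w.length s) : HoldsArches σ w F s where
  toHoldsInput := h.toHoldsInput
  k := h.k
  archEnd := h.archEnd
  firstPosArch m hm a ha :=
    h.firstPosArch m hm a ha (archEnd_lt_lastOcc hm ha (F.archEnd_le_length _))
  lastPosArch m hm a ha := by
    rw [h.lastPosArch m hm a ha (archEnd_lt_lastOcc hm ha (F.archEnd_le_length _)),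
      min_eq_right (F.archEnd_le_length _), lastOcc_archEnd_succ hm ha]
  lastOcc := h.lastOcc

theorem scanProg_runs (hw : IsWordOver σ w) (hB : 2 * w.length ≤ B) (hs : HoldsInput σ w s)
    (hzero : ∀ a, 1 ≤ a → a ≤ σ → s.arr .lastOcc a = 0) :
    RunsIn B (9 + ((w.length - 0) * (4 + (recordOcc.maxCost + closeArch.maxCost)) + 4)) scanProg s
      (HoldsArches σ w F) := by
  let J (i : ℕ) (s : RamState) : Prop :=
    ∃ ℓ, (ℓ < F.k → i < F.archEnd (ℓ + 1)) ∧ ScanState σ w F ℓ i s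
  have hpos : 1 ≤ w.length := F.k_pos.trans_le (F.k_le_length hw)
  have hstart : (.k ≔ 0 ;; .pos ≔ 0 ;; .count ≔ 0 ;; .store .archEnd 0 0 : RamProg).Safe B s := by
    simp
  have hJ₀ : J 0 ((.k ≔ 0 ;; .pos ≔ 0 ;; .count ≔ 0 ;; .store .archEnd 0 0 : RamProg).run s) := by
    refine ⟨0, fun hk => (Nat.zero_le _).trans_lt (F.archEnd_lt_succ hk),
      { toHoldsInput := { hs with }
        pos := by simp
        k := by simp
        k_le := Nat.zero_le _
        archEnd_le := F.archEnd_zero.le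
        le_archEnd := fun _ => Nat.zero_le _
        count := by simp [F.archEnd_zero, lettersBetween_self]
        lastOcc := fun a ha => by simp [_root_.lastOcc, hzero a ((hw a).1 ha).1 ((hw a).1 ha).2]
        archEnd := fun m hm => by simp [Nat.le_zero.1 hm, F.archEnd_zero]
        firstPosArch := fun m _ a _ h => absurd h (by simp [_root_.lastOcc])
        lastPosArch := fun m _ a _ h => absurd h (by simp [_root_.lastOcc]) }⟩
  refine ((RunsIn.of_safe hstart hJ₀).seq fun s₁ hs₁ => RunsIn.while_lt (J := J) (by omega)
    (by omega) (fun _ _ _ ⟨ℓ, hlt, h⟩ => ⟨ℓ, hlt, { h with }⟩)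
    (fun _ _ ⟨_, _, h⟩ => ⟨h.pos, h.n⟩) (fun i s hi ⟨ℓ, hlt, h⟩ =>
      (recordOcc_runs hw hB hi hlt h).seq fun s' hs' => closeArch_runs hw hB hi hs') hs₁
    (Nat.zero_le _)).mono le_rfl fun s' ⟨ℓ, hlt, h⟩ => ?_
  obtain rfl : ℓ = F.k := h.k_le.eq_of_not_lt fun hℓ =>
    (hlt hℓ).not_ge (F.archEnd_le_length _)
  exact h.holdsArches

end

namespace ArchFactorization

variable {w : List ℕ} {F : ArchFactorization w} {ℓ i j t : ℕ}

theorem mem_lastSet_iff_of_lt_k (hℓ : ℓ + 1 < F.k) (hj : letterAt w j ∈ w) :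
    j ∈ F.lastSet (ℓ + 1) ↔
      F.lastPosArch (ℓ + 1) (letterAt w j) = j ∧
        0 < F.leqCount (ℓ + 1 + 1) (F.firstPosArch (ℓ + 1 + 1) (letterAt w j)) := by
  rw [mem_lastSet_iff (by omega), mem_filteredLetters_iff_not_hasAbsentAfter hℓ hj, not_not,
    hasAbsentAfter_iff hℓ (inArch_firstPosArch hℓ hj).2, leqCount_pos_iff]
  exact (and_iff_right hj).trans and_comm

theorem mem_lastSet_k_iff (hℓ : ℓ + 1 = F.k) (hj : letterAt w j ∈ w) :
    j ∈ F.lastSet (ℓ + 1) ↔ F.lastPosArch (ℓ + 1) (letterAt w j) = j ∧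
      lastOcc w w.length (letterAt w j) ≤ F.archEnd (ℓ + 1) := by
  rw [mem_lastSet_iff (by omega), hℓ, mem_filteredLetters_k, mem_rest_iff_lt_lastOcc, not_lt]
  exact (and_iff_right hj).trans and_comm

theorem lexArr_mem_lastSet (ht : 0 < t) (ht' : t ≤ (F.sortedLast ℓ).length) :
    F.lexArr ℓ t ∈ F.lastSet ℓ := by
  refine F.mem_sortedLast.1 (List.mem_of_mem_take (argmin_getD_mem fun h => ?_))
  have := congrArg List.length h
  rw [List.length_take_of_le ht', List.length_nil] at this
  omega

theorem lexArr_leqCount_add_one (hi : i + 1 ∈ F.lastSet ℓ) :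
    F.lexArr ℓ (F.leqCount ℓ i + 1) = if F.leqCount ℓ i = 0 then i + 1
      else if letterAt w (i + 1) < letterAt w (F.lexArr ℓ (F.leqCount ℓ i)) then i + 1
      else F.lexArr ℓ (F.leqCount ℓ i) := by
  have hcount : F.leqCount ℓ (i + 1) = F.leqCount ℓ i + 1 := by rw [leqCount_add_one, if_pos hi]
  have hlen : F.leqCount ℓ (i + 1) ≤ (F.sortedLast ℓ).length := F.leqCount_le_length
  rw [lexArr_add_one F (by omega), ← hcount, F.letterAt_sortedLast_leqCount hi]

end ArchFactorization

section

open RamProg RamExpr RegName ArrName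

/-- Decides whether the next position of the arch with index `level` belongs to its set `L'`: the
register `keep` becomes `1` if it does and `0` if it does not. The rows of `Leq` for the later
arches are already in place. -/
def testPos : RamProg :=
  letter ≔ get word (pos + 1) ;;
  ite (level <ₑ k) (keep ≔ get leq (get firstPosArch (level * sigma + letter)))
    (keep ≔ (get .lastOcc letter <ₑ get archEnd k + 1)) ;;
  keep ≔ (0 <ₑ keep) * (get lastPosArch ((level - 1) * sigma + letter) =ₑ pos + 1)

/-- Moves to the next position and, if it is to be kept, appends it to the current row of
`sortedLast` and `Lex`; the register `count` is the length of the row, and `best` is its last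
entry in `Lex`. -/
def recordPos : RamProg :=
  pos ≔ pos + 1 ;;
  ite keep
    (ite (count =ₑ 0) (best ≔ pos) (ite (letter <ₑ get word best) (best ≔ pos) skip) ;;
      count ≔ count + 1 ;;
      store sortedLast ((level - 1) * sigma + count) pos ;;
      store lex ((level - 1) * sigma + count) best)
    skip ;;
  store leq pos count

/-- At the end of an arch, moves to the beginning of the preceding one. -/
def closeRow : RamProg :=
  ite (pos =ₑ get archEnd level)
    (store sortedLen level count ;;
      level ≔ level - 1 ;; pos ≔ get archEnd (level - 1) ;; count ≔ 0)
    skip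

/-- Computes the rows of `sortedLast`, `Leq` and `Lex`, from the last arch to the first one and from
left to right within an arch. -/
def rowsProg : RamProg :=
  (level ≔ k ;; pos ≔ get archEnd (level - 1) ;; count ≔ 0) ;;
  .while level (testPos ;; recordPos ;; closeRow)

end

/-- The memory holds the part of the row `ℓ + 1` of `sortedLast`, `Leq` and `Lex` that belongs to
the positions up to `i`. -/
structure HoldsRow (σ : ℕ) (w : List ℕ) (F : ArchFactorization w) (ℓ i : ℕ) (s : RamState) :
    Prop where
  leq : ∀ j, F.InArch (ℓ + 1) j → j ≤ i → s.arr .leq j = F.leqCount (ℓ + 1) j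
  sortedLast : ∀ t, 1 ≤ t → t ≤ F.leqCount (ℓ + 1) i →
    s.arr .sortedLast (ℓ * σ + t) = letterAt (F.sortedLast (ℓ + 1)) t
  lex : ∀ t, 1 ≤ t → t ≤ F.leqCount (ℓ + 1) i → s.arr .lex (ℓ * σ + t) = F.lexArr (ℓ + 1) t

/-- The memory holds the arches and the complete rows `ℓ + 1, …, k` of `sortedLast`, `Leq` and
`Lex`. -/
structure HoldsRowsFrom (σ : ℕ) (w : List ℕ) (F : ArchFactorization w) (ℓ : ℕ) (s : RamState) : Prop
    extends HoldsArches σ w F s where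
  row : ∀ m, ℓ ≤ m → m < F.k → HoldsRow σ w F m (F.archEnd (m + 1)) s
  sortedLen : ∀ m, ℓ ≤ m → m < F.k → s.arr .sortedLen (m + 1) = (F.sortedLast (m + 1)).length

/-- The state of the computation of the row `ℓ + 1` when the positions up to `i` are done. -/
structure RowState (σ : ℕ) (w : List ℕ) (F : ArchFactorization w) (ℓ i : ℕ) (s : RamState) : Prop
    extends HoldsRowsFrom σ w F (ℓ + 1) s where
  lt_k : ℓ < F.k
  archEnd_le : F.archEnd ℓ ≤ i
  le_archEnd : i ≤ F.archEnd (ℓ + 1)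
  level : s.reg .level = ℓ + 1
  pos : s.reg .pos = i
  count : s.reg .count = F.leqCount (ℓ + 1) i
  best : 0 < F.leqCount (ℓ + 1) i → s.reg .best = F.lexArr (ℓ + 1) (F.leqCount (ℓ + 1) i)
  current : HoldsRow σ w F ℓ i s

/-- The invariant of `rowsProg`: the number of positions of `ar(1) ⋯ ar(k)` that are not yet
processed is `m`. -/
def RowsInvariant (σ : ℕ) (w : List ℕ) (F : ArchFactorization w) (m : ℕ) (s : RamState) : Prop :=
  (m = 0 ∧ s.reg .level = 0 ∧ HoldsRowsFrom σ w F 0 s) ∨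
    ∃ ℓ i, i < F.archEnd (ℓ + 1) ∧ m + i = F.archEnd (ℓ + 1) + F.archEnd ℓ ∧ RowState σ w F ℓ i s

section

variable {B σ ℓ i : ℕ} {w : List ℕ} {F : ArchFactorization w} {s s' : RamState} {p : RamProg}

open ArchFactorization RamProg

theorem Exec.holdsArches (h : Exec B p s s') (hs : HoldsArches σ w F s)
    (hreg : ∀ x ∈ [RegName.n, .sigma, .k], x ∉ p.assignedRegs)
    (harr : ∀ A ∈ [ArrName.word, .archEnd, .firstPosArch, .lastPosArch, .lastOcc],
      A ∉ p.storedArrs) : HoldsArches σ w F s' where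
  toHoldsInput := h.holdsInput hs.toHoldsInput (hreg _ (by simp)) (hreg _ (by simp))
    (harr _ (by simp))
  k := (h.reg_eq (hreg _ (by simp))).trans hs.k
  archEnd := h.arr_eq (harr .archEnd (by simp)) ▸ hs.archEnd
  firstPosArch := h.arr_eq (harr .firstPosArch (by simp)) ▸ hs.firstPosArch
  lastPosArch := h.arr_eq (harr .lastPosArch (by simp)) ▸ hs.lastPosArch
  lastOcc := h.arr_eq (harr .lastOcc (by simp)) ▸ hs.lastOcc

theorem HoldsRow.congr (h : HoldsRow σ w F ℓ i s) (hleq : s'.arr .leq = s.arr .leq)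
    (hsorted : s'.arr .sortedLast = s.arr .sortedLast) (hlex : s'.arr .lex = s.arr .lex) :
    HoldsRow σ w F ℓ i s' where
  leq := hleq ▸ h.leq
  sortedLast := hsorted ▸ h.sortedLast
  lex := hlex ▸ h.lex

theorem HoldsRowsFrom.tick (h : HoldsRowsFrom σ w F ℓ s) (t : ℕ) :
    HoldsRowsFrom σ w F ℓ (s.tick t) :=
  { h with row := fun m hm hmk => (h.row m hm hmk).congr rfl rfl rfl }

theorem RowState.tick (h : RowState σ w F ℓ i s) (t : ℕ) : RowState σ w F ℓ i (s.tick t) :=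
  { h with
    toHoldsRowsFrom := h.toHoldsRowsFrom.tick t
    current := h.current.congr rfl rfl rfl }

theorem RowsInvariant.tick {m : ℕ} (h : RowsInvariant σ w F m s) (t : ℕ) :
    RowsInvariant σ w F m (s.tick t) :=
  h.imp (fun ⟨hm, hlevel, hrows⟩ => ⟨hm, hlevel, hrows.tick t⟩)
    fun ⟨ℓ, i, hi, hm, hrow⟩ => ⟨ℓ, i, hi, hm, hrow.tick t⟩

theorem RowState.of_exec_testPos (h : RowState σ w F ℓ i s) (hexec : Exec B testPos s s') :
    RowState σ w F ℓ i s' := by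
  have harr (A : ArrName) : s'.arr A = s.arr A :=
    hexec.arr_eq (by simp [testPos, storedArrs])
  have hreg {x : RegName} (hx : x ≠ .letter) (hx' : x ≠ .keep) : s'.reg x = s.reg x :=
    hexec.reg_eq (by simp [testPos, assignedRegs, hx, hx'])
  exact
    { h with
      toHoldsArches := hexec.holdsArches h.toHoldsArches (by simp [testPos, assignedRegs])
        (by simp [testPos, storedArrs])
      row := fun m hm hmk => (h.row m hm hmk).congr (harr _) (harr _) (harr _)
      sortedLen := harr .sortedLen ▸ h.sortedLen
      level := (hreg (by simp) (by simp)).trans h.level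
      pos := (hreg (by simp) (by simp)).trans h.pos
      count := (hreg (by simp) (by simp)).trans h.count
      best := fun hpos => (hreg (by simp) (by simp)).trans (h.best hpos)
      current := h.current.congr (harr _) (harr _) (harr _) }

theorem testPos_safe_and_values_of_lt_k (hw : IsWordOver σ w) (hB : 2 * w.length ≤ B)
    (hi : i < F.archEnd (ℓ + 1)) (h : RowState σ w F ℓ i s) (hℓk : ℓ + 1 < F.k) :
    testPos.Safe B s ∧ (testPos.run s).reg .letter = letterAt w (i + 1) ∧
      (testPos.run s).reg .keep = if i + 1 ∈ F.lastSet (ℓ + 1) then 1 else 0 := by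
  have hσ := F.one_le_of_isWordOver hw
  have hkw := F.k_le_length hw
  have hℓ := h.lt_k
  have hiw : i + 1 ≤ w.length := hi.trans_le (F.archEnd_le_length _)
  have ha : letterAt w (i + 1) ∈ w := letterAt_mem (Nat.le_add_left 1 i) hiw
  have haσ := (hw _).1 ha
  have hletter := h.word (i + 1) (Nat.le_add_left 1 i) hiw
  have hlast := h.lastPosArch ℓ hℓ _ ha
  have hlast_le := (inArch_lastPosArch hℓ ha).le_length
  have hσw := mul_add_le_length hw F.k_pos le_rfl
  have hcell := mul_add_le_length hw hℓ haσ.2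
  have hfirst := h.firstPosArch (ℓ + 1) hℓk _ ha
  have hin := inArch_firstPosArch hℓk ha
  have hin_le := hin.le_length
  have hleq := (h.row (ℓ + 1) le_rfl hℓk).leq _ hin hin.2
  have hleq_le : F.leqCount (ℓ + 1 + 1) (F.firstPosArch (ℓ + 1 + 1) (letterAt w (i + 1))) ≤ σ :=
    F.leqCount_le_length.trans (length_sortedLast_le hw)
  have hcell' := mul_add_le_length hw hℓk haσ.2
  have hcell₀' := mul_add_le_length hw hℓk (Nat.zero_le σ)
  have hvalue := mem_lastSet_iff_of_lt_k hℓk ha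
  refine ⟨?_, ?_, ?_⟩
  · simp (disch := first | omega | simp) [testPos, h.pos, h.k, h.sigma, h.level, hletter, hfirst,
      hleq, hlast, hℓk, hB.trans', ite_one_zero_le]
    split_ifs <;> omega
  · simp [testPos, h.pos, h.k, h.sigma, h.level, hletter, hℓk]
  · simp [testPos, h.pos, h.k, h.sigma, h.level, hletter, hfirst, hleq, hlast, hℓk, hvalue,
      ite_and]

theorem testPos_safe_and_values_of_eq_k (hw : IsWordOver σ w) (hB : 2 * w.length ≤ B)
    (hi : i < F.archEnd (ℓ + 1)) (h : RowState σ w F ℓ i s) (hℓk : ℓ + 1 = F.k) :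
    testPos.Safe B s ∧ (testPos.run s).reg .letter = letterAt w (i + 1) ∧
      (testPos.run s).reg .keep = if i + 1 ∈ F.lastSet (ℓ + 1) then 1 else 0 := by
  have hσ := F.one_le_of_isWordOver hw
  have hkw := F.k_le_length hw
  have hℓ := h.lt_k
  have hiw : i + 1 ≤ w.length := hi.trans_le (F.archEnd_le_length _)
  have ha : letterAt w (i + 1) ∈ w := letterAt_mem (Nat.le_add_left 1 i) hiw
  have haσ := (hw _).1 ha
  have hletter := h.word (i + 1) (Nat.le_add_left 1 i) hiw
  have hlast := h.lastPosArch ℓ hℓ _ ha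
  have hlast_le := (inArch_lastPosArch hℓ ha).le_length
  have hσw := mul_add_le_length hw F.k_pos le_rfl
  have hcell := mul_add_le_length hw hℓ haσ.2
  have hocc := h.lastOcc _ ha
  have hocc_le : lastOcc w w.length (letterAt w (i + 1)) ≤ w.length := lastOcc_le
  have hk := h.k.trans hℓk.symm
  have hend := h.archEnd (ℓ + 1) hℓk.le
  have hend_le := F.archEnd_le_length (ℓ + 1)
  have hvalue := mem_lastSet_k_iff hℓk ha
  refine ⟨?_, ?_, ?_⟩
  · simp (disch := first | omega | simp) [testPos, h.pos, hk, h.sigma, h.level, hletter, hocc,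
      hend, hlast, hB.trans', ite_one_zero_le]
    split_ifs <;> omega
  · simp [testPos, h.pos, hk, h.sigma, h.level, hletter]
  · simp [testPos, h.pos, hk, h.sigma, h.level, hletter, hocc, hend, hlast, hvalue, ite_and]
    split_ifs <;> omega

theorem testPos_runs (hw : IsWordOver σ w) (hB : 2 * w.length ≤ B) (hi : i < F.archEnd (ℓ + 1))
    (h : RowState σ w F ℓ i s) :
    RunsIn B testPos.maxCost testPos s fun s' => RowState σ w F ℓ i s' ∧
      s'.reg .letter = letterAt w (i + 1) ∧
      s'.reg .keep = if i + 1 ∈ F.lastSet (ℓ + 1) then 1 else 0 := by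
  obtain ⟨hsafe, hvalues⟩ := (show ℓ + 1 ≤ F.k from h.lt_k).lt_or_eq.elim
    (testPos_safe_and_values_of_lt_k hw hB hi h) (testPos_safe_and_values_of_eq_k hw hB hi h)
  exact .of_safe hsafe ⟨h.of_exec_testPos (exec_run hsafe), hvalues⟩

theorem RowState.lexArr_bounds (h : RowState σ w F ℓ i s) (hpos : 0 < F.leqCount (ℓ + 1) i) :
    1 ≤ F.lexArr (ℓ + 1) (F.leqCount (ℓ + 1) i) ∧
      F.lexArr (ℓ + 1) (F.leqCount (ℓ + 1) i) ≤ w.length := by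
  have hin := inArch_of_mem_lastSet h.lt_k (lexArr_mem_lastSet hpos F.leqCount_le_length)
  exact ⟨hin.pos, hin.le_length⟩

theorem recordPos_safe_and_values (hw : IsWordOver σ w) (hB : 2 * w.length ≤ B)
    (hi : i < F.archEnd (ℓ + 1)) (h : RowState σ w F ℓ i s)
    (hletter : s.reg .letter = letterAt w (i + 1))
    (hkeep : s.reg .keep = if i + 1 ∈ F.lastSet (ℓ + 1) then 1 else 0) :
    recordPos.Safe B s ∧ (recordPos.run s).reg .pos = i + 1 ∧
      (recordPos.run s).reg .count = F.leqCount (ℓ + 1) (i + 1) ∧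
      (0 < F.leqCount (ℓ + 1) (i + 1) → (recordPos.run s).reg .best =
        F.lexArr (ℓ + 1) (F.leqCount (ℓ + 1) (i + 1))) ∧
      (recordPos.run s).arr .leq =
        Function.update (s.arr .leq) (i + 1) (F.leqCount (ℓ + 1) (i + 1)) ∧
      (recordPos.run s).arr .sortedLast = (if i + 1 ∈ F.lastSet (ℓ + 1) then
        Function.update (s.arr .sortedLast) (ℓ * σ + F.leqCount (ℓ + 1) (i + 1)) (i + 1)
        else s.arr .sortedLast) ∧
      (recordPos.run s).arr .lex = (if i + 1 ∈ F.lastSet (ℓ + 1) then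
        Function.update (s.arr .lex) (ℓ * σ + F.leqCount (ℓ + 1) (i + 1))
          (F.lexArr (ℓ + 1) (F.leqCount (ℓ + 1) (i + 1)))
        else s.arr .lex) := by
  have hσ := F.one_le_of_isWordOver hw
  have hiw : i + 1 ≤ w.length := hi.trans_le (F.archEnd_le_length _)
  have hℓw : ℓ + 1 ≤ w.length := h.lt_k.trans_le (F.k_le_length hw)
  have hcell := mul_add_le_length hw h.lt_k le_rfl
  have hcount : F.leqCount (ℓ + 1) (i + 1) ≤ σ :=
    F.leqCount_le_length.trans (length_sortedLast_le hw)
  have hstep := F.leqCount_add_one (ℓ := ℓ + 1) (i := i)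
  by_cases hmem : i + 1 ∈ F.lastSet (ℓ + 1)
  · have hlex := lexArr_leqCount_add_one hmem
    rw [if_pos hmem] at hstep
    rw [if_pos hmem] at hkeep
    have haσ := (hw _).1 (letterAt_mem (Nat.le_add_left 1 i) hiw)
    by_cases hzero : F.leqCount (ℓ + 1) i = 0
    · rw [hzero, zero_add, if_pos rfl] at hlex
      simp [recordPos, h.pos, h.count, h.sigma, h.level, hkeep, hmem, hstep, hlex, hzero]
      omega
    · have hbounds := h.lexArr_bounds (Nat.pos_of_ne_zero hzero)
      have hbest := h.best (Nat.pos_of_ne_zero hzero)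
      have hword := h.word _ hbounds.1 hbounds.2
      have hbestσ := (hw _).1 (letterAt_mem hbounds.1 hbounds.2)
      by_cases hlt : letterAt w (i + 1) < letterAt w (F.lexArr (ℓ + 1) (F.leqCount (ℓ + 1) i)) <;>
      · simp [recordPos, h.pos, h.count, h.sigma, h.level, hletter, hkeep, hmem, hstep, hlex, hzero,
          hbest, hword, hlt]
        omega
  · rw [if_neg hmem] at hstep
    rw [if_neg hmem] at hkeep
    have hfits : (i ≤ B ∧ 1 ≤ B ∧ i < B) ∧ i < B ∧ F.leqCount (ℓ + 1) i ≤ B := by omega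
    simpa [recordPos, h.pos, h.count, hkeep, hmem, hstep] using ⟨hfits, h.best⟩

theorem update_row_of_lt {f : ℕ → ℕ} {m t u v : ℕ} (hw : IsWordOver σ w) (hm : ℓ < m) (ht : 1 ≤ t)
    (ht' : t ≤ F.leqCount (m + 1) u) :
    (if i + 1 ∈ F.lastSet (ℓ + 1) then
      Function.update f (ℓ * σ + F.leqCount (ℓ + 1) (i + 1)) v else f) (m * σ + t) =
      f (m * σ + t) := by
  split_ifs with hmem
  · have hcell := mul_add_eq_mul_add_iff (m := m) (ℓ := ℓ) (F.leqCount_pos_iff.2 ⟨_, hmem, le_rfl⟩)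
      (F.leqCount_le_length.trans (length_sortedLast_le hw)) ht
      (ht'.trans (F.leqCount_le_length.trans (length_sortedLast_le hw)))
    exact Function.update_of_ne (fun h => hm.ne (hcell.1 h.symm).1) _ _
  · rfl

theorem update_row_succ {f v : ℕ → ℕ}
    (h : ∀ t, 1 ≤ t → t ≤ F.leqCount (ℓ + 1) i → f (ℓ * σ + t) = v t) {t : ℕ} (ht : 1 ≤ t)
    (ht' : t ≤ F.leqCount (ℓ + 1) (i + 1)) :
    (if i + 1 ∈ F.lastSet (ℓ + 1) then Function.update f
      (ℓ * σ + F.leqCount (ℓ + 1) (i + 1)) (v (F.leqCount (ℓ + 1) (i + 1))) else f) (ℓ * σ + t) =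
      v t := by
  have hstep := F.leqCount_add_one (ℓ := ℓ + 1) (i := i)
  split_ifs with hmem
  · rw [if_pos hmem] at hstep
    rcases ht'.eq_or_lt with rfl | hlt
    · exact Function.update_self _ _ _
    · rw [Function.update_of_ne (by omega)]
      exact h t ht (by omega)
  · rw [if_neg hmem] at hstep
    exact h t ht (by omega)

theorem recordPos_runs (hw : IsWordOver σ w) (hB : 2 * w.length ≤ B)
    (hi : i < F.archEnd (ℓ + 1)) (h : RowState σ w F ℓ i s)
    (hletter : s.reg .letter = letterAt w (i + 1))
    (hkeep : s.reg .keep = if i + 1 ∈ F.lastSet (ℓ + 1) then 1 else 0) :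
    RunsIn B recordPos.maxCost recordPos s (RowState σ w F ℓ (i + 1)) := by
  obtain ⟨hsafe, hpos, hcount, hbest, hleq, hsorted, hlex⟩ :=
    recordPos_safe_and_values hw hB hi h hletter hkeep
  have hexec := exec_run hsafe
  refine .of_safe hsafe
    { toHoldsArches := hexec.holdsArches h.toHoldsArches (by simp [recordPos, assignedRegs])
        (by simp [recordPos, storedArrs])
      row := fun m hm hmk =>
        { leq := fun j hj hjm => ?_
          sortedLast := fun t ht ht' => ?_
          lex := fun t ht ht' => ?_ }
      sortedLen := hexec.arr_eq (A := .sortedLen) (by simp [recordPos, storedArrs]) ▸ h.sortedLen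
      lt_k := h.lt_k
      archEnd_le := h.archEnd_le.trans (Nat.le_succ i)
      le_archEnd := hi
      level := (hexec.reg_eq (by simp [recordPos, assignedRegs])).trans h.level
      pos := hpos
      count := hcount
      best := hbest
      current :=
        { leq := fun j hj hji => ?_
          sortedLast := fun t ht ht' => ?_
          lex := fun t ht ht' => ?_ } }
  · have hne : j ≠ i + 1 := ((F.archEnd_mono hm).trans_lt hj.1 |>.trans_le' hi).ne'
    rw [hleq, Function.update_of_ne hne, (h.row m hm hmk).leq j hj hjm]
  · rw [hsorted, update_row_of_lt hw hm ht ht', (h.row m hm hmk).sortedLast t ht ht']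
  · rw [hlex, update_row_of_lt hw hm ht ht', (h.row m hm hmk).lex t ht ht']
  · rw [hleq]
    rcases hji.eq_or_lt with rfl | hlt
    · exact Function.update_self _ _ _
    · rw [Function.update_of_ne hlt.ne, h.current.leq j hj (Nat.lt_succ_iff.1 hlt)]
  · rw [hsorted, ← update_row_succ h.current.sortedLast ht ht']
    split_ifs with hmem
    · rw [F.letterAt_sortedLast_leqCount hmem]
    · rfl
  · rw [hlex, update_row_succ h.current.lex ht ht']

theorem RowState.holdsRowsFrom_of_exec_closeRow (h : RowState σ w F ℓ (F.archEnd (ℓ + 1)) s)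
    (hexec : Exec B closeRow s s')
    (hlen : s'.arr .sortedLen =
      Function.update (s.arr .sortedLen) (ℓ + 1) (F.leqCount (ℓ + 1) (F.archEnd (ℓ + 1)))) :
    HoldsRowsFrom σ w F ℓ s' := by
  have harr {A : ArrName} (hA : A ≠ .sortedLen) : s'.arr A = s.arr A :=
    hexec.arr_eq (by simpa [closeRow, storedArrs] using hA)
  have hrow {m : ℕ} (hm : ℓ ≤ m) (hmk : m < F.k) : HoldsRow σ w F m (F.archEnd (m + 1)) s := by
    rcases hm.eq_or_lt with rfl | hlt
    · exact h.current
    · exact h.row m hlt hmk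
  refine
    { toHoldsArches := hexec.holdsArches h.toHoldsArches (by simp [closeRow, assignedRegs])
        (by simp [closeRow, storedArrs])
      row := fun m hm hmk =>
        (hrow hm hmk).congr (harr (by simp)) (harr (by simp)) (harr (by simp))
      sortedLen := fun m hm hmk => ?_ }
  rw [hlen]
  rcases hm.eq_or_lt with rfl | hlt
  · rw [Function.update_self, leqCount_archEnd_succ F hmk]
  · rw [Function.update_of_ne (by omega), h.sortedLen m hlt hmk]

theorem HoldsRowsFrom.rowState_start (h : HoldsRowsFrom σ w F (ℓ + 1) s) (hℓ : ℓ < F.k)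
    (hlevel : s.reg .level = ℓ + 1) (hpos : s.reg .pos = F.archEnd ℓ) (hcount : s.reg .count = 0) :
    RowState σ w F ℓ (F.archEnd ℓ) s :=
  have hzero := F.leqCount_archEnd hℓ
  { h with
    lt_k := hℓ
    archEnd_le := le_rfl
    le_archEnd := F.archEnd_mono (Nat.le_succ ℓ)
    level := hlevel
    pos := hpos
    count := hcount.trans hzero.symm
    best := fun hne => absurd hne (by omega)
    current :=
      { leq := fun j hj hji => absurd hj.1 hji.not_gt
        sortedLast := fun t ht ht' => absurd (ht.trans ht') (by omega)
        lex := fun t ht ht' => absurd (ht.trans ht') (by omega) } }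

theorem closeRow_runs (hw : IsWordOver σ w) (hB : 2 * w.length ≤ B) {m : ℕ}
    (hm : m + i = F.archEnd (ℓ + 1) + F.archEnd ℓ) (h : RowState σ w F ℓ i s) :
    RunsIn B closeRow.maxCost closeRow s (RowsInvariant σ w F m) := by
  have hkw := F.k_le_length hw
  have hℓk := h.lt_k
  have hend := h.archEnd (ℓ + 1) hℓk
  have hend_le := F.archEnd_le_length (ℓ + 1)
  have hi := h.le_archEnd
  rcases hi.lt_or_eq with hlt | rfl
  · have hrun : closeRow.run s = (s.tick 5).tick 1 := by
      simp [closeRow, h.pos, h.level, hend, hlt.ne, RamExpr.cost]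
    refine .of_safe ?_ (.inr ⟨ℓ, i, hlt, hm, hrun ▸ (h.tick 5).tick 1⟩)
    simp [closeRow, h.pos, h.level, hend, hlt.ne]
    omega
  have hcount : F.leqCount (ℓ + 1) (F.archEnd (ℓ + 1)) ≤ σ :=
    F.leqCount_le_length.trans (length_sortedLast_le hw)
  have hσw := mul_add_le_length hw F.k_pos le_rfl
  have hprev := h.archEnd (ℓ - 1) (by omega)
  have hprev_le := F.archEnd_le_length (ℓ - 1)
  obtain ⟨hsafe, hlevel, hpos, hzero, hlen⟩ : closeRow.Safe B s ∧
      (closeRow.run s).reg .level = ℓ ∧ (closeRow.run s).reg .pos = F.archEnd (ℓ - 1) ∧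
      (closeRow.run s).reg .count = 0 ∧ (closeRow.run s).arr .sortedLen =
        Function.update (s.arr .sortedLen) (ℓ + 1) (F.leqCount (ℓ + 1) (F.archEnd (ℓ + 1))) := by
    simp [closeRow, h.pos, h.level, h.count, hend, hprev]
    omega
  have hrows := h.holdsRowsFrom_of_exec_closeRow (exec_run hsafe) hlen
  refine .of_safe hsafe ?_
  rcases ℓ with _ | ℓ
  · exact .inl ⟨by rw [F.archEnd_zero] at hm; omega, hlevel, hrows⟩
  · exact .inr ⟨ℓ, F.archEnd ℓ, F.archEnd_lt_succ (by omega), by omega,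
      hrows.rowState_start (by omega) hlevel hpos hzero⟩

theorem RowsInvariant.level_le {m : ℕ} (h : RowsInvariant σ w F m s) : s.reg .level ≤ F.k := by
  rcases h with ⟨-, hlevel, -⟩ | ⟨ℓ, i, -, -, h⟩
  · exact hlevel ▸ Nat.zero_le _
  · exact h.level ▸ h.lt_k

theorem RowsInvariant.level_eq_zero_iff {m : ℕ} (h : RowsInvariant σ w F m s) :
    s.reg .level = 0 ↔ m = 0 := by
  rcases h with ⟨rfl, hlevel, -⟩ | ⟨ℓ, i, hi, hm, h⟩
  · exact iff_of_true hlevel rfl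
  · exact iff_of_false (by rw [h.level]; omega) (by omega)

theorem RowsInvariant.step_runs {m : ℕ} (hw : IsWordOver σ w) (hB : 2 * w.length ≤ B)
    (h : RowsInvariant σ w F (m + 1) s) :
    RunsIn B (testPos.maxCost + (recordPos.maxCost + closeRow.maxCost))
      (testPos ;; recordPos ;; closeRow) s (RowsInvariant σ w F m) := by
  obtain ⟨hm, -⟩ | ⟨ℓ, i, hi, hm, hrow⟩ := h
  · exact absurd hm (Nat.succ_ne_zero m)
  exact (testPos_runs hw hB hi hrow).seq fun _ ⟨h, hletter, hkeep⟩ =>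
    (recordPos_runs hw hB hi h hletter hkeep).seq fun _ h => closeRow_runs hw hB (by omega) h

theorem rowsProg_runs (hw : IsWordOver σ w) (hB : 2 * w.length ≤ B) (h : HoldsArches σ w F s) :
    RunsIn B (9 + (w.length * (2 + (testPos.maxCost + (recordPos.maxCost + closeRow.maxCost)))
      + 2)) rowsProg s (HoldsRowsFrom σ w F 0) := by
  have hk := F.k_pos
  have hkw := F.k_le_length hw
  have hend := h.archEnd (F.k - 1) (by omega)
  have hend_le := F.archEnd_le_length (F.k - 1)
  have hsucc : F.k - 1 + 1 = F.k := by omega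
  let start : RamProg :=
    .level ≔ RegName.k ;; .pos ≔ .get .archEnd (RegName.level - 1) ;; .count ≔ 0
  obtain ⟨hsafe, hlevel, hpos, hcount⟩ : start.Safe B s ∧ (start.run s).reg .level = F.k ∧
      (start.run s).reg .pos = F.archEnd (F.k - 1) ∧ (start.run s).reg .count = 0 := by
    simp [start, h.k, hend]
    omega
  have hrows : HoldsRowsFrom σ w F (F.k - 1 + 1) (start.run s) :=
    { toHoldsArches := (exec_run hsafe).holdsArches h (by simp [start, assignedRegs])
        (by simp [start, storedArrs])
      row := fun m hm hmk => by omega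
      sortedLen := fun m hm hmk => by omega }
  have hstart : RowsInvariant σ w F (F.archEnd F.k) (start.run s) :=
    .inr ⟨F.k - 1, F.archEnd (F.k - 1), F.archEnd_lt_succ (by omega), by rw [hsucc],
      hrows.rowState_start (by omega) (hlevel.trans hsucc.symm) hpos hcount⟩
  refine ((RunsIn.of_safe hsafe hstart).seq fun s₁ hs₁ => RunsIn.while (fun _ _ t hI => hI.tick t)
    (fun m s hI => ?_) (fun _ _ hI => hI.level_eq_zero_iff) (fun _ _ hI => hI.step_runs hw hB)
    hs₁).mono ?_ fun s' hI => ?_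
  · exact hI.level_le.trans (by omega)
  · exact Nat.add_le_add_left (Nat.add_le_add_right
      (Nat.mul_le_mul_right _ (F.archEnd_le_length _)) _) _
  · rcases hI with ⟨-, -, hrows⟩ | ⟨ℓ, i, hi, hm, -⟩
    · exact hrows
    · omega

end

theorem sort_Icc_one (n : ℕ) : (Finset.Icc 1 n).sort (· ≤ ·) = List.range' 1 n :=
  have hset : (List.range' 1 n).toFinset = Finset.Icc 1 n := by
    ext a
    simp [Nat.lt_one_add_iff]
  hset ▸ (List.toFinset_sort _ List.nodup_range').2 (List.sortedLE_range' 1 n 1).pairwise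

namespace ArchFactorization

variable {w : List ℕ} {F : ArchFactorization w} {σ a : ℕ}

theorem distArr_firstPosArch_one_eq_iff (ha : a ∈ w) :
    distArr w (F.firstPosArch 1 a) = F.k + 1 ↔ 0 < F.leqCount 1 (F.firstPosArch 1 a) := by
  have hin : F.InArch (0 + 1) (F.firstPosArch 1 a) := inArch_firstPosArch F.k_pos ha
  have hdist : distArr w (F.firstPosArch 1 a) = F.k + 1 ↔
      HasAbsentAfter w (F.firstPosArch 1 a) F.k := distArr_eq_iff hin
  rw [hdist, leqCount_pos_iff]
  exact hasAbsentAfter_iff F.k_pos hin.2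

variable (F) in
/-- The part of `startSAS` that belongs to the letters `1, …, a`. -/
noncomputable def startUpTo (a : ℕ) : List ℕ :=
  ((List.range' 1 a).map (F.firstPosArch 1)).filter (0 < F.leqCount 1 ·)

theorem startUpTo_add_one : F.startUpTo (a + 1) = F.startUpTo a ++
    if 0 < F.leqCount 1 (F.firstPosArch 1 (a + 1)) then [F.firstPosArch 1 (a + 1)] else [] := by
  rw [startUpTo, List.range'_concat, List.map_append, List.filter_append, ← startUpTo, one_mul,
    add_comm 1 a, List.map_singleton, List.filter_singleton]
  simp

theorem startUpTo_eq_startSAS (hw : IsWordOver σ w) : F.startUpTo σ = F.startSAS := by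
  rw [startSAS, hw.toFinset_eq, sort_Icc_one]
  refine List.filter_congr fun j hj => ?_
  obtain ⟨a, ha, rfl⟩ := List.mem_map.1 hj
  have haw : a ∈ w := (hw a).2 (by rw [List.mem_range'_1] at ha; omega)
  exact decide_eq_decide.2 (distArr_firstPosArch_one_eq_iff haw).symm

theorem length_startUpTo_le : (F.startUpTo a).length ≤ a := by
  simpa [startUpTo] using List.length_filter_le _ ((List.range' 1 a).map (F.firstPosArch 1))

end ArchFactorization

section

open RamProg RamExpr RegName ArrName

/-- Moves to the next letter and appends its first position to `startSAS` if the shortest absent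
subsequences may start there. -/
def recordStart : RamProg :=
  count ≔ count + 1 ;;
  pos ≔ get firstPosArch count ;;
  ite (get leq pos) (startLen ≔ startLen + 1 ;; store startSAS startLen pos) skip

/-- Computes `startSAS` and `init` from the first row of `Leq`. -/
def startProg : RamProg :=
  (count ≔ 0 ;; startLen ≔ 0) ;; .while (count <ₑ sigma) recordStart ;; init ≔ get startSAS 1

/-- Computes all the data from the word. -/
def preprocessProg : RamProg :=
  clearLastOcc ;; scanProg ;; rowsProg ;; startProg

end

/-- The state of the computation of `startSAS` when the letters up to `a` are done. -/
structure StartState (σ : ℕ) (w : List ℕ) (F : ArchFactorization w) (a : ℕ) (s : RamState) : Prop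
    extends HoldsRowsFrom σ w F 0 s where
  count : s.reg .count = a
  startLen : s.reg .startLen = (F.startUpTo a).length
  startSAS : ∀ t, 1 ≤ t → t ≤ (F.startUpTo a).length →
    s.arr .startSAS t = letterAt (F.startUpTo a) t

section

variable {B σ ℓ a : ℕ} {w : List ℕ} {F : ArchFactorization w} {s s' : RamState} {p : RamProg}

open ArchFactorization RamProg

theorem Exec.holdsRowsFrom (h : Exec B p s s') (hs : HoldsRowsFrom σ w F ℓ s)
    (hreg : ∀ x ∈ [RegName.n, .sigma, .k], x ∉ p.assignedRegs)
    (harr : ∀ A ∈ [ArrName.word, .archEnd, .firstPosArch, .lastPosArch, .lastOcc, .leq,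
      .sortedLast, .lex, .sortedLen], A ∉ p.storedArrs) : HoldsRowsFrom σ w F ℓ s' where
  toHoldsArches := h.holdsArches hs.toHoldsArches hreg fun A hA => harr A <| by
    simp only [List.mem_cons, List.not_mem_nil, or_false] at hA ⊢
    tauto
  row m hm hmk := (hs.row m hm hmk).congr (h.arr_eq (harr _ (by simp)))
    (h.arr_eq (harr _ (by simp))) (h.arr_eq (harr _ (by simp)))
  sortedLen := h.arr_eq (harr .sortedLen (by simp)) ▸ hs.sortedLen

theorem recordStart_safe_and_values (hw : IsWordOver σ w) (hB : 2 * w.length ≤ B) (ha : a < σ)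
    (h : StartState σ w F a s) :
    recordStart.Safe B s ∧ (recordStart.run s).reg .count = a + 1 ∧
      (recordStart.run s).reg .startLen = (F.startUpTo (a + 1)).length ∧
      (recordStart.run s).arr .startSAS = if F.startUpTo (a + 1) = F.startUpTo a
        then s.arr .startSAS
        else Function.update (s.arr .startSAS) (F.startUpTo (a + 1)).length
          (F.firstPosArch 1 (a + 1)) := by
  have haw : a + 1 ∈ w := (hw _).2 (by omega)
  have hσw := mul_add_le_length hw F.k_pos le_rfl
  have hin : F.InArch (0 + 1) (F.firstPosArch 1 (a + 1)) := inArch_firstPosArch F.k_pos haw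
  have hfirst := h.firstPosArch 0 F.k_pos _ haw
  have hleq := (h.row 0 le_rfl F.k_pos).leq _ hin hin.2
  have hleq_le : F.leqCount 1 (F.firstPosArch 1 (a + 1)) ≤ σ :=
    F.leqCount_le_length.trans (length_sortedLast_le hw)
  have hin_le := hin.le_length
  have hlen : (F.startUpTo a).length ≤ a := length_startUpTo_le
  rw [zero_mul, zero_add] at hfirst
  rw [zero_add] at hleq
  rw [startUpTo_add_one]
  by_cases hzero : F.leqCount 1 (F.firstPosArch 1 (a + 1)) = 0 <;>
  · simp [recordStart, h.count, h.startLen, hfirst, hleq, hzero, Nat.pos_iff_ne_zero]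
    omega

theorem recordStart_runs (hw : IsWordOver σ w) (hB : 2 * w.length ≤ B) (ha : a < σ)
    (h : StartState σ w F a s) :
    RunsIn B recordStart.maxCost recordStart s (StartState σ w F (a + 1)) := by
  obtain ⟨hsafe, hcount, hlen, hstart⟩ := recordStart_safe_and_values hw hB ha h
  refine .of_safe hsafe
    { toHoldsRowsFrom := (exec_run hsafe).holdsRowsFrom h.toHoldsRowsFrom
        (by simp [recordStart, assignedRegs]) (by simp [recordStart, storedArrs])
      count := hcount
      startLen := hlen
      startSAS := fun t ht ht' => ?_ }
  rw [hstart]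
  rw [startUpTo_add_one] at ht' ⊢
  split_ifs at ht' ⊢ with hpos hself
  · simp at hself
  · rw [List.length_append, List.length_singleton] at ht' ⊢
    rcases ht'.eq_or_lt with rfl | hlt
    · simp [letterAt]
    · rw [Function.update_of_ne hlt.ne, h.startSAS t ht (by omega),
        ← letterAt_take (L := F.startUpTo a ++ _) ht (Nat.lt_succ_iff.1 hlt), List.take_left]
  · rw [List.append_nil] at ht' ⊢
    exact h.startSAS t ht ht'
  · simp_all

theorem StartState.tick (h : StartState σ w F a s) (t : ℕ) : StartState σ w F a (s.tick t) :=
  { h with toHoldsRowsFrom := h.toHoldsRowsFrom.tick t }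

theorem HoldsRowsFrom.holdsData (hw : IsWordOver σ w) (h : HoldsRowsFrom σ w F 0 s)
    (hlen : s.reg .startLen = F.startSAS.length)
    (hstart : ∀ t, 1 ≤ t → t ≤ F.startSAS.length → s.arr .startSAS t = letterAt F.startSAS t)
    (hinit : s.reg .init = F.init) : HoldsData σ w F s :=
  have hrow {ℓ : ℕ} (hℓ : 1 ≤ ℓ) (hℓk : ℓ ≤ F.k) : HoldsRow σ w F (ℓ - 1) (F.archEnd ℓ) s := by
    simpa only [Nat.sub_add_cancel hℓ] using h.row (ℓ - 1) (Nat.zero_le _) (by omega)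
  have hcount {ℓ : ℕ} (hℓ : 1 ≤ ℓ) (hℓk : ℓ ≤ F.k) :
      (F.sortedLast ℓ).length = F.leqCount (ℓ - 1 + 1) (F.archEnd ℓ) := by
    simpa only [Nat.sub_add_cancel hℓ] using
      (leqCount_archEnd_succ F (show ℓ - 1 < F.k by omega)).symm
  { toHoldsInput := h.toHoldsInput
    k := h.k
    archEnd := h.archEnd
    firstPosArch := fun ℓ a hℓ hℓk ha haσ => by
      simpa only [cell, Nat.sub_add_cancel hℓ] using
        h.firstPosArch (ℓ - 1) (by omega) a ((hw a).2 ⟨ha, haσ⟩)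
    lastPosArch := fun ℓ a hℓ hℓk ha haσ => by
      simpa only [cell, Nat.sub_add_cancel hℓ] using
        h.lastPosArch (ℓ - 1) (by omega) a ((hw a).2 ⟨ha, haσ⟩)
    sortedLen := fun ℓ hℓ hℓk => by
      simpa only [Nat.sub_add_cancel hℓ] using h.sortedLen (ℓ - 1) (Nat.zero_le _) (by omega)
    sortedLast := fun ℓ t hℓ hℓk ht ht' => by
      simpa only [cell, Nat.sub_add_cancel hℓ] using
        (hrow hℓ hℓk).sortedLast t ht (ht'.trans_eq (hcount hℓ hℓk))
    leq := fun ℓ i hℓ hℓk hi => by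
      simpa only [leqCount, Nat.sub_add_cancel hℓ] using
        (hrow hℓ hℓk).leq i (by rwa [Nat.sub_add_cancel hℓ]) hi.2
    lex := fun ℓ t hℓ hℓk ht ht' => by
      simpa only [cell, Nat.sub_add_cancel hℓ] using
        (hrow hℓ hℓk).lex t ht (ht'.trans_eq (hcount hℓ hℓk))
    startLen := hlen
    startSAS := hstart
    init := hinit }

theorem startProg_runs (hw : IsWordOver σ w) (hB : 2 * w.length ≤ B)
    (h : HoldsRowsFrom σ w F 0 s) :
    RunsIn B (4 + ((σ - 0) * (4 + recordStart.maxCost) + 4 + 3)) startProg s (HoldsData σ w F) := by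
  have hσ := F.one_le_of_isWordOver hw
  have hσw := mul_add_le_length hw F.k_pos le_rfl
  let start : RamProg := .count ≔ 0 ;; .startLen ≔ 0
  have hsafe : start.Safe B s := by simp [start]
  have hstart : StartState σ w F 0 (start.run s) :=
    { toHoldsRowsFrom := (exec_run hsafe).holdsRowsFrom h (by simp [start, assignedRegs])
        (by simp [start, storedArrs])
      count := by simp [start]
      startLen := by simp [start, startUpTo]
      startSAS := fun t ht ht' => absurd (ht.trans ht') (by simp [startUpTo]) }
  refine (RunsIn.of_safe hsafe hstart).seq fun s₁ hs₁ => (RunsIn.while_lt (by omega) (by omega)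
    (fun _ _ t hs => hs.tick t) (fun _ _ hs => ⟨hs.count, hs.sigma⟩)
    (fun _ _ ha hs => recordStart_runs hw hB ha hs) hs₁ (Nat.zero_le σ)).seq fun s₂ hs₂ => ?_
  have hlen := hs₂.startLen
  have hentries := hs₂.startSAS
  rw [startUpTo_eq_startSAS hw] at hlen hentries
  have hpos : 1 ≤ F.startSAS.length := List.length_pos_iff.2 startSAS_ne_nil
  have hfirst : s₂.arr .startSAS 1 = F.init := (hentries 1 le_rfl hpos).trans init_eq_head.symm
  have hinit_le : F.init ≤ w.length := by
    obtain ⟨_, _, hin⟩ := exists_inArch_of_mem_choices (Nat.zero_le _) F.init_mem_startSAS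
    exact hin.le_length
  have hsafe₂ : (.init ≔ .get .startSAS 1 : RamProg).Safe B s₂ := by
    simp [hfirst]
    omega
  refine .of_safe hsafe₂ (((exec_run hsafe₂).holdsRowsFrom hs₂.toHoldsRowsFrom
    (by simp [assignedRegs]) (by simp [storedArrs])).holdsData hw ?_ ?_ ?_)
  · simpa using hlen
  · simpa using hentries
  · simpa using hfirst

theorem preprocessProg_runs (hw : IsWordOver σ w) (hB : 2 * w.length ≤ B) (hs : HoldsInput σ w s) :
    RunsIn B (221 * w.length) preprocessProg s (HoldsData σ w F) := by
  have hσ := F.one_le_of_isWordOver hw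
  have hσw := mul_add_le_length hw F.k_pos le_rfl
  refine ((clearLastOcc_runs (by omega) (by omega) hs).seq fun s₁ h₁ =>
    (scanProg_runs hw hB h₁.1 h₁.2).seq fun s₂ h₂ => (rowsProg_runs hw hB h₂).seq fun s₃ h₃ =>
    startProg_runs hw hB h₃).mono ?_ fun _ h => h
  have hscan : 4 + (recordOcc.maxCost + closeArch.maxCost) = 51 := rfl
  have hrows : 2 + (testPos.maxCost + (recordPos.maxCost + closeRow.maxCost)) = 97 := rfl
  have hstart : 4 + recordStart.maxCost = 21 := rfl
  rw [hscan, hrows, hstart]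
  omega

end

theorem mainTheorem5 :
    ∃ (preprocess check lexMin enumerate : RamProg) (c C : ℕ) (delay : Polynomial ℕ),
      ∀ (σ : ℕ) (w : List ℕ) (F : ArchFactorization w), 1 ≤ σ → IsWordOver σ w →
        -- linear-time preprocessing
        (∀ s, s.Fresh → HoldsInput σ w s →
          ∃ s', Exec (c * w.length) preprocess s s' ∧ HoldsData σ w F s' ∧
            s'.time ≤ C * w.length) ∧
        -- checking a word of length `k + 1` in time `O(k)`
        (∀ (u : List ℕ), u.length = F.k + 1 → (∀ a ∈ u, a ∈ w) →
          ∀ s, s.Fresh → HoldsData σ w F s → HoldsQuery u s →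
            ∃ s', Exec (c * w.length) check s s' ∧ HoldsData σ w F s' ∧
              s'.time ≤ C * F.k ∧
              (IsSAS w u → s'.reg .ans = 1) ∧ (¬ IsSAS w u → s'.reg .ans = 0)) ∧
        -- the lexicographically smallest SAS in time `O(k)`
        (∀ s, s.Fresh → HoldsData σ w F s →
          ∃ s', Exec (c * w.length) lexMin s s' ∧ HoldsData σ w F s' ∧
            s'.time ≤ C * F.k ∧ s'.cur = [] ∧
            ∃ (u : List ℕ) (t : ℕ), s'.out = [(u, t)] ∧ IsSAS w u ∧
              ∀ v, IsSAS w v → u ≤ v) ∧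
        -- enumeration of all SAS, each exactly once, with polynomial delay
        (∀ s, s.Fresh → HoldsData σ w F s →
          ∃ s', Exec (c * w.length) enumerate s s' ∧ HoldsData σ w F s' ∧
            s'.cur = [] ∧ (s'.out.map Prod.fst).Nodup ∧
            (∀ v, v ∈ s'.out.map Prod.fst ↔ IsSAS w v) ∧
            DelayAtMost (delay.eval w.length) s') := by
  refine ⟨preprocessProg, checkProg, lexMinProg, enumProg, 2, 221,
    (11 * .X + 51) * (2 * .X + 4), fun σ w F _ hw => ⟨fun s hs hinput => ?_,
      fun u hu hletters s hs hdata hquery => ?_, fun s hs hdata => ?_, fun s hs hdata => ?_⟩⟩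
  · obtain ⟨s', hexec, htime, hdata⟩ := preprocessProg_runs (F := F) hw le_rfl hinput
    exact ⟨s', hexec, hdata, by rwa [hs.1, zero_add] at htime⟩
  · obtain ⟨s', hexec, htime, hdata, hans⟩ := checkProg_runs hw le_rfl hu hletters hdata hquery
    exact ⟨s', hexec, hdata, by have := hs.1; omega, hans⟩
  · obtain ⟨s', hexec, htime, hdata, hcur, t, hout⟩ :=
      lexMinProg_runs hw le_rfl hdata hs.2.1 hs.2.2
    exact ⟨s', hexec, hdata, by have := hs.1; omega, hcur, _, t, hout, F.isSAS_lexWord,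
      fun _ => F.lexWord_le_of_isSAS⟩
  · obtain ⟨s', hexec, hdata, hcur, hout, hdelay⟩ :=
      enumProg_runs hw le_rfl hdata hs.1 hs.2.1 hs.2.2
    have hkw := F.k_le_length hw
    refine ⟨s', hexec, hdata, hcur, hout ▸ F.nodup_sasWords le_rfl,
      fun v => hout ▸ F.mem_sasWords_startSAS_iff, hdelay.mono ?_⟩
    simp only [Polynomial.eval_mul, Polynomial.eval_add, Polynomial.eval_X, Polynomial.eval_ofNat]
    gcongr
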